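/- Let $(M^n,g)$, $n\ge 4$, be a smooth (not necessarily complete) Riemannian manifold with Levi-Civita connection $\nabla$ and Ricci tensor $r$, and let $f:M\to\mathbb{R}$ be smooth with $$\nabla df=-r+\lambda g$$ for some constant $\lambda\in\mathbb{R}$ (a gradient Ricci soliton). Assume that $(M,g)$ has harmonic Weyl curvature, i.e. the divergence of its Weyl tensor vanishes. An *adapted frame field* on an open set $U\subset M$ on which $\nabla f\neq 0$ is a family of smooth orthonormal vector fields $F_1,\dots,F_n$ on $U$ with $F_1=\nabla f/|\nabla f|$ and $r(F_i,\cdot)=\lambda_i\,g(F_i,\cdot)$ for functions $\lambda_1,\dots,\lambda_n:U\to\mathbb{R}$. Put $\zeta_i=g(F_i,\nabla_{F_i}F_1)$ for $i\ge 2$. The frame field is *refined* if there are $c\in\mathbb{R}$, $\varepsilon>0$ and a smooth local flow $\theta_t$ of $\nabla f/|\nabla f|$, defined on an open subset of $M\times\mathbb{R}$ containing $W\times(-\varepsilon,\varepsilon)$, where $W=U\cap f^{-1}(c)$, such that $$U=\{\theta_t(p): p\in W,\ |t|<\varepsilon\}$$ and, for all $p\in W$, $|t|<\varepsilon$ and $i\ge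 2$, $$F_i(\theta_t(p))=e^{-\int_0^t\zeta_i(\theta_v(p))\,dv}\,(\theta_t)_*\bigl(F_i(p)\bigr).$$ Then for every refined adapted frame field $F_1,\dots,F_n$ on an open set $U\subset M$ and every point $x\in U$, there are fewer than three distinct numbers among $\lambda_2(x),\dots,\lambda_n(x)$. -/

import Mathlib

open Manifold Bundle
open scoped ContDiff

noncomputable section

namespace RicciSoliton

section Coordinates

/-! Tensor calculus in coordinates, for a metric with component matrix `G y = (g_ij(y))` at the
point with coordinates `y`.  Sign conventions: `R(X,Y)Z = ∇_X ∇_Y Z - ∇_Y ∇_X Z - ∇_[X,Y] Z`, and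
the Ricci tensor is the trace of `X ↦ R(X,Y)Z` (positive on round spheres). -/

variable {n : ℕ}

/-- The partial derivative `∂u/∂y_i`. -/
def pderiv (i : Fin n) (u : EuclideanSpace ℝ (Fin n) → ℝ) (y : EuclideanSpace ℝ (Fin n)) : ℝ :=
  fderiv ℝ u y (EuclideanSpace.single i 1)

/-- The Christoffel symbol `Γ^k_ij`. -/
def christoffel (G : EuclideanSpace ℝ (Fin n) → Matrix (Fin n) (Fin n) ℝ)
    (y : EuclideanSpace ℝ (Fin n)) (k i j : Fin n) : ℝ :=
  1 / 2 * ∑ l, (G y)⁻¹ k l * (pderiv i (fun z => G z j l) y + pderiv j (fun z => G z i l) y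
    - pderiv l (fun z => G z i j) y)

/-- The coefficient of `∂_l` in `R(∂_i,∂_j)∂_k`. -/
def riemannUp (G : EuclideanSpace ℝ (Fin n) → Matrix (Fin n) (Fin n) ℝ)
    (y : EuclideanSpace ℝ (Fin n)) (i j k l : Fin n) : ℝ :=
  pderiv i (fun z => christoffel G z l j k) y - pderiv j (fun z => christoffel G z l i k) y
    + ∑ m, (christoffel G y l i m * christoffel G y m j k
      - christoffel G y l j m * christoffel G y m i k)

/-- `R_ijkl = g(R(∂_i,∂_j)∂_k, ∂_l)`. -/
def riemann (G : EuclideanSpace ℝ (Fin n) → Matrix (Fin n) (Fin n) ℝ)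
    (y : EuclideanSpace ℝ (Fin n)) (i j k l : Fin n) : ℝ :=
  ∑ m, riemannUp G y i j k m * G y m l

/-- The components `r_jk` of the Ricci tensor. -/
def ricciCoord (G : EuclideanSpace ℝ (Fin n) → Matrix (Fin n) (Fin n) ℝ)
    (y : EuclideanSpace ℝ (Fin n)) (j k : Fin n) : ℝ :=
  ∑ i, riemannUp G y i j k i

/-- The scalar curvature. -/
def scalarCoord (G : EuclideanSpace ℝ (Fin n) → Matrix (Fin n) (Fin n) ℝ)
    (y : EuclideanSpace ℝ (Fin n)) : ℝ :=
  ∑ j, ∑ k, (G y)⁻¹ j k * ricciCoord G y j k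

/-- The components `W_ijkl` of the Weyl tensor (in dimension `n ≥ 3`). -/
def weyl (G : EuclideanSpace ℝ (Fin n) → Matrix (Fin n) (Fin n) ℝ)
    (y : EuclideanSpace ℝ (Fin n)) (i j k l : Fin n) : ℝ :=
  riemann G y i j k l
    - 1 / ((n : ℝ) - 2) * (ricciCoord G y j k * G y i l + ricciCoord G y i l * G y j k
        - ricciCoord G y i k * G y j l - ricciCoord G y j l * G y i k)
    + scalarCoord G y / (((n : ℝ) - 1) * ((n : ℝ) - 2)) * (G y j k * G y i l - G y i k * G y j l)

/-- The components `∇_m W_ijkl` of the covariant derivative of the Weyl tensor. -/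
def covWeyl (G : EuclideanSpace ℝ (Fin n) → Matrix (Fin n) (Fin n) ℝ)
    (y : EuclideanSpace ℝ (Fin n)) (m i j k l : Fin n) : ℝ :=
  pderiv m (fun z => weyl G z i j k l) y
    - ∑ p, (christoffel G y p m i * weyl G y p j k l + christoffel G y p m j * weyl G y i p k l
      + christoffel G y p m k * weyl G y i j p l + christoffel G y p m l * weyl G y i j k p)

/-- The components `∑ g^{mi} ∇_m W_ijkl` of the divergence of the Weyl tensor. -/
def divWeyl (G : EuclideanSpace ℝ (Fin n) → Matrix (Fin n) (Fin n) ℝ)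
    (y : EuclideanSpace ℝ (Fin n)) (j k l : Fin n) : ℝ :=
  ∑ m, ∑ i, (G y)⁻¹ m i * covWeyl G y m i j k l

/-- The components `∂_i ∂_j u - Γ^k_ij ∂_k u` of the Hessian `∇ du`. -/
def hessCoord (G : EuclideanSpace ℝ (Fin n) → Matrix (Fin n) (Fin n) ℝ)
    (u : EuclideanSpace ℝ (Fin n) → ℝ) (y : EuclideanSpace ℝ (Fin n)) (i j : Fin n) : ℝ :=
  pderiv i (pderiv j u) y - ∑ k, christoffel G y k i j * pderiv k u y

end Coordinates

section Manifold

variable {n : ℕ} {M : Type*} [TopologicalSpace M] [ChartedSpace (EuclideanSpace ℝ (Fin n)) M]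

/-- The components of a tangent vector at `x` with respect to the coordinate fields of `φ`. -/
def vecCoord (φ : OpenPartialHomeomorph M (EuclideanSpace ℝ (Fin n))) (x : M)
    (v : TangentSpace (𝓡 n) x) : EuclideanSpace ℝ (Fin n) :=
  mfderiv (𝓡 n) (𝓡 n) φ x v

/-- The coordinate field `∂_i` of `φ`, at the point with coordinates `y`. -/
def coordField (φ : OpenPartialHomeomorph M (EuclideanSpace ℝ (Fin n)))
    (y : EuclideanSpace ℝ (Fin n)) (i : Fin n) : TangentSpace (𝓡 n) (φ.symm y) :=
  mfderiv (𝓡 n) (𝓡 n) φ.symm y (EuclideanSpace.single i (1 : ℝ) : EuclideanSpace ℝ (Fin n))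

variable [IsManifold (𝓡 n) ∞ M] [RiemannianBundle (fun x : M => TangentSpace (𝓡 n) x)]

/-- The component matrix `g_ij = g(∂_i, ∂_j)` of the Riemannian metric in the chart `φ`. -/
def metricCoord (φ : OpenPartialHomeomorph M (EuclideanSpace ℝ (Fin n)))
    (y : EuclideanSpace ℝ (Fin n)) : Matrix (Fin n) (Fin n) ℝ :=
  Matrix.of fun i j => inner ℝ (coordField φ y i) (coordField φ y j)

/-- The Ricci tensor evaluated at two tangent vectors at `x`, computed in the chart `φ`. -/
def ricci (φ : OpenPartialHomeomorph M (EuclideanSpace ℝ (Fin n))) (x : M)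
    (u v : TangentSpace (𝓡 n) x) : ℝ :=
  ∑ i, ∑ j, ricciCoord (metricCoord φ) (φ x) i j * vecCoord φ x u i * vecCoord φ x v j

/-- The Levi-Civita covariant derivative `∇_v Y` at `x` of a vector field `Y`, with components
`v(Y^k) + Γ^k_ij v^i Y^j` in the preferred chart at `x`. -/
def covDeriv (Y : ∀ x : M, TangentSpace (𝓡 n) x) (x : M) (v : TangentSpace (𝓡 n) x) :
    TangentSpace (𝓡 n) x :=
  let φ := chartAt (EuclideanSpace ℝ (Fin n)) x
  let c : EuclideanSpace ℝ (Fin n) → EuclideanSpace ℝ (Fin n) :=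
    fun y => vecCoord φ (φ.symm y) (Y (φ.symm y))
  let w : EuclideanSpace ℝ (Fin n) := WithLp.toLp 2 fun k =>
    fderiv ℝ (fun y => c y k) (φ x) (vecCoord φ x v)
      + ∑ i, ∑ j, christoffel (metricCoord φ) (φ x) k i j * vecCoord φ x v i * c (φ x) j
  (mfderiv (𝓡 n) (𝓡 n) φ x).inverse w

variable (n) in
/-- The gradient of `f`: the vector representing `df` with respect to the metric. -/
def grad (f : M → ℝ) (x : M) : TangentSpace (𝓡 n) x :=
  haveI : FiniteDimensional ℝ (TangentSpace (𝓡 n) x) :=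
    inferInstanceAs (FiniteDimensional ℝ (EuclideanSpace ℝ (Fin n)))
  haveI : CompleteSpace (TangentSpace (𝓡 n) x) := FiniteDimensional.complete ℝ _
  (InnerProductSpace.toDual ℝ (TangentSpace (𝓡 n) x)).symm (mfderiv (𝓡 n) 𝓘(ℝ, ℝ) f x)

variable (n) in
/-- The field `∇f / |∇f|`. -/
def unitGrad (f : M → ℝ) (x : M) : TangentSpace (𝓡 n) x :=
  ‖grad n f x‖⁻¹ • grad n f x

/-- `∇ df = - r + lam g`, as an identity of tensors, i.e. in all smooth charts. -/
structure IsGradientRicciSoliton (f : M → ℝ) (lam : ℝ) : Prop where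
  smooth : ContMDiff (𝓡 n) 𝓘(ℝ, ℝ) ∞ f
  equation : ∀ φ ∈ IsManifold.maximalAtlas (𝓡 n) ∞ M, ∀ y ∈ φ.target, ∀ i j : Fin n,
    hessCoord (metricCoord φ) (fun z => f (φ.symm z)) y i j
      = - ricciCoord (metricCoord φ) y i j + lam * metricCoord φ y i j

variable (n M) in
/-- The divergence of the Weyl tensor vanishes, i.e. its components in all smooth charts do. -/
def HasHarmonicWeyl : Prop :=
  ∀ φ ∈ IsManifold.maximalAtlas (𝓡 n) ∞ M, ∀ y ∈ φ.target, ∀ j k l : Fin n,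
    divWeyl (metricCoord φ) y j k l = 0

/-- `F` is an adapted frame field of `(M, g, f)` on the open set `U`, with Ricci eigenvalues `ev`:
`F_i` are smooth orthonormal fields on `U` with `r(F_i, ·) = ev_i g(F_i, ·)`, and the first of them
(index `0`) is `∇f / |∇f|`. -/
structure IsAdaptedFrame [NeZero n] (f : M → ℝ) (U : Set M)
    (F : Fin n → ∀ x : M, TangentSpace (𝓡 n) x) (ev : Fin n → M → ℝ) : Prop where
  isOpen : IsOpen U
  grad_ne_zero : ∀ x ∈ U, grad n f x ≠ 0
  smooth : ∀ i, ContMDiffOn (𝓡 n) (𝓡 n).tangent ∞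
    (fun x => (⟨x, F i x⟩ : TangentBundle (𝓡 n) M)) U
  orthonormal : ∀ x ∈ U, ∀ i j, inner ℝ (F i x) (F j x) = if i = j then (1 : ℝ) else 0
  first : ∀ x ∈ U, F 0 x = unitGrad n f x
  eigen : ∀ i, ∀ x ∈ U, ∀ φ ∈ IsManifold.maximalAtlas (𝓡 n) ∞ M, x ∈ φ.source →
    ∀ v : TangentSpace (𝓡 n) x, ricci φ x (F i x) v = ev i x * inner ℝ (F i x) v

/-- `ζ_i = g(F_i, ∇_{F_i} F_1)` (the first field has index `0`). -/
def zeta [NeZero n] (F : Fin n → ∀ x : M, TangentSpace (𝓡 n) x) (i : Fin n) (x : M) : ℝ :=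
  inner ℝ (F i x) (covDeriv (F 0) x (F i x))


/-- `θ` (with arguments the point and the time) is a local flow of the vector field `X`, defined on
the open set `D ⊆ M × ℝ` of points and times. -/
structure IsLocalFlow (X : ∀ x : M, TangentSpace (𝓡 n) x) (θ : M → ℝ → M) (D : Set (M × ℝ)) :
    Prop where
  isOpen : IsOpen D
  smooth : ContMDiffOn ((𝓡 n).prod 𝓘(ℝ, ℝ)) (𝓡 n) ∞ (fun q : M × ℝ => θ q.1 q.2) D
  initial : ∀ p, (p, (0 : ℝ)) ∈ D → θ p 0 = p
  integralCurve : ∀ p, IsMIntegralCurveOn (θ p) X {t | (p, t) ∈ D}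

/-- The adapted frame field `F` on `U` is refined: `U` is the union of the flow lines, for times in
`(-ε, ε)`, of `F_1 = ∇f / |∇f|` through the points of `W = U ∩ f⁻¹(c)`, and the other fields are
transported by the flow `θ` as `F_i(θ_t(p)) = exp(-∫_0^t ζ_i(θ_v(p)) dv) (θ_t)_* F_i(p)`. -/
structure IsRefinedAdaptedFrame [NeZero n] (f : M → ℝ) (U : Set M)
    (F : Fin n → ∀ x : M, TangentSpace (𝓡 n) x) (ev : Fin n → M → ℝ) : Prop
    extends IsAdaptedFrame f U F ev where
  refined : ∃ (c ε : ℝ) (θ : M → ℝ → M) (D : Set (M × ℝ)), 0 < ε ∧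
    IsLocalFlow (unitGrad n f) θ D ∧
    (U ∩ f ⁻¹' {c}) ×ˢ Set.Ioo (-ε) ε ⊆ D ∧
    (fun q : M × ℝ => θ q.1 q.2) '' ((U ∩ f ⁻¹' {c}) ×ˢ Set.Ioo (-ε) ε) = U ∧
    ∀ p ∈ U ∩ f ⁻¹' {c}, ∀ t ∈ Set.Ioo (-ε) ε, ∀ i : Fin n, i ≠ 0 →
      F i (θ p t) = Real.exp (-∫ v in (0 : ℝ)..t, zeta F i (θ p v)) •
        mfderiv (𝓡 n) (𝓡 n) (fun q => θ q t) p (F i p)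

end Manifold

end RicciSoliton

end

open Manifold Bundle
open scoped ContDiff

noncomputable section

namespace RicciSoliton

/-! ### Riccati equations and their linearisation y'' = -s y. -/

section LinearODE

open Set

variable {a b t₀ : ℝ}

/-! Put s = λ₁/(n-1), ψ = |∇f| and ζ_i = (λ - λ_i)/ψ, the principal curvatures of the level sets of
f; at a given point distinct λ_i mean distinct ζ_i. For n ≥ 4 a divergence-free Weyl tensor forces
the Cotton tensor to vanish. Together with the Ricci identity for f this determines every curvature
component with an entry F₁: R(a,b,c,F₁) = s (⟨F₁,a⟩⟨b,c⟩ - ⟨F₁,b⟩⟨a,c⟩) (`curv4_first`).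

The problem then reduces to ODEs along one integral curve of F₁. They are ψ' = λ - (n-1)s, ζ_i' =
-ζ_i² - s, and an equation for s' from the trace of the Ricci tensor. The quantities L_ij = K_ij +
ζ_i ζ_j (by the Gauss equation, the sectional curvatures of the level sets) satisfy L_ij' = -(ζ_i +
ζ_j) L_ij up to terms from the rotation of the frame inside the Ricci eigenspaces. These terms
cancel once L is summed over blocks of equal ζ. Finally, the sum of L_ij over j is a quadratic
polynomial in ζ_i with leading coefficient -1 and coefficients independent of i.

The substitution ζ = h'/h gives h'' = -s h, so h_x = u + x v for a fundamental system u, v, where x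
is the value of ζ at the base point. Block sums of L become constants divided by h_x h_y. If three
values x, y, z are distinct, the second divided difference of the trace relation removes its unknown
coefficients and leaves h_x h_y h_z Σ c_p/h_p = -1 (`divided_difference`). Comparing residues for
different triples shows that only p = x, y, z contribute (`coeff_eq_zero_of_residue`). Hence a
quadratic form in u, v is constant, and s is constant (`hasDerivAt_zero_of_quadratic_eq_one`).

For constant s = σ, the equation for s' becomes a relation between power sums of the ζ_i. If σ ≤ 0,
differentiating it twice makes a sum of squares nonpositive, so all ζ_i are roots of one quadratic.
If σ > 0, periodicity of the h_i forces ψ' = 0, and positivity of the power sums is violated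
(`not_three_distinct_of_const`). Both cases exclude three distinct values. -/

theorem eq_of_hasDerivAt_zero {f : ℝ → ℝ} (hf : ∀ t ∈ Ioo a b, HasDerivAt f 0 t)
    {t t' : ℝ} (ht : t ∈ Ioo a b) (ht' : t' ∈ Ioo a b) : f t = f t' :=
  isOpen_Ioo.is_const_of_deriv_eq_zero isPreconnected_Ioo
    (fun x hx => (hf x hx).differentiableAt.differentiableWithinAt)
    (fun x hx => (hf x hx).deriv) ht ht'

theorem hasDerivAt_zero_of_eqOn_const {f : ℝ → ℝ} {c f' : ℝ} (hf : ∀ t ∈ Ioo a b, f t = c)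
    {t : ℝ} (ht : t ∈ Ioo a b) (hd : HasDerivAt f f' t) : f' = 0 := by
  have h : f =ᶠ[nhds t] fun _ => c :=
    Filter.eventuallyEq_of_mem (isOpen_Ioo.mem_nhds ht) fun x hx => hf x hx
  exact hd.unique ((hasDerivAt_const t c).congr_of_eventuallyEq h)

/-- A solution of `y'' = - s y` with vanishing initial data vanishes, given a fundamental system
`u, v`. -/
theorem eq_zero_of_initial_zero {s u du v dv y dy : ℝ → ℝ} (ht₀ : t₀ ∈ Ioo a b)
    (hu : ∀ t ∈ Ioo a b, HasDerivAt u (du t) t) (hdu : ∀ t ∈ Ioo a b, HasDerivAt du (-s t * u t) t)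
    (hv : ∀ t ∈ Ioo a b, HasDerivAt v (dv t) t) (hdv : ∀ t ∈ Ioo a b, HasDerivAt dv (-s t * v t) t)
    (hy : ∀ t ∈ Ioo a b, HasDerivAt y (dy t) t) (hdy : ∀ t ∈ Ioo a b, HasDerivAt dy (-s t * y t) t)
    (hW : ∀ t ∈ Ioo a b, u t * dv t - v t * du t = 1) (h0 : y t₀ = 0) (h0' : dy t₀ = 0)
    {t : ℝ} (ht : t ∈ Ioo a b) : y t = 0 ∧ dy t = 0 := by
  have h1 : ∀ t ∈ Ioo a b, HasDerivAt (fun t => y t * du t - dy t * u t) 0 t := fun t ht => by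
    refine (((hy t ht).mul (hdu t ht)).sub ((hdy t ht).mul (hu t ht))).congr_deriv ?_
    ring
  have h2 : ∀ t ∈ Ioo a b, HasDerivAt (fun t => y t * dv t - dy t * v t) 0 t := fun t ht => by
    refine (((hy t ht).mul (hdv t ht)).sub ((hdy t ht).mul (hv t ht))).congr_deriv ?_
    ring
  have e1 := eq_of_hasDerivAt_zero h1 ht ht₀
  have e2 := eq_of_hasDerivAt_zero h2 ht ht₀
  simp only [h0, h0', zero_mul, sub_zero] at e1 e2
  have hw := hW t ht
  constructor
  · linear_combination (-y t) * hw - v t * e1 + u t * e2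
  · linear_combination (-dy t) * hw - dv t * e1 + du t * e2

/-- The substitution h = exp ∫ ζ turns a Riccati equation into a linear one; that h never vanishes
is what later allows division by u + x v. -/
theorem exists_exp_antideriv {ζ : ℝ → ℝ} (hζ : ContinuousOn ζ (Ioo a b)) (ht₀ : t₀ ∈ Ioo a b) :
    ∃ h : ℝ → ℝ, h t₀ = 1 ∧ (∀ t, h t ≠ 0) ∧ ∀ t ∈ Ioo a b, HasDerivAt h (ζ t * h t) t := by
  refine ⟨fun t => Real.exp (∫ x in t₀..t, ζ x), by simp, fun t => Real.exp_ne_zero _,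
    fun t ht => ?_⟩
  have hsub : Set.uIcc t₀ t ⊆ Ioo a b := ordConnected_Ioo.uIcc_subset ht₀ ht
  have h1 : HasDerivAt (fun t => ∫ x in t₀..t, ζ x) (ζ t) t :=
    intervalIntegral.integral_hasDerivAt_right ((hζ.mono hsub).intervalIntegrable)
      (hζ.stronglyMeasurableAtFilter isOpen_Ioo _ ht) (hζ.continuousAt (isOpen_Ioo.mem_nhds ht))
  exact h1.exp.congr_deriv (by ring)

/-- Data of solutions of Riccati equations `ζ' = - ζ² - s`: the solutions `h` of `h'' = - s h` with
`h' = ζ h` are combinations of a fundamental system. -/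
theorem exists_fundamental_system {ι : Type*} {s : ℝ → ℝ} {ζ : ι → ℝ → ℝ} (ht₀ : t₀ ∈ Ioo a b)
    (hζ : ∀ i, ∀ t ∈ Ioo a b, HasDerivAt (ζ i) (-(ζ i t) ^ 2 - s t) t)
    {i j : ι} (hij : ζ i t₀ ≠ ζ j t₀) :
    ∃ u du v dv : ℝ → ℝ, u t₀ = 1 ∧ du t₀ = 0 ∧ v t₀ = 0 ∧ dv t₀ = 1 ∧
      (∀ t ∈ Ioo a b, HasDerivAt u (du t) t) ∧ (∀ t ∈ Ioo a b, HasDerivAt du (-s t * u t) t) ∧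
      (∀ t ∈ Ioo a b, HasDerivAt v (dv t) t) ∧ (∀ t ∈ Ioo a b, HasDerivAt dv (-s t * v t) t) ∧
      (∀ t ∈ Ioo a b, u t * dv t - v t * du t = 1) ∧
      ∀ k, ∀ t ∈ Ioo a b, u t + ζ k t₀ * v t ≠ 0 ∧
        ζ k t * (u t + ζ k t₀ * v t) = du t + ζ k t₀ * dv t := by
  have hex : ∀ k, ∃ h : ℝ → ℝ, h t₀ = 1 ∧ (∀ t, h t ≠ 0) ∧
      ∀ t ∈ Ioo a b, HasDerivAt h (ζ k t * h t) t := fun k =>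
    exists_exp_antideriv (fun t ht => (hζ k t ht).continuousAt.continuousWithinAt) ht₀
  choose h h0 hne hd using hex
  have hd2 : ∀ k, ∀ t ∈ Ioo a b, HasDerivAt (fun t => ζ k t * h k t) (-s t * h k t) t :=
    fun k t ht => (((hζ k t ht).mul (hd k t ht))).congr_deriv (by ring)
  have hne' : ζ i t₀ - ζ j t₀ ≠ 0 := sub_ne_zero.2 hij
  -- Two solutions with value 1 and different slopes at `t₀` span the solution space; the factor c
  -- gives v slope 1 there.
  set c := (ζ i t₀ - ζ j t₀)⁻¹ with hc
  have hcc : c * (ζ i t₀ - ζ j t₀) = 1 := inv_mul_cancel₀ hne'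
  let v : ℝ → ℝ := fun t => c * (h i t - h j t)
  let dv : ℝ → ℝ := fun t => c * (ζ i t * h i t - ζ j t * h j t)
  let u : ℝ → ℝ := fun t => h i t - ζ i t₀ * v t
  let du : ℝ → ℝ := fun t => ζ i t * h i t - ζ i t₀ * dv t
  have hv : ∀ t ∈ Ioo a b, HasDerivAt v (dv t) t := fun t ht =>
    ((hd i t ht).sub (hd j t ht)).const_mul c
  have hdv : ∀ t ∈ Ioo a b, HasDerivAt dv (-s t * v t) t := fun t ht =>
    (((hd2 i t ht).sub (hd2 j t ht)).const_mul c).congr_deriv (by simp only [v]; ring)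
  have hu : ∀ t ∈ Ioo a b, HasDerivAt u (du t) t := fun t ht =>
    (hd i t ht).sub ((hv t ht).const_mul _)
  have hdu : ∀ t ∈ Ioo a b, HasDerivAt du (-s t * u t) t := fun t ht =>
    ((hd2 i t ht).sub ((hdv t ht).const_mul _)).congr_deriv (by simp only [u]; ring)
  have hv0 : v t₀ = 0 := by simp [v, h0]
  have hdv0 : dv t₀ = 1 := by simp only [dv, h0, mul_one]; exact hcc
  have hu0 : u t₀ = 1 := by simp [u, h0, hv0]
  have hdu0 : du t₀ = 0 := by simp [du, h0, hdv0]
  have hW : ∀ t ∈ Ioo a b, u t * dv t - v t * du t = 1 := fun t ht => by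
    have := eq_of_hasDerivAt_zero (f := fun t => u t * dv t - v t * du t) (fun t ht => by
      refine (((hu t ht).mul (hdv t ht)).sub ((hv t ht).mul (hdu t ht))).congr_deriv ?_
      ring) ht ht₀
    simpa [hu0, hdu0, hv0, hdv0] using this
  refine ⟨u, du, v, dv, hu0, hdu0, hv0, hdv0, hu, hdu, hv, hdv, hW, fun k t ht => ?_⟩
  -- Both `h k` and u + ζ_k(t₀) v solve the linear equation with the same initial data, so they
  -- coincide.
  have key := eq_zero_of_initial_zero (s := s) (y := fun t => h k t - (u t + ζ k t₀ * v t))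
    (dy := fun t => ζ k t * h k t - (du t + ζ k t₀ * dv t)) ht₀ hu hdu hv hdv
    (fun t ht => (hd k t ht).sub ((hu t ht).add ((hv t ht).const_mul _)))
    (fun t ht => ((hd2 k t ht).sub ((hdu t ht).add ((hdv t ht).const_mul _))).congr_deriv
      (by ring)) hW (by simp [h0, hu0, hv0]) (by simp [h0, hdu0, hdv0]) ht
  have k1 : u t + ζ k t₀ * v t = h k t := by linarith [key.1]
  exact ⟨k1 ▸ hne k t, by rw [k1]; linarith [key.2]⟩

end LinearODE

/-! ### Residue comparison for combinations of 1/(u + p v). -/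

section Interpolation

open Polynomial Finset

/-- Comparison of residues: for functions `h_x = u + x v` with nonconstant `v / u`, an identity
between combinations of the `1 / h_p` with factors `h_y` and `h_w` forces coefficients to vanish. -/
theorem coeff_eq_zero_of_residue {V : Finset ℝ} {T : Set ℝ} {u v : ℝ → ℝ} {c d : ℝ → ℝ} {y w κ : ℝ}
    (hκ : κ ∉ V) (hU : ∀ t ∈ T, u t + κ * v t ≠ 0)
    (hinf : ((fun t => v t / (u t + κ * v t)) '' T).Infinite)
    (hne : ∀ x ∈ V, ∀ t ∈ T, u t + x * v t ≠ 0) (hw : w ∈ V) (hyw : y ≠ w)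
    (h : ∀ t ∈ T, (u t + y * v t) * ∑ p ∈ V, c p / (u t + p * v t)
      = (u t + w * v t) * ∑ p ∈ V, d p / (u t + p * v t)) : c w = 0 := by
  -- In the variable z = v/(u + κv), the quotient (u + xv)/(u + κv) is the polynomial `l x`, of
  -- degree at most one. Since κ is not in V, each `l p` with p in V has a root. P is the hypothesis
  -- with denominators cleared.
  let l : ℝ → ℝ[X] := fun x => 1 + C (x - κ) * X
  let P : ℝ[X] := l y * ∑ p ∈ V, C (c p) * ∏ q ∈ V.erase p, l q
    - l w * ∑ p ∈ V, C (d p) * ∏ q ∈ V.erase p, l q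
  have hP : P = 0 := by
    refine Polynomial.eq_zero_of_infinite_isRoot P (hinf.mono ?_)
    rintro _ ⟨t, ht, rfl⟩
    have hU' := hU t ht
    set z := v t / (u t + κ * v t) with hz
    have hl : ∀ x, (l x).eval z = (u t + x * v t) / (u t + κ * v t) := fun x => by
      simp only [l, eval_add, eval_one, eval_mul, eval_C, eval_X, hz]
      field_simp
      ring
    have hprod : ∀ p ∈ V, ∏ q ∈ V.erase p, (l q).eval z
        = (∏ q ∈ V, (l q).eval z) * (u t + κ * v t) * (1 / (u t + p * v t)) := fun p hp => by
      rw [← Finset.mul_prod_erase V _ hp, hl p]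
      have h1 := hne p hp t ht
      generalize ∏ q ∈ V.erase p, (l q).eval z = Q
      rw [div_mul_eq_mul_div, div_mul_cancel₀ _ hU', mul_one_div, mul_div_cancel_left₀ _ h1]
    have hsum : ∀ c : ℝ → ℝ, (∑ p ∈ V, C (c p) * ∏ q ∈ V.erase p, l q).eval z
        = (∏ q ∈ V, (l q).eval z) * (u t + κ * v t) * ∑ p ∈ V, c p / (u t + p * v t) := fun c => by
      rw [eval_finsetSum, Finset.mul_sum]
      refine Finset.sum_congr rfl fun p hp => ?_
      rw [eval_mul, eval_C, eval_prod, hprod p hp]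
      ring
    change P.eval z = 0
    simp only [P, eval_sub, eval_mul, hsum, hl]
    have e : ∀ A Q S : ℝ, A / (u t + κ * v t) * (Q * (u t + κ * v t) * S) = Q * (A * S) :=
      fun A Q S => by
        rw [mul_right_comm Q, ← mul_assoc, mul_comm, ← mul_assoc, mul_div_cancel₀ _ hU']
        ring
    rw [e, e, h t ht, sub_self]
  -- At the root of `l w` the second half of P vanishes, and in the first half so does every summand
  -- except that of w.
  have hwκ : w - κ ≠ 0 := sub_ne_zero.2 fun h => hκ (h ▸ hw)
  set z : ℝ := -(w - κ)⁻¹ with hz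
  have hl : ∀ x, (l x).eval z = (w - x) * (w - κ)⁻¹ := fun x => by
    simp only [l, eval_add, eval_one, eval_mul, eval_C, eval_X, hz]
    field_simp
    ring
  have hsum : (∑ p ∈ V, C (c p) * ∏ q ∈ V.erase p, l q).eval z
      = c w * ∏ q ∈ V.erase w, (w - q) * (w - κ)⁻¹ := by
    rw [eval_finsetSum, Finset.sum_eq_single_of_mem w hw fun p hp hpw => ?_]
    · simp only [eval_mul, eval_C, eval_prod, hl]
    · rw [eval_mul, eval_prod, Finset.prod_eq_zero (Finset.mem_erase.2 ⟨hpw.symm, hw⟩)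
        (by simp [hl]),
        mul_zero]
  have h0 : P.eval z = 0 := by rw [hP, eval_zero]
  simp only [P, eval_sub, eval_mul, hsum, hl, sub_self, zero_mul, sub_zero] at h0
  have h1 : (w - y) * (w - κ)⁻¹ ≠ 0 := mul_ne_zero (sub_ne_zero.2 hyw.symm) (inv_ne_zero hwκ)
  have h2 : ∏ q ∈ V.erase w, (w - q) * (w - κ)⁻¹ ≠ 0 := Finset.prod_ne_zero_iff.2 fun q hq =>
    mul_ne_zero (sub_ne_zero.2 (Finset.ne_of_mem_erase hq).symm) (inv_ne_zero hwκ)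
  simpa [h1, h2] using h0

end Interpolation

/-! ### The case of constant s. -/

section ConstantPotential

open Set

variable {a b t₀ : ℝ}

/-- If a quadratic form in two solutions of `y'' = - s y` is the constant `1`, then `s' = 0`. -/
theorem hasDerivAt_zero_of_quadratic_eq_one {s u du v dv : ℝ → ℝ} {A B C : ℝ}
    (hu : ∀ t ∈ Ioo a b, HasDerivAt u (du t) t) (hdu : ∀ t ∈ Ioo a b, HasDerivAt du (-s t * u t) t)
    (hv : ∀ t ∈ Ioo a b, HasDerivAt v (dv t) t) (hdv : ∀ t ∈ Ioo a b, HasDerivAt dv (-s t * v t) t)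
    (hq : ∀ t ∈ Ioo a b, A * u t ^ 2 + B * (u t * v t) + C * v t ^ 2 = 1)
    {t : ℝ} (ht : t ∈ Ioo a b) : HasDerivAt s 0 t := by
  -- Let q be the quadratic form. Two differentiations of q(u,v) = 1 give s = q(u',v'); the
  -- derivative of the latter is -s times the once differentiated relation, hence zero.
  have h1 : ∀ t ∈ Ioo a b,
      2 * A * (u t * du t) + B * (du t * v t + u t * dv t) + 2 * C * (v t * dv t) = 0 :=
    fun t ht => hasDerivAt_zero_of_eqOn_const hq ht
      ((((((hu t ht).pow 2).const_mul A).add (((hu t ht).mul (hv t ht)).const_mul B)).add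
        (((hv t ht).pow 2).const_mul C)).congr_deriv (by norm_num; ring))
  have h2 : ∀ t ∈ Ioo a b, s t = A * du t ^ 2 + B * (du t * dv t) + C * dv t ^ 2 := fun t ht => by
    have := hasDerivAt_zero_of_eqOn_const h1 ht
      (((((hu t ht).mul (hdu t ht)).const_mul (2 * A)).add
        ((((hdu t ht).mul (hv t ht)).add ((hu t ht).mul (hdv t ht))).const_mul B)).add
        (((hv t ht).mul (hdv t ht)).const_mul (2 * C)))
    linear_combination (-1 / 2) * this - s t * hq t ht
  have h3 : HasDerivAt (fun t => A * du t ^ 2 + B * (du t * dv t) + C * dv t ^ 2) 0 t :=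
    (((((hdu t ht).pow 2).const_mul A).add (((hdu t ht).mul (hdv t ht)).const_mul B)).add
        (((hdv t ht).pow 2).const_mul C)).congr_deriv
        (by norm_num; linear_combination (-s t) * h1 t ht)
  exact h3.congr_of_eventuallyEq
    (Filter.eventuallyEq_of_mem (isOpen_Ioo.mem_nhds ht) fun x hx => h2 x hx)

variable {ι : Type*} [Fintype ι] {ζ : ι → ℝ → ℝ} {σ A : ℝ} {ψ : ℝ → ℝ}

theorem hasDerivAt_powerSum (hζ : ∀ i, ∀ t ∈ Ioo a b, HasDerivAt (ζ i) (-(ζ i t) ^ 2 - σ) t)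
    (k : ℕ) {t : ℝ} (ht : t ∈ Ioo a b) :
    HasDerivAt (fun t => ∑ i, ζ i t ^ (k + 1))
      (-(k + 1) * (∑ i, ζ i t ^ (k + 2) + σ * ∑ i, ζ i t ^ k)) t := by
  have := HasDerivAt.fun_sum (u := Finset.univ) fun i _ => (hζ i t ht).pow (k + 1)
  refine this.congr_deriv ?_
  rw [Finset.mul_sum, ← Finset.sum_add_distrib, Finset.mul_sum]
  refine Finset.sum_congr rfl fun i _ => ?_
  push_cast
  ring

/-- Two differentiations of the hypothesis, using P_k' = -k (P_{k+1} + σ P_{k-1}) for the power sums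
P_k and ψ' = A. -/
theorem powerSum_relations (hζ : ∀ i, ∀ t ∈ Ioo a b, HasDerivAt (ζ i) (-(ζ i t) ^ 2 - σ) t)
    (hψ : ∀ t ∈ Ioo a b, HasDerivAt ψ A t)
    (h1 : ∀ t ∈ Ioo a b, A * ∑ i, ζ i t = ψ t * (∑ i, ζ i t ^ 2 - Fintype.card ι * σ))
    {t : ℝ} (ht : t ∈ Ioo a b) :
    A * ∑ i, ζ i t ^ 2 = ψ t * (∑ i, ζ i t ^ 3 + σ * ∑ i, ζ i t) ∧
    3 * A * (∑ i, ζ i t ^ 3 + σ * ∑ i, ζ i t)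
      = ψ t * (3 * ∑ i, ζ i t ^ 4 + 4 * σ * ∑ i, ζ i t ^ 2 + Fintype.card ι * σ ^ 2) := by
  have d1 : ∀ t ∈ Ioo a b, HasDerivAt (fun t => ∑ i, ζ i t)
      (-(∑ i, ζ i t ^ 2) - Fintype.card ι * σ) t := fun t ht => by
    simpa [mul_comm, sub_eq_add_neg, add_comm] using hasDerivAt_powerSum hζ 0 ht
  have d2 : ∀ t ∈ Ioo a b, HasDerivAt (fun t => ∑ i, ζ i t ^ 2)
      (-2 * (∑ i, ζ i t ^ 3 + σ * ∑ i, ζ i t)) t := fun t ht =>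
    (hasDerivAt_powerSum hζ 1 ht).congr_deriv (by norm_num)
  have d3 : ∀ t ∈ Ioo a b, HasDerivAt (fun t => ∑ i, ζ i t ^ 3)
      (-3 * (∑ i, ζ i t ^ 4 + σ * ∑ i, ζ i t ^ 2)) t := fun t ht =>
    (hasDerivAt_powerSum hζ 2 ht).congr_deriv (by norm_num)
  have h2 : ∀ t ∈ Ioo a b,
      A * ∑ i, ζ i t ^ 2 - ψ t * (∑ i, ζ i t ^ 3 + σ * ∑ i, ζ i t) = 0 := fun t ht => by
    have := hasDerivAt_zero_of_eqOn_const (fun t ht => sub_eq_zero.2 (h1 t ht)) ht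
      (((d1 t ht).const_mul A).sub ((hψ t ht).mul ((d2 t ht).sub_const _)))
    linear_combination (-1 / 2) * this
  refine ⟨sub_eq_zero.1 (h2 t ht), ?_⟩
  have := hasDerivAt_zero_of_eqOn_const h2 ht
      (((d2 t ht).const_mul A).sub ((hψ t ht).mul ((d3 t ht).add ((d1 t ht).const_mul σ))))
  linear_combination (-1) * this

/-- With y the trigonometric solution and h = exp ∫ z, the product (y' - z y) h has zero derivative
and vanishes at `t₀`. This avoids dividing by y, whose zeros are not excluded beforehand. -/
theorem solution_trig (hσ : 0 < σ) (ht₀ : t₀ ∈ Ioo a b) {z : ℝ → ℝ}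
    (hz : ∀ t ∈ Ioo a b, HasDerivAt z (-(z t) ^ 2 - σ) t) {t : ℝ} (ht : t ∈ Ioo a b) :
    HasDerivAt (fun t => Real.cos (√σ * (t - t₀)) + z t₀ / √σ * Real.sin (√σ * (t - t₀)))
      (z t * (Real.cos (√σ * (t - t₀)) + z t₀ / √σ * Real.sin (√σ * (t - t₀)))) t := by
  have hk : √σ ≠ 0 := (Real.sqrt_pos.2 hσ).ne'
  have hk2 : √σ * √σ = σ := Real.mul_self_sqrt hσ.le
  obtain ⟨h, h0, hne, hd⟩ := exists_exp_antideriv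
    (fun t ht => (hz t ht).continuousAt.continuousWithinAt) ht₀
  set k := √σ
  let y : ℝ → ℝ := fun t => Real.cos (k * (t - t₀)) + z t₀ / k * Real.sin (k * (t - t₀))
  let dy : ℝ → ℝ := fun t => -k * Real.sin (k * (t - t₀)) + z t₀ * Real.cos (k * (t - t₀))
  have hlin : ∀ t, HasDerivAt (fun t => k * (t - t₀)) k t := fun t => by
    simpa using ((hasDerivAt_id t).sub_const t₀).const_mul k
  have hy : ∀ t, HasDerivAt y (dy t) t := fun t =>
    ((hlin t).cos.add ((hlin t).sin.const_mul (z t₀ / k))).congr_deriv (by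
      simp only [dy]; field_simp)
  have hdy : ∀ t, HasDerivAt dy (-σ * y t) t := fun t =>
    (((hlin t).sin.const_mul (-k)).add ((hlin t).cos.const_mul (z t₀))).congr_deriv (by
      simp only [y, ← hk2]; field_simp; ring)
  have hc : ∀ t ∈ Ioo a b, HasDerivAt (fun t => (dy t - z t * y t) * h t) 0 t := fun t ht =>
    (((hdy t).sub ((hz t ht).mul (hy t))).mul (hd t ht)).congr_deriv (by
      simp only [Pi.sub_apply, Pi.mul_apply]; ring)
  have := eq_of_hasDerivAt_zero hc ht ht₀
  have h00 : dy t₀ - z t₀ * y t₀ = 0 := by simp [dy, y]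
  rw [h00, zero_mul, mul_eq_zero, or_iff_left (hne t)] at this
  exact (hy t).congr_deriv (by linarith)

/-- For positive `σ`, the periodicity of the solutions of `h'' = - σ h` forces `ψ` to be constant.
    -/
theorem slope_eq_zero_of_pos [Nonempty ι] (hσ : 0 < σ) (ht₀ : t₀ ∈ Ioo a b)
    (hζ : ∀ i, ∀ t ∈ Ioo a b, HasDerivAt (ζ i) (-(ζ i t) ^ 2 - σ) t)
    (hψ : ∀ t ∈ Ioo a b, HasDerivAt ψ A t)
    (h1 : ∀ t ∈ Ioo a b, A * ∑ i, ζ i t = ψ t * (∑ i, ζ i t ^ 2 - Fintype.card ι * σ)) : A = 0 := by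
  have hk : 0 < √σ := Real.sqrt_pos.2 hσ
  have hN : (0 : ℝ) < Fintype.card ι := by exact_mod_cast Fintype.card_pos
  set N : ℝ := (Fintype.card ι : ℝ)
  let y : ι → ℝ → ℝ := fun i t =>
    Real.cos (√σ * (t - t₀)) + ζ i t₀ / √σ * Real.sin (√σ * (t - t₀))
  -- Each factor satisfies y_i' = ζ_i y_i, so P' = H P; unlike the ζ_i, P makes sense on the whole
  -- line.
  let P : ℝ → ℝ := fun t => ∏ i, y i t
  let H : ℝ → ℝ := fun t => ∑ i, ζ i t
  have hP : ∀ t ∈ Ioo a b, HasDerivAt P (H t * P t) t := fun t ht => by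
    classical
    refine (HasDerivAt.fun_finsetProd fun i _ => solution_trig hσ ht₀ (hζ i) ht).congr_deriv ?_
    simp only [H, P, Finset.sum_mul]
    refine Finset.sum_congr rfl fun i _ => ?_
    rw [← Finset.mul_prod_erase Finset.univ _ (Finset.mem_univ i), smul_eq_mul]
    ring
  have hψ0 : ∀ t ∈ Ioo a b, ψ t = ψ t₀ + A * (t - t₀) := fun t ht => by
    have := eq_of_hasDerivAt_zero (f := fun t => ψ t - A * (t - t₀)) (fun t ht =>
      ((hψ t ht).sub (((hasDerivAt_id t).sub_const t₀).const_mul A)).congr_deriv (by simp)) ht ht₀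
    simp only [sub_self, mul_zero, sub_zero] at this
    linarith
  have dH : ∀ t ∈ Ioo a b, HasDerivAt H (-(∑ i, ζ i t ^ 2) - N * σ) t := fun t ht => by
    simpa [mul_comm, sub_eq_add_neg, add_comm] using hasDerivAt_powerSum hζ 0 ht
  -- The hypothesis gives (ψH)' = -2Nσψ with ψ affine, so ψH is this quadratic polynomial.
  let q : ℝ → ℝ := fun t =>
    ψ t₀ * H t₀ - 2 * N * σ * ψ t₀ * (t - t₀) - N * σ * A * (t - t₀) ^ 2
  have hq : ∀ t ∈ Ioo a b, ψ t * H t = q t := fun t ht => by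
    have := eq_of_hasDerivAt_zero (f := fun t => ψ t * H t - q t) (fun t ht => by
      have hid := (hasDerivAt_id t).sub_const t₀
      refine (((hψ t ht).mul (dH t ht)).sub (((hid.const_mul (2 * N * σ * ψ t₀)).const_sub
        (ψ t₀ * H t₀)).sub ((hid.pow 2).const_mul (N * σ * A)))).congr_deriv ?_
      have e1 := h1 t ht
      have e2 := hψ0 t ht
      simp only [id, Nat.cast_ofNat, mul_one]
      norm_num
      linear_combination e1 - 2 * N * σ * e2) ht ht₀
    simp only [q, sub_self, mul_zero, sub_zero] at this ⊢
    norm_num at this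
    linarith
  have hyan : ∀ i, AnalyticOnNhd ℝ (y i) univ := fun i x _ => by
    have hl : AnalyticAt ℝ (fun t : ℝ => √σ * (t - t₀)) x := by fun_prop
    exact (Real.analyticAt_cos.comp hl).add (analyticAt_const.mul (Real.analyticAt_sin.comp hl))
  have hPan : AnalyticOnNhd ℝ P univ := fun x _ =>
    Finset.analyticAt_fun_prod _ fun i _ => hyan i x (mem_univ _)
  -- The relation ψP' = qP involves only functions analytic on ℝ, so it persists outside the
  -- interval.
  let Φ : ℝ → ℝ := fun t => (ψ t₀ + A * (t - t₀)) * deriv P t - q t * P t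
  have hΦan : AnalyticOnNhd ℝ Φ univ := fun x _ => by
    have h1 : AnalyticAt ℝ (fun t : ℝ => ψ t₀ + A * (t - t₀)) x := by fun_prop
    have h2 : AnalyticAt ℝ q x := by simp only [q]; fun_prop
    exact (h1.mul (hPan.deriv x (mem_univ _))).sub (h2.mul (hPan x (mem_univ _)))
  have hΦ : Φ = 0 := by
    refine AnalyticOnNhd.eq_of_eventuallyEq (z₀ := t₀) hΦan analyticOnNhd_const ?_
    refine Filter.eventuallyEq_of_mem (isOpen_Ioo.mem_nhds ht₀) fun t ht => ?_
    simp only [Φ, (hP t ht).deriv, Pi.zero_apply, ← hψ0 t ht, ← hq t ht]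
    ring
  let p : ℝ := 2 * Real.pi / √σ
  have hp : p ≠ 0 := by positivity
  have hper : Function.Periodic P p := fun t => by
    have : √σ * (t + p - t₀) = √σ * (t - t₀) + 2 * Real.pi := by
      simp only [p]; field_simp; ring
    simp only [P, y, this, Real.cos_add_two_pi, Real.sin_add_two_pi]
  have hper' : Function.Periodic (deriv P) p := fun t => by
    have : (fun t => P (t + p)) = P := funext hper
    rw [← deriv_comp_add_const, this]
  have hP0 : P t₀ = 1 := by simp [P, y]
  have hP1 : deriv P t₀ = H t₀ := by rw [(hP t₀ ht₀).deriv, hP0, mul_one]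
  -- P and P' take their initial values again one period away on either side. Adding the two
  -- identities cancels the terms linear in p and isolates N σ p² A.
  have e1 : Φ (t₀ + p) = 0 := congrFun hΦ _
  have e2 : Φ (t₀ - p) = 0 := congrFun hΦ _
  simp only [Φ, q, hper t₀, hper' t₀, hper.sub_eq, hper'.sub_eq, hP0, hP1] at e1 e2
  have : (N * σ * p ^ 2) * A = 0 := by linear_combination (e1 + e2) / 2
  exact (mul_eq_zero.1 this).resolve_left (by positivity)

/-- For σ ≤ 0 and ρ = A/ψ the relations make Σ (ζ_i² - ρζ_i - σ)² nonpositive, so the ζ_i are roots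
of one quadratic. For σ > 0 the slope A vanishes, and 3P₄ + 4σP₂ + Nσ² = 0 with P₂ = Nσ is
impossible by positivity. -/
theorem not_three_distinct_of_const [Nonempty ι] (ht₀ : t₀ ∈ Ioo a b)
    (hζ : ∀ i, ∀ t ∈ Ioo a b, HasDerivAt (ζ i) (-(ζ i t) ^ 2 - σ) t)
    (hψ : ∀ t ∈ Ioo a b, HasDerivAt ψ A t) (hψ0 : ψ t₀ ≠ 0)
    (h1 : ∀ t ∈ Ioo a b, A * ∑ i, ζ i t = ψ t * (∑ i, ζ i t ^ 2 - Fintype.card ι * σ))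
    {i j k : ι} (hij : ζ i t₀ ≠ ζ j t₀) (hjk : ζ j t₀ ≠ ζ k t₀) (hik : ζ i t₀ ≠ ζ k t₀) : False :=
        by
  obtain ⟨r2, r3⟩ := powerSum_relations hζ hψ h1 ht₀
  have r1 := h1 t₀ ht₀
  have hN : (0 : ℝ) < Fintype.card ι := by exact_mod_cast Fintype.card_pos
  rcases le_or_gt σ 0 with hσ | hσ
  · set ρ := A / ψ t₀ with hρ
    have hA : A = ρ * ψ t₀ := by rw [hρ, div_mul_cancel₀ _ hψ0]
    rw [hA] at r1 r2 r3
    have q1 : ρ * ∑ i, ζ i t₀ = ∑ i, ζ i t₀ ^ 2 - Fintype.card ι * σ :=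
      mul_left_cancel₀ hψ0 (by linear_combination r1)
    have q2 : ρ * ∑ i, ζ i t₀ ^ 2 = ∑ i, ζ i t₀ ^ 3 + σ * ∑ i, ζ i t₀ :=
      mul_left_cancel₀ hψ0 (by linear_combination r2)
    have q3 : 3 * ρ * (∑ i, ζ i t₀ ^ 3 + σ * ∑ i, ζ i t₀)
        = 3 * ∑ i, ζ i t₀ ^ 4 + 4 * σ * ∑ i, ζ i t₀ ^ 2 + Fintype.card ι * σ ^ 2 :=
      mul_left_cancel₀ hψ0 (by linear_combination r3)
    -- The combination 4σ q1 + ρ q2 - q3/3 eliminates the power sums of orders 1, 3 and 4; the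
    -- remaining terms are nonpositive because σ ≤ 0.
    have hsum : ∑ i, (ζ i t₀ ^ 2 - ρ * ζ i t₀ - σ) ^ 2
        = 2 / 3 * σ * ∑ i, ζ i t₀ ^ 2 - 10 / 3 * (Fintype.card ι * σ ^ 2) := by
      have : ∑ i, (ζ i t₀ ^ 2 - ρ * ζ i t₀ - σ) ^ 2 = ∑ i, ζ i t₀ ^ 4 - 2 * ρ * ∑ i, ζ i t₀ ^ 3
          + (ρ ^ 2 - 2 * σ) * ∑ i, ζ i t₀ ^ 2 + 2 * σ * ρ * ∑ i, ζ i t₀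
          + Fintype.card ι * σ ^ 2 := by
        rw [← nsmul_eq_mul, ← Finset.card_univ, ← Finset.sum_const]
        simp only [Finset.mul_sum, ← Finset.sum_add_distrib, ← Finset.sum_sub_distrib]
        exact Finset.sum_congr rfl fun i _ => by ring
      rw [this]
      linear_combination 4 * σ * q1 + ρ * q2 - q3 / 3
    have hle : ∑ i, (ζ i t₀ ^ 2 - ρ * ζ i t₀ - σ) ^ 2 ≤ 0 := by
      rw [hsum]
      have : 0 ≤ ∑ i, ζ i t₀ ^ 2 := Finset.sum_nonneg fun i _ => sq_nonneg _
      nlinarith [mul_nonneg (neg_nonneg.2 hσ) this, mul_nonneg hN.le (sq_nonneg σ)]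
    have hz : ∀ i, ζ i t₀ ^ 2 - ρ * ζ i t₀ - σ = 0 := fun i => by
      have h0 := (Finset.sum_eq_zero_iff_of_nonneg fun i _ => sq_nonneg _).1
        (le_antisymm hle (Finset.sum_nonneg fun i _ => sq_nonneg _)) i (Finset.mem_univ i)
      exact pow_eq_zero_iff two_ne_zero |>.1 h0
    have e1 : (ζ i t₀ + ζ j t₀ - ρ) = 0 := (mul_eq_zero.1 (by
      linear_combination hz i - hz j : (ζ i t₀ - ζ j t₀) * (ζ i t₀ + ζ j t₀ - ρ) = 0)).resolve_left
        (sub_ne_zero.2 hij)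
    have e2 : (ζ i t₀ + ζ k t₀ - ρ) = 0 := (mul_eq_zero.1 (by
      linear_combination hz i - hz k : (ζ i t₀ - ζ k t₀) * (ζ i t₀ + ζ k t₀ - ρ) = 0)).resolve_left
        (sub_ne_zero.2 hik)
    exact hjk (by linarith)
  · have hA := slope_eq_zero_of_pos hσ ht₀ hζ hψ h1
    rw [hA, zero_mul] at r1
    rw [hA, mul_zero, zero_mul] at r3
    have q1 := (mul_eq_zero.1 r1.symm).resolve_left hψ0
    have q3 := (mul_eq_zero.1 r3.symm).resolve_left hψ0
    have h4 : 0 ≤ ∑ i, ζ i t₀ ^ 4 := Finset.sum_nonneg fun i _ => by positivity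
    have : 0 < Fintype.card ι * σ ^ 2 := by positivity
    nlinarith

end ConstantPotential

/-! ### Block sums of the level-set curvatures, and reduction to constant s. -/

section Blocks

open Set

/-- Frame rotation is skew while the tensors it meets are symmetric. This removes the rotation terms
from block sums of curvature and makes frame contractions commute with covariant differentiation. -/
theorem sum_skew_mul_symm_eq_zero {κ : Type*} (B : Finset κ) (w S : κ → κ → ℝ)
    (hw : ∀ i k, w i k = -w k i) (hS : ∀ i k, S i k = S k i) :
    ∑ i ∈ B, ∑ k ∈ B, w i k * S i k = 0 := by
  have h : ∑ i ∈ B, ∑ k ∈ B, w i k * S i k = ∑ i ∈ B, ∑ k ∈ B, -(w i k * S i k) := by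
    conv_lhs => rw [Finset.sum_comm]
    refine Finset.sum_congr rfl fun i _ => Finset.sum_congr rfl fun k _ => ?_
    rw [hw, hS]; ring
  simp only [Finset.sum_neg_distrib] at h
  linarith

variable {a b t₀ : ℝ} {ι : Type*} [Fintype ι]

/-- Supplies the infinitely many evaluation points needed in `coeff_eq_zero_of_residue`: near `t₀`
the denominator is close to 1, and the quotient is strictly increasing because the Wronskian is 1.
-/
theorem exists_infinite_image {u du v dv : ℝ → ℝ} (V : Finset ℝ) (ht₀ : t₀ ∈ Ioo a b)
    (hu0 : u t₀ = 1) (hv0 : v t₀ = 0)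
    (hu : ∀ t ∈ Ioo a b, HasDerivAt u (du t) t) (hv : ∀ t ∈ Ioo a b, HasDerivAt v (dv t) t)
    (hW : ∀ t ∈ Ioo a b, u t * dv t - v t * du t = 1) :
    ∃ κ, κ ∉ V ∧ ∃ T ⊆ Ioo a b, (∀ t ∈ T, u t + κ * v t ≠ 0) ∧
      ((fun t => v t / (u t + κ * v t)) '' T).Infinite := by
  obtain ⟨κ, hκ⟩ := Infinite.exists_notMem_finset V
  refine ⟨κ, hκ, ?_⟩
  have hUd : ∀ t ∈ Ioo a b, HasDerivAt (fun t => u t + κ * v t) (du t + κ * dv t) t := fun t ht =>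
    (hu t ht).add ((hv t ht).const_mul κ)
  have hmem : {t | u t + κ * v t ≠ 0} ∩ Ioo a b ∈ nhds t₀ :=
    Filter.inter_mem ((hUd t₀ ht₀).continuousAt.eventually_ne (by simp [hu0, hv0]))
      (isOpen_Ioo.mem_nhds ht₀)
  obtain ⟨c, d, hcd, hsub⟩ := mem_nhds_iff_exists_Ioo_subset.1 hmem
  refine ⟨Ioo c d, fun t ht => (hsub ht).2, fun t ht => (hsub ht).1, ?_⟩
  have hz : ∀ t ∈ Ioo c d, HasDerivAt (fun t => v t / (u t + κ * v t))
      (1 / (u t + κ * v t) ^ 2) t := fun t ht =>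
    ((hv t (hsub ht).2).div (hUd t (hsub ht).2) (hsub ht).1).congr_deriv (by
      rw [← hW t (hsub ht).2]; ring)
  refine Set.Infinite.image (StrictMonoOn.injOn ?_) (Ioo_infinite (hcd.1.trans hcd.2))
  refine strictMonoOn_of_deriv_pos (convex_Ioo c d)
    (fun t ht => (hz t ht).continuousAt.continuousWithinAt) fun t ht => ?_
  rw [interior_Ioo] at ht
  rw [(hz t ht).deriv]
  have := (hsub ht).1
  have h0 : u t + κ * v t ≠ 0 := this
  positivity

/-- The second divided difference of `c + B ζ - ζ²` is `-1`. -/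
theorem divided_difference {u v du dv c B x y w : ℝ} (hW : u * dv - v * du = 1)
    (hxy : x ≠ y) (hyw : y ≠ w) (hxw : x ≠ w) :
    (c * (u + x * v) ^ 2 + B * (du + x * dv) * (u + x * v) - (du + x * dv) ^ 2)
        * ((u + y * v) * (u + w * v)) / ((x - y) * (x - w))
      + (c * (u + y * v) ^ 2 + B * (du + y * dv) * (u + y * v) - (du + y * dv) ^ 2)
        * ((u + x * v) * (u + w * v)) / ((y - x) * (y - w))
      + (c * (u + w * v) ^ 2 + B * (du + w * dv) * (u + w * v) - (du + w * dv) ^ 2)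
        * ((u + x * v) * (u + y * v)) / ((w - x) * (w - y)) = -1 := by
  have h1 := sub_ne_zero.2 hxy
  have h2 := sub_ne_zero.2 hyw
  have h3 := sub_ne_zero.2 hxw
  rw [← neg_sub x y, ← neg_sub x w, ← neg_sub y w]
  field_simp
  linear_combination (-(x - y) * (x - w) * (y - w)) * (u * dv - v * du + 1) * hW

/-- The ODE core of the argument. Here ζ are the principal curvatures, s is the radial sectional
curvature, L is the curvature of the level sets with zero diagonal, w is the rotation of the frame
along the curve and S holds the curvature components that this rotation mixes in. `hE` is the traced
Gauss equation. -/
theorem riccati_not_three_distinct {ζ : ι → ℝ → ℝ} {s ψ : ℝ → ℝ} {lam : ℝ} {L w : ι → ι → ℝ → ℝ}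
    {S : ι → ι → ι → ℝ → ℝ} (ht₀ : t₀ ∈ Ioo a b)
    (hζ : ∀ i, ∀ t ∈ Ioo a b, HasDerivAt (ζ i) (-(ζ i t) ^ 2 - s t) t)
    (hψ : ∀ t ∈ Ioo a b, HasDerivAt ψ (lam - Fintype.card ι * s t) t)
    (hψ0 : ∀ t ∈ Ioo a b, ψ t ≠ 0)
    (hs : ∀ t ∈ Ioo a b, ∃ s', HasDerivAt s s' t ∧ Fintype.card ι * s'
      = (lam - Fintype.card ι * s t) * ∑ i, ζ i t - ψ t * ∑ i, ζ i t ^ 2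
        + Fintype.card ι * s t * ψ t)
    (hL : ∀ i j, ∀ t ∈ Ioo a b, HasDerivAt (L i j) (-(ζ i t + ζ j t) * L i j t
      + 2 * ∑ k, w i k t * S j i k t + 2 * ∑ k, w j k t * S i j k t) t)
    (hw : ∀ i j, ∀ t ∈ Ioo a b, w i j t = -w j i t)
    (hwζ : ∀ i j, ∀ t ∈ Ioo a b, (ζ i t - ζ j t) * w i j t = 0)
    (hS : ∀ i j k, ∀ t ∈ Ioo a b, S j i k t = S j k i t)
    (hE : ∀ i, ∀ t ∈ Ioo a b, ∑ j, L i j t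
      = lam - s t + ζ i t * (∑ j, ζ j t - ψ t) - ζ i t ^ 2)
    {i j k : ι} (hij : ζ i t₀ ≠ ζ j t₀) (hjk : ζ j t₀ ≠ ζ k t₀) (hik : ζ i t₀ ≠ ζ k t₀) : False :=
        by
  obtain ⟨u, du, v, dv, hu0, hdu0, hv0, hdv0, hu, hdu, hv, hdv, hW, hsol⟩ :=
    exists_fundamental_system ht₀ hζ hij
  let V : Finset ℝ := Finset.univ.image fun i => ζ i t₀
  let B : ℝ → Finset ι := fun x => Finset.univ.filter fun i => ζ i t₀ = x
  let M : ℝ → ℝ → ℝ → ℝ := fun x y t => ∑ i ∈ B x, ∑ j ∈ B y, L i j t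
  have hB : ∀ x i, i ∈ B x ↔ ζ i t₀ = x := fun x i => by simp [B]
  have hV : ∀ i, ζ i t₀ ∈ V := fun i => by simp [V]
  have hne : ∀ x ∈ V, ∀ t ∈ Ioo a b, u t + x * v t ≠ 0 := fun x hx t ht => by
    obtain ⟨i, -, rfl⟩ := Finset.mem_image.1 hx
    exact (hsol i t ht).1
  have hBζ : ∀ x, ∀ i ∈ B x, ∀ t ∈ Ioo a b, ζ i t * (u t + x * v t) = du t + x * dv t := by
    intro x i hi t ht
    obtain rfl := (hB x i).1 hi
    exact (hsol i t ht).2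
  -- Principal curvatures distinct at `t₀` stay distinct, since u + xv and u + yv have Wronskian y -
  -- x. So w only mixes indices in one block.
  have hw0 : ∀ i k, ζ i t₀ ≠ ζ k t₀ → ∀ t ∈ Ioo a b, w i k t = 0 := fun i k hne t ht => by
    refine (mul_eq_zero.1 (hwζ i k t ht)).resolve_left fun h0 => hne ?_
    obtain ⟨n1, e1⟩ := hsol i t ht
    obtain ⟨n2, e2⟩ := hsol k t ht
    have h1 : ζ i t = ζ k t := sub_eq_zero.1 h0
    rw [h1] at e1
    linear_combination (-(ζ i t₀ - ζ k t₀)) * hW t ht + (u t + ζ k t₀ * v t) * (-e1)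
      + (u t + ζ i t₀ * v t) * e2
  -- Only k in the block of i contributes, and there a skew matrix is paired with a symmetric one.
  have hcancel : ∀ x, ∀ t ∈ Ioo a b, ∀ Q : ι → ι → ℝ, (∀ i k, Q i k = Q k i) →
      ∑ i ∈ B x, ∑ k, w i k t * Q i k = 0 := fun x t ht Q hQ => by
    rw [← sum_skew_mul_symm_eq_zero (B x) (fun i k => w i k t) Q (fun i k => hw i k t ht) hQ]
    refine Finset.sum_congr rfl fun i hi => (Finset.sum_subset (Finset.subset_univ _) ?_).symm
    intro k _ hk
    rw [hw0 i k (fun h => hk ((hB x k).2 (h ▸ (hB x i).1 hi))) t ht, zero_mul]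
  have hM : ∀ x ∈ V, ∀ y ∈ V, ∀ t ∈ Ioo a b, HasDerivAt (M x y)
      (-((du t + x * dv t) / (u t + x * v t) + (du t + y * dv t) / (u t + y * v t)) * M x y t) t :=
          by
    intro x hx y hy t ht
    refine (HasDerivAt.fun_sum fun i _ => HasDerivAt.fun_sum fun j _ => hL i j t ht).congr_deriv ?_
    simp only [Finset.sum_add_distrib, ← Finset.mul_sum]
    rw [Finset.sum_comm (s := B x) (t := B y) (f := fun i j => ∑ k, w i k t * S j i k t),
      Finset.sum_eq_zero (s := B y) (fun j _ =>
        hcancel x t ht (fun i k => S j i k t) (fun i k => hS i j k t ht)),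
      Finset.sum_eq_zero (s := B x) (fun i _ =>
        hcancel y t ht (fun j k => S i j k t) (fun j k => hS j i k t ht))]
    simp only [mul_zero, add_zero, M]
    rw [Finset.mul_sum]
    refine Finset.sum_congr rfl fun i hi => ?_
    rw [Finset.mul_sum]
    refine Finset.sum_congr rfl fun j hj => ?_
    rw [← hBζ x i hi t ht, ← hBζ y j hj t ht, mul_div_cancel_right₀ _ (hne x hx t ht),
      mul_div_cancel_right₀ _ (hne y hy t ht)]
  -- The logarithmic derivative of h_x h_y is ζ_x + ζ_y, opposite to the decay rate of the block
  -- sum.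
  have hMc : ∀ x ∈ V, ∀ y ∈ V, ∀ t ∈ Ioo a b,
      M x y t * ((u t + x * v t) * (u t + y * v t)) = M x y t₀ := fun x hx y hy t ht => by
    have := eq_of_hasDerivAt_zero
      (f := fun t => M x y t * ((u t + x * v t) * (u t + y * v t))) (fun t ht => by
      have nx := hne x hx t ht
      have ny := hne y hy t ht
      refine ((hM x hx y hy t ht).mul (((hu t ht).add ((hv t ht).const_mul x)).mul
        ((hu t ht).add ((hv t ht).const_mul y)))).congr_deriv ?_
      simp only [Pi.add_apply, Pi.mul_apply]
      generalize u t + x * v t = X at nx ⊢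
      generalize u t + y * v t = Y at ny ⊢
      field_simp
      ring) ht ht₀
    simpa [hu0, hv0] using this
  let m : ℝ → ℝ := fun x => ((B x).card : ℝ)
  have hm : ∀ x ∈ V, m x ≠ 0 := fun x hx => by
    obtain ⟨i, -, rfl⟩ := Finset.mem_image.1 hx
    exact Nat.cast_ne_zero.2 (Finset.card_ne_zero_of_mem ((hB _ i).2 rfl))
  -- The traced Gauss equation, averaged over the block of x and multiplied by h_x².
  have hEx : ∀ x ∈ V, ∀ t ∈ Ioo a b, (lam - s t) * (u t + x * v t) ^ 2
      + (∑ j, ζ j t - ψ t) * (du t + x * dv t) * (u t + x * v t) - (du t + x * dv t) ^ 2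
      = (u t + x * v t) * ∑ p ∈ V, (M x p t₀ / m x) / (u t + p * v t) := by
    intro x hx t ht
    have nx := hne x hx t ht
    have h1 : ∑ p ∈ V, M x p t = ∑ i ∈ B x, ∑ j, L i j t := by
      simp only [M]
      rw [Finset.sum_comm]
      exact Finset.sum_congr rfl fun i _ =>
        Finset.sum_fiberwise_of_maps_to (fun j _ => hV j) (fun j => L i j t)
    have h2 : ∑ i ∈ B x, ∑ j, L i j t = m x * (lam - s t
        + (du t + x * dv t) / (u t + x * v t) * (∑ j, ζ j t - ψ t)
        - ((du t + x * dv t) / (u t + x * v t)) ^ 2) := by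
      rw [← nsmul_eq_mul, ← Finset.sum_const]
      refine Finset.sum_congr rfl fun i hi => ?_
      rw [hE i t ht, ← hBζ x i hi t ht, mul_div_cancel_right₀ _ nx]
    have h3 : ∑ p ∈ V, (M x p t₀ / m x) / (u t + p * v t)
        = (u t + x * v t) / m x * ∑ p ∈ V, M x p t := by
      rw [Finset.mul_sum]
      refine Finset.sum_congr rfl fun p hp => ?_
      rw [← hMc x hx p hp t ht]
      have h4 := hne p hp t ht
      have h5 := hm x hx
      generalize u t + p * v t = X at h4 ⊢
      field_simp
    rw [h3, h1, h2]
    have := hm x hx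
    field_simp
  -- The coefficients λ - s and Σζ_j - ψ do not depend on the block, so a second divided difference
  -- over three blocks removes them.
  have htriple : ∀ x ∈ V, ∀ y ∈ V, ∀ z ∈ V, x ≠ y → y ≠ z → x ≠ z → ∃ c : ℝ → ℝ, ∀ t ∈ Ioo a b,
      (u t + x * v t) * (u t + y * v t) * ((u t + z * v t) * ∑ p ∈ V, c p / (u t + p * v t))
        = -1 := by
    intro x hx y hy z hz hxy hyz hxz
    refine ⟨fun p => M x p t₀ / m x / ((x - y) * (x - z)) + M y p t₀ / m y / ((y - x) * (y - z))
      + M z p t₀ / m z / ((z - x) * (z - y)), fun t ht => ?_⟩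
    rw [← divided_difference (c := lam - s t) (B := ∑ j, ζ j t - ψ t) (hW t ht) hxy hyz hxz,
      hEx x hx t ht, hEx y hy t ht, hEx z hz t ht]
    simp only [add_div, Finset.sum_add_distrib]
    have : ∀ (f : ℝ → ℝ) (d : ℝ), ∑ p ∈ V, f p / d / (u t + p * v t)
        = (∑ p ∈ V, f p / (u t + p * v t)) / d := fun f d => by
      rw [Finset.sum_div]
      exact Finset.sum_congr rfl fun p _ => div_right_comm _ _ _
    rw [this (fun p => M x p t₀ / m x), this (fun p => M y p t₀ / m y),
      this (fun p => M z p t₀ / m z)]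
    ring
  set x := ζ i t₀ with hx
  set y := ζ j t₀ with hy
  set z := ζ k t₀ with hz
  obtain ⟨c, hc⟩ := htriple x (hV i) y (hV j) z (hV k) hij hjk hik
  obtain ⟨κ, hκ, T, hT, hU, hinf⟩ := exists_infinite_image V ht₀ hu0 hv0 hu hv hW
  -- Replacing z by p in the triple and cancelling h_x h_y leaves h_z Σ c_q/h_q = h_p Σ d_q/h_q,
  -- whose right-hand side has no pole at h_p = 0.
  have hc0 : ∀ p ∈ V, p ≠ x → p ≠ y → p ≠ z → c p = 0 := by
    intro p hp hpx hpy hpz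
    obtain ⟨d, hd⟩ := htriple x (hV i) y (hV j) p hp hij hpy.symm hpx.symm
    refine coeff_eq_zero_of_residue (d := d) (y := z) hκ hU hinf
      (fun q hq t ht => hne q hq t (hT ht)) hp hpz.symm fun t ht => ?_
    exact mul_left_cancel₀ (mul_ne_zero (hne x (hV i) t (hT ht)) (hne y (hV j) t (hT ht)))
      ((hc t (hT ht)).trans (hd t (hT ht)).symm)
  -- With three summands left, h_x h_y h_z Σ c_p/h_p is a quadratic form in u and v.
  have hquad : ∀ t ∈ Ioo a b, -(c x + c y + c z) * u t ^ 2
      + -(c x * (y + z) + c y * (x + z) + c z * (x + y)) * (u t * v t)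
      + -(c x * y * z + c y * x * z + c z * x * y) * v t ^ 2 = 1 := by
    intro t ht
    have h1 : ∑ p ∈ V, c p / (u t + p * v t)
        = c x / (u t + x * v t) + c y / (u t + y * v t) + c z / (u t + z * v t) := by
      rw [← Finset.sum_subset (s₁ := {x, y, z}), Finset.sum_insert, Finset.sum_pair hjk, add_assoc]
      · simp [hij, hik]
      · intro p hp
        simp only [Finset.mem_insert, Finset.mem_singleton] at hp
        rcases hp with rfl | rfl | rfl
        exacts [hV i, hV j, hV k]
      · intro p hp hp'
        simp only [Finset.mem_insert, Finset.mem_singleton, not_or] at hp'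
        rw [hc0 p hp hp'.1 hp'.2.1 hp'.2.2, zero_div]
    have h2 := hc t ht
    rw [h1] at h2
    have n1 := hne x (hV i) t ht
    have n2 := hne y (hV j) t ht
    have n3 := hne z (hV k) t ht
    have h3 : c x * ((u t + y * v t) * (u t + z * v t)) + c y * ((u t + x * v t) * (u t + z * v t))
        + c z * ((u t + x * v t) * (u t + y * v t)) = -1 := by
      rw [← h2]
      generalize u t + x * v t = X at n1 ⊢
      generalize u t + y * v t = Y at n2 ⊢
      generalize u t + z * v t = Z at n3 ⊢
      field_simp
    linear_combination (-1) * h3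
  have hs0 : ∀ t ∈ Ioo a b, HasDerivAt s 0 t := fun t ht =>
    hasDerivAt_zero_of_quadratic_eq_one hu hdu hv hdv hquad ht
  have hsc : ∀ t ∈ Ioo a b, s t = s t₀ := fun t ht => eq_of_hasDerivAt_zero hs0 ht ht₀
  have : Nonempty ι := ⟨i⟩
  refine not_three_distinct_of_const (σ := s t₀) (A := lam - Fintype.card ι * s t₀) (ψ := ψ) ht₀
    (fun i t ht => hsc t ht ▸ hζ i t ht) (fun t ht => hsc t ht ▸ hψ t ht) (hψ0 t₀ ht₀)
    (fun t ht => ?_) hij hjk hik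
  obtain ⟨s', hs', he⟩ := hs t ht
  rw [hs'.unique (hs0 t ht), mul_zero, hsc t ht] at he
  linear_combination (-1) * he

end Blocks

/-! ### Levi-Civita connections on open sets of a vector space. -/

section LeviCivita

open Filter Topology

variable {E : Type*} [NormedAddCommGroup E] [NormedSpace ℝ E]

set_option synthInstance.maxHeartbeats 200000 in
instance normedAddCommGroupBilin : NormedAddCommGroup (E →L[ℝ] E →L[ℝ] E) := inferInstance

set_option synthInstance.maxHeartbeats 200000 in
instance normedSpaceBilin : NormedSpace ℝ (E →L[ℝ] E →L[ℝ] E) := inferInstance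

set_option synthInstance.maxHeartbeats 200000 in
instance normedAddCommGroupTrilin : NormedAddCommGroup (E →L[ℝ] E →L[ℝ] E →L[ℝ] E) :=
  inferInstance

set_option synthInstance.maxHeartbeats 200000 in
instance normedSpaceTrilin : NormedSpace ℝ (E →L[ℝ] E →L[ℝ] E →L[ℝ] E) := inferInstance

set_option synthInstance.maxHeartbeats 200000 in
instance addMonoidBilin : AddMonoid (E →L[ℝ] E →L[ℝ] E) := inferInstance

instance addZeroClassBilin : AddZeroClass (E →L[ℝ] E →L[ℝ] E) := inferInstance

set_option synthInstance.maxHeartbeats 200000 in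
instance addMonoidTrilin : AddMonoid (E →L[ℝ] E →L[ℝ] E →L[ℝ] E) := inferInstance

instance addZeroClassTrilin : AddZeroClass (E →L[ℝ] E →L[ℝ] E →L[ℝ] E) := inferInstance

set_option synthInstance.maxHeartbeats 200000 in
instance normedAddCommGroupForm : NormedAddCommGroup (E →L[ℝ] E →L[ℝ] ℝ) := inferInstance

set_option synthInstance.maxHeartbeats 200000 in
instance normedSpaceForm : NormedSpace ℝ (E →L[ℝ] E →L[ℝ] ℝ) := inferInstance

set_option synthInstance.maxHeartbeats 200000 in
instance normedAddCommGroupTriform : NormedAddCommGroup (E →L[ℝ] E →L[ℝ] E →L[ℝ] ℝ) :=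
  inferInstance

set_option synthInstance.maxHeartbeats 200000 in
instance normedSpaceTriform : NormedSpace ℝ (E →L[ℝ] E →L[ℝ] E →L[ℝ] ℝ) := inferInstance

/-- The curvature `R(a,b)c` of the connection with coefficients `A` (constant vectors `a, b, c`). -/
def curv (A : E → E →L[ℝ] E →L[ℝ] E) (y a b c : E) : E :=
  fderiv ℝ A y a b c - fderiv ℝ A y b a c + A y a (A y b c) - A y b (A y a c)

/-- The covariant derivative `(∇_v R)(a,b)c`. -/
def curvCov (A : E → E →L[ℝ] E →L[ℝ] E) (y v a b c : E) : E :=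
  fderiv ℝ (fderiv ℝ A) y v a b c - fderiv ℝ (fderiv ℝ A) y v b a c
    + fderiv ℝ A y v a (A y b c) + A y a (fderiv ℝ A y v b c)
    - fderiv ℝ A y v b (A y a c) - A y b (fderiv ℝ A y v a c)
    + A y v (curv A y a b c) - curv A y (A y v a) b c - curv A y a (A y v b) c
    - curv A y a b (A y v c)

/-- `R_abcd = g(R(a,b)c, d)`. -/
def curv4 (g : E → E →L[ℝ] E →L[ℝ] ℝ) (A : E → E →L[ℝ] E →L[ℝ] E) (y a b c d : E) : ℝ :=
  g y (curv A y a b c) d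

/-- `(∇_v R)_abcd`. -/
def curv4Cov (g : E → E →L[ℝ] E →L[ℝ] ℝ) (A : E → E →L[ℝ] E →L[ℝ] E) (y v a b c d : E) : ℝ :=
  g y (curvCov A y v a b c) d

/-- The field `X` along the curve `γ` with velocity `v` at `t` has covariant derivative `DX`. -/
def HasCovDerivAt (A : E → E →L[ℝ] E →L[ℝ] E) (γ : ℝ → E) (v : E) (X : ℝ → E) (DX : E) (t : ℝ) :
    Prop :=
  HasDerivAt X (DX - A (γ t) v (X t)) t

/-- `A` is the Levi-Civita connection of the smooth metric `g` on the open set `Ω`. -/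
structure IsLeviCivita (g : E → E →L[ℝ] E →L[ℝ] ℝ) (A : E → E →L[ℝ] E →L[ℝ] E) (Ω : Set E) :
    Prop where
  isOpen : IsOpen Ω
  smooth_metric : ∀ y ∈ Ω, ContDiffAt ℝ ∞ g y
  smooth : ∀ y ∈ Ω, ContDiffAt ℝ ∞ A y
  symm : ∀ y ∈ Ω, ∀ a b, g y a b = g y b a
  torsion_free : ∀ y ∈ Ω, ∀ a b, A y a b = A y b a
  compat : ∀ y ∈ Ω, ∀ v a b, fderiv ℝ g y v a b = g y (A y v a) b + g y a (A y v b)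

section Linearity

variable (g : E → E →L[ℝ] E →L[ℝ] ℝ) (A : E → E →L[ℝ] E →L[ℝ] E) (y v a b c d a' : E) (r : ℝ)

theorem curv_add₁ : curv A y (a + a') b c = curv A y a b c + curv A y a' b c := by
  simp only [curv, map_add, add_apply]; abel
theorem curv_add₂ : curv A y b (a + a') c = curv A y b a c + curv A y b a' c := by
  simp only [curv, map_add, add_apply]; abel
theorem curv_add₃ : curv A y b c (a + a') = curv A y b c a + curv A y b c a' := by
  simp only [curv, map_add]; abel
theorem curv_smul₁ : curv A y (r • a) b c = r • curv A y a b c := by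
  simp only [curv, map_smul, smul_apply, smul_sub, smul_add]
theorem curv_smul₂ : curv A y b (r • a) c = r • curv A y b a c := by
  simp only [curv, map_smul, smul_apply, smul_sub, smul_add]
theorem curv_smul₃ : curv A y b c (r • a) = r • curv A y b c a := by
  simp only [curv, map_smul, smul_sub, smul_add]
theorem curv_swap : curv A y b a c = -curv A y a b c := by
  simp only [curv]; abel

theorem curv4_add₁ : curv4 g A y (a + a') b c d = curv4 g A y a b c d + curv4 g A y a' b c d := by
  simp only [curv4, curv_add₁, map_add, add_apply]
theorem curv4_add₂ : curv4 g A y b (a + a') c d = curv4 g A y b a c d + curv4 g A y b a' c d := by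
  simp only [curv4, curv_add₂, map_add, add_apply]
theorem curv4_add₃ : curv4 g A y b c (a + a') d = curv4 g A y b c a d + curv4 g A y b c a' d := by
  simp only [curv4, curv_add₃, map_add, add_apply]
theorem curv4_add₄ : curv4 g A y b c d (a + a') = curv4 g A y b c d a + curv4 g A y b c d a' := by
  simp only [curv4, map_add]
theorem curv4_smul₁ : curv4 g A y (r • a) b c d = r * curv4 g A y a b c d := by
  simp only [curv4, curv_smul₁, map_smul, smul_apply, smul_eq_mul]
theorem curv4_smul₂ : curv4 g A y b (r • a) c d = r * curv4 g A y b a c d := by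
  simp only [curv4, curv_smul₂, map_smul, smul_apply, smul_eq_mul]
theorem curv4_smul₃ : curv4 g A y b c (r • a) d = r * curv4 g A y b c a d := by
  simp only [curv4, curv_smul₃, map_smul, smul_apply, smul_eq_mul]
theorem curv4_smul₄ : curv4 g A y b c d (r • a) = r * curv4 g A y b c d a := by
  simp only [curv4, map_smul, smul_eq_mul]
theorem curv4_swap : curv4 g A y b a c d = -curv4 g A y a b c d := by
  simp only [curv4, curv_swap A y a b c, map_neg, neg_apply]

end Linearity

variable {g : E → E →L[ℝ] E →L[ℝ] ℝ} {A : E → E →L[ℝ] E →L[ℝ] E} {Ω : Set E}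
  {γ X Y Z W : ℝ → E} {v DX DY DZ DW : E} {t : ℝ}

namespace IsLeviCivita

variable (h : IsLeviCivita g A Ω)
include h

theorem differentiableAt_fderiv {y : E} (hy : y ∈ Ω) : DifferentiableAt ℝ (fderiv ℝ A) y :=
  ((h.smooth y hy).fderiv_right (m := 1) (by norm_cast)).differentiableAt (by norm_num)

theorem metric_hasDerivAt (ht : γ t ∈ Ω) (hγ : HasDerivAt γ v t)
    (hX : HasCovDerivAt A γ v X DX t) (hY : HasCovDerivAt A γ v Y DY t) :
    HasDerivAt (fun t => g (γ t) (X t) (Y t)) (g (γ t) DX (Y t) + g (γ t) (X t) DY) t := by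
  have hg : HasDerivAt (fun t => g (γ t)) (fderiv ℝ g (γ t) v) t :=
    ((h.smooth_metric _ ht).differentiableAt (by norm_num)).hasFDerivAt.comp_hasDerivAt t hγ
  refine ((hg.clm_apply hX).clm_apply hY).congr_deriv ?_
  simp only [add_apply, map_sub, sub_apply, h.compat _ ht]
  ring

theorem connection_hasDerivAt (ht : γ t ∈ Ω) (hγ : HasDerivAt γ v t) {X' Y' : E}
    (hX : HasDerivAt X X' t) (hY : HasDerivAt Y Y' t) :
    HasDerivAt (fun t => A (γ t) (X t) (Y t))
      (fderiv ℝ A (γ t) v (X t) (Y t) + A (γ t) X' (Y t) + A (γ t) (X t) Y') t := by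
  have hg : HasDerivAt (fun t => A (γ t)) (fderiv ℝ A (γ t) v) t :=
    ((h.smooth _ ht).differentiableAt (by norm_num)).hasFDerivAt.comp_hasDerivAt t hγ
  refine ((hg.clm_apply hX).clm_apply hY).congr_deriv ?_
  simp only [add_apply]

theorem curv_hasDerivAt (ht : γ t ∈ Ω) (hγ : HasDerivAt γ v t)
    (hX : HasCovDerivAt A γ v X DX t) (hY : HasCovDerivAt A γ v Y DY t)
    (hZ : HasCovDerivAt A γ v Z DZ t) :
    HasCovDerivAt A γ v (fun t => curv A (γ t) (X t) (Y t) (Z t))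
      (curvCov A (γ t) v (X t) (Y t) (Z t) + curv A (γ t) DX (Y t) (Z t)
        + curv A (γ t) (X t) DY (Z t) + curv A (γ t) (X t) (Y t) DZ) t := by
  have hd : HasDerivAt (fun t => fderiv ℝ A (γ t)) (fderiv ℝ (fderiv ℝ A) (γ t) v) t :=
    (h.differentiableAt_fderiv ht).hasFDerivAt.comp_hasDerivAt t hγ
  unfold HasCovDerivAt at *
  have h1 := ((hd.clm_apply hX).clm_apply hY).clm_apply hZ
  have h2 := ((hd.clm_apply hY).clm_apply hX).clm_apply hZ
  have h3 := h.connection_hasDerivAt ht hγ hX (h.connection_hasDerivAt ht hγ hY hZ)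
  have h4 := h.connection_hasDerivAt ht hγ hY (h.connection_hasDerivAt ht hγ hX hZ)
  refine (((h1.sub h2).add h3).sub h4).congr_deriv ?_
  simp only [curvCov, curv, map_add, map_sub, add_apply, sub_apply]
  abel

theorem curv4_hasDerivAt (ht : γ t ∈ Ω) (hγ : HasDerivAt γ v t)
    (hX : HasCovDerivAt A γ v X DX t) (hY : HasCovDerivAt A γ v Y DY t)
    (hZ : HasCovDerivAt A γ v Z DZ t) (hW : HasCovDerivAt A γ v W DW t) :
    HasDerivAt (fun t => curv4 g A (γ t) (X t) (Y t) (Z t) (W t))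
      (curv4Cov g A (γ t) v (X t) (Y t) (Z t) (W t) + curv4 g A (γ t) DX (Y t) (Z t) (W t)
        + curv4 g A (γ t) (X t) DY (Z t) (W t) + curv4 g A (γ t) (X t) (Y t) DZ (W t)
        + curv4 g A (γ t) (X t) (Y t) (Z t) DW) t := by
  refine (h.metric_hasDerivAt ht hγ (h.curv_hasDerivAt ht hγ hX hY hZ) hW).congr_deriv ?_
  simp only [curv4, curv4Cov, map_add, add_apply]

end IsLeviCivita

/-- These fields are parallel to first order at the base point. Inserting them into a tensor and
differentiating at 0 produces the covariant derivative without correction terms. -/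
theorem hasCovDerivAt_line (y v a : E) :
    HasCovDerivAt A (fun t : ℝ => y + t • v) v (fun t => a - t • A y v a) 0 0 := by
  unfold HasCovDerivAt
  simpa using (((hasDerivAt_id (0 : ℝ)).smul_const (A y v a)).const_sub a)

theorem hasDerivAt_line (y v : E) (t : ℝ) : HasDerivAt (fun t : ℝ => y + t • v) v t := by
  simpa using (((hasDerivAt_id t).smul_const v).const_add y)

namespace IsLeviCivita

variable (h : IsLeviCivita g A Ω) {y : E} (hy : y ∈ Ω)
include h hy

theorem eventually_line_mem (v : E) : ∀ᶠ t in 𝓝 (0 : ℝ), y + t • v ∈ Ω :=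
  (hasDerivAt_line y v 0).continuousAt.eventually_mem (h.isOpen.mem_nhds (by simpa using hy))

/-- An identity for a function of points and vectors differentiates to its covariant version. -/
theorem curv4_line (v a b c d : E) :
    HasDerivAt (fun t : ℝ => curv4 g A (y + t • v) (a - t • A y v a) (b - t • A y v b)
      (c - t • A y v c) (d - t • A y v d)) (curv4Cov g A y v a b c d) 0 := by
  have := h.curv4_hasDerivAt (γ := fun t : ℝ => y + t • v) (t := 0) (by simpa using hy)
    (hasDerivAt_line y v 0) (hasCovDerivAt_line y v a) (hasCovDerivAt_line y v b)
    (hasCovDerivAt_line y v c) (hasCovDerivAt_line y v d)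
  refine this.congr_deriv ?_
  simp [curv4, curv]

theorem second_symm (v a : E) : fderiv ℝ (fderiv ℝ A) y v a = fderiv ℝ (fderiv ℝ A) y a v :=
  ((h.smooth y hy).isSymmSndFDerivAt (by
    simp only [minSmoothness_of_isRCLikeNormedField]
    norm_cast)).eq v a

/-- Symmetry of A in its two arguments passes to its derivative, and the cyclic sum cancels term by
term. -/
theorem curv_bianchi₁ (a b c : E) : curv A y a b c + curv A y b c a + curv A y c a b = 0 := by
  have ht : ∀ v a b, fderiv ℝ A y v a b = fderiv ℝ A y v b a := fun v a b => by
    have h1 : ∀ a b, HasDerivAt (fun t : ℝ => A (y + t • v) a b) (fderiv ℝ A y v a b) 0 :=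
      fun a b => by
        have := h.connection_hasDerivAt (γ := fun t : ℝ => y + t • v) (t := 0) (by simpa using hy)
          (hasDerivAt_line y v 0) (hasDerivAt_const 0 a) (hasDerivAt_const 0 b)
        refine this.congr_deriv ?_
        simp only [zero_smul, add_zero, map_zero, zero_apply]
    refine (h1 a b).unique ((h1 b a).congr_of_eventuallyEq ?_)
    filter_upwards [h.eventually_line_mem hy v] with t ht using h.torsion_free _ ht a b
  simp only [curv]
  rw [h.torsion_free y hy b c, h.torsion_free y hy c a, h.torsion_free y hy a b, ht a b c,
    ht b c a, ht c a b]
  abel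

/-- The second derivatives of A cancel by their symmetry, the remaining terms by vanishing torsion.
-/
theorem curv_bianchi₂ (v a b c : E) :
    curvCov A y v a b c + curvCov A y a b v c + curvCov A y b v a c = 0 := by
  simp only [curvCov]
  rw [h.second_symm hy v a, h.second_symm hy a b, h.second_symm hy b v,
    h.torsion_free y hy v a, h.torsion_free y hy a b, h.torsion_free y hy b v]
  simp only [curv, map_add, map_sub]
  abel

end IsLeviCivita
end LeviCivita

/-! ### Curvature symmetries, contractions over orthonormal frames and contracted Bianchi
identities. -/

section Frames

set_option linter.unusedSectionVars false

open Filter Topology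

/-- The octahedron argument: four cyclic identities combined with the two skew symmetries. -/
theorem pair_symm_of_bianchi {α : Type*} {f : α → α → α → α → ℝ}
    (h1 : ∀ a b c d, f b a c d = -f a b c d) (h2 : ∀ a b c d, f a b d c = -f a b c d)
    (h3 : ∀ a b c d, f a b c d + f b c a d + f c a b d = 0) (a b c d : α) :
    f a b c d = f c d a b := by
  have e1 := h3 a b c d
  have e2 := h3 b c d a
  have e3 := h3 c d a b
  have e4 := h3 d a b c
  have := h2 b c d a
  have := h1 c d b a
  have := h2 c d b a
  have := h2 d b c a
  have := h1 d a c b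
  have := h2 d a c b
  have := h1 a c d b
  have := h2 a c d b
  have := h2 a b d c
  have := h1 b d a c
  have := h2 b d a c
  have := h1 d b a c
  have := h1 c a b d
  have := h2 c a b d
  have := h1 c a d b
  have := h2 d b a c
  have := h1 a d b c
  have := h2 d a b c
  have := h2 a d b c
  have := h2 b c a d
  have := h1 b c a d
  linarith

variable {E : Type*} [NormedAddCommGroup E] [NormedSpace ℝ E]
  {g : E → E →L[ℝ] E →L[ℝ] ℝ} {A : E → E →L[ℝ] E →L[ℝ] E} {Ω : Set E}

section Linearity

variable (g A) (y a b c d v v' : E) (r : ℝ)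

theorem curvCov_add : curvCov A y (v + v') a b c = curvCov A y v a b c + curvCov A y v' a b c := by
  simp only [curvCov, map_add, add_apply, curv_add₁, curv_add₂, curv_add₃]
  abel

theorem curvCov_smul : curvCov A y (r • v) a b c = r • curvCov A y v a b c := by
  simp only [curvCov, map_smul, smul_apply, curv_smul₁, curv_smul₂, curv_smul₃, smul_sub, smul_add]

theorem curvCov_add₁ : curvCov A y a (v + v') b c
    = curvCov A y a v b c + curvCov A y a v' b c := by
  simp only [curvCov, map_add, add_apply, curv_add₁]
  abel

theorem curvCov_smul₁ : curvCov A y a (r • v) b c = r • curvCov A y a v b c := by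
  simp only [curvCov, map_smul, smul_apply, curv_smul₁, smul_sub, smul_add]

theorem curv4Cov_add : curv4Cov g A y (v + v') a b c d
    = curv4Cov g A y v a b c d + curv4Cov g A y v' a b c d := by
  simp only [curv4Cov, curvCov_add, map_add, add_apply]

theorem curv4Cov_smul : curv4Cov g A y (r • v) a b c d = r * curv4Cov g A y v a b c d := by
  simp only [curv4Cov, curvCov_smul, map_smul, smul_apply, smul_eq_mul]

theorem curv4Cov_add₁ : curv4Cov g A y a (v + v') b c d
    = curv4Cov g A y a v b c d + curv4Cov g A y a v' b c d := by
  simp only [curv4Cov, curvCov_add₁, map_add, add_apply]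

theorem curv4Cov_smul₁ : curv4Cov g A y a (r • v) b c d = r * curv4Cov g A y a v b c d := by
  simp only [curv4Cov, curvCov_smul₁, map_smul, smul_apply, smul_eq_mul]

end Linearity

namespace IsLeviCivita

variable (h : IsLeviCivita g A Ω) {y : E} (hy : y ∈ Ω)
include h hy

theorem curv4_bianchi₁ (a b c d : E) :
    curv4 g A y a b c d + curv4 g A y b c a d + curv4 g A y c a b d = 0 := by
  have := congrArg (fun x => g y x d) (h.curv_bianchi₁ hy a b c)
  simpa only [curv4, curv4Cov, map_add, add_apply, map_zero, zero_apply] using this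

theorem curv4Cov_bianchi₂ (v a b c d : E) :
    curv4Cov g A y v a b c d + curv4Cov g A y a b v c d + curv4Cov g A y b v a c d = 0 := by
  have := congrArg (fun x => g y x d) (h.curv_bianchi₂ hy v a b c)
  simpa only [curv4, curv4Cov, map_add, add_apply, map_zero, zero_apply] using this

/-- For constant c, d the second derivative of the function g(c,d) is symmetric. Metric
compatibility turns its antisymmetric part into g(R(a,b)c,d) + g(c,R(a,b)d). -/
theorem curv4_swap₃₄ (a b c d : E) : curv4 g A y a b d c = -curv4 g A y a b c d := by
  let φ : E → ℝ := fun z => g z c d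
  have hφ : ContDiffAt ℝ ∞ φ y :=
    ((h.smooth_metric y hy).clm_apply contDiffAt_const).clm_apply contDiffAt_const
  have hd : ∀ z ∈ Ω, ∀ b, fderiv ℝ φ z b = g z (A z b c) d + g z c (A z b d) := fun z hz b => by
    have := h.metric_hasDerivAt (γ := fun t : ℝ => z + t • b) (t := 0) (by simpa using hz)
      (hasDerivAt_line z b 0) (X := fun _ => c) (DX := A z b c) (Y := fun _ => d) (DY := A z b d)
      (by simpa [HasCovDerivAt] using hasDerivAt_const (0 : ℝ) c)
      (by simpa [HasCovDerivAt] using hasDerivAt_const (0 : ℝ) d)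
    have h0 : HasFDerivAt φ (fderiv ℝ φ z) (z + (0 : ℝ) • b) := by
      rw [zero_smul, add_zero]
      exact (((h.smooth_metric z hz).clm_apply contDiffAt_const).clm_apply
        contDiffAt_const).differentiableAt (by norm_num) |>.hasFDerivAt
    have h1 := h0.comp_hasDerivAt (0 : ℝ) (hasDerivAt_line z b 0)
    have h2 := h1.unique this
    simpa using h2
  have h2 : ∀ a b, fderiv ℝ (fderiv ℝ φ) y a b
      = g y (fderiv ℝ A y a b c + A y a (A y b c)) d + g y (A y b c) (A y a d)
        + (g y (A y a c) (A y b d) + g y c (fderiv ℝ A y a b d + A y a (A y b d))) := by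
    intro a b
    have h0 : HasFDerivAt (fderiv ℝ φ) (fderiv ℝ (fderiv ℝ φ) y) (y + (0 : ℝ) • a) := by
      rw [zero_smul, add_zero]
      exact ((hφ.fderiv_right (m := 1) (by norm_cast)).differentiableAt (by norm_num)).hasFDerivAt
    have h1 : HasDerivAt (fun t : ℝ => fderiv ℝ φ (y + t • a) b)
        (fderiv ℝ (fderiv ℝ φ) y a b) 0 := by
      have := (h0.comp_hasDerivAt (0 : ℝ) (hasDerivAt_line y a 0)).clm_apply
        (hasDerivAt_const (0 : ℝ) b)
      simpa using this
    have hcov : ∀ x, HasCovDerivAt A (fun t : ℝ => y + t • a) a (fun _ => x) (A y a x) 0 :=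
      fun x => by simpa [HasCovDerivAt] using hasDerivAt_const (0 : ℝ) x
    have hcA : ∀ x, HasCovDerivAt A (fun t : ℝ => y + t • a) a (fun t => A (y + t • a) b x)
        (fderiv ℝ A y a b x + A y a (A y b x)) 0 := fun x => by
      have := h.connection_hasDerivAt (γ := fun t : ℝ => y + t • a) (t := 0) (by simpa using hy)
          (hasDerivAt_line y a 0) (hasDerivAt_const 0 b) (hasDerivAt_const 0 x)
      refine this.congr_deriv ?_
      simp only [zero_smul, add_zero, map_zero, zero_apply, add_sub_cancel_right]
    have hy0 : y + (0 : ℝ) • a ∈ Ω := by simpa using hy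
    have h3 := (h.metric_hasDerivAt (γ := fun t : ℝ => y + t • a) hy0 (hasDerivAt_line y a 0)
      (hcA c) (hcov d)).add (h.metric_hasDerivAt (γ := fun t : ℝ => y + t • a) hy0
      (hasDerivAt_line y a 0) (hcov c) (hcA d))
    have h4 := h1.unique (h3.congr_of_eventuallyEq (by
      filter_upwards [h.eventually_line_mem hy a] with t ht using hd _ ht b))
    simpa only [zero_smul, add_zero] using h4
  have hs : fderiv ℝ (fderiv ℝ φ) y a b = fderiv ℝ (fderiv ℝ φ) y b a :=
    (hφ.isSymmSndFDerivAt (by simp only [minSmoothness_of_isRCLikeNormedField]; norm_cast)).eq a b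
  rw [h2, h2] at hs
  have e : curv4 g A y a b d c = g y c (curv A y a b d) := h.symm y hy _ _
  rw [e]
  simp only [curv4, curv, map_add, map_sub, add_apply, sub_apply] at hs ⊢
  linarith

theorem curv4_pair (a b c d : E) : curv4 g A y a b c d = curv4 g A y c d a b :=
  pair_symm_of_bianchi (fun a b c d => curv4_swap g A y a b c d) (h.curv4_swap₃₄ hy)
    (h.curv4_bianchi₁ hy) a b c d

/-- The symmetries of ∇R come from those of R by differentiating along `curv4_line`. -/
theorem curv4Cov_swap (v a b c d : E) : curv4Cov g A y v b a c d = -curv4Cov g A y v a b c d :=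
  (h.curv4_line hy v b a c d).unique ((h.curv4_line hy v a b c d).neg.congr_of_eventuallyEq
    (Eventually.of_forall fun _ => curv4_swap ..))

theorem curv4Cov_swap₃₄ (v a b c d : E) : curv4Cov g A y v a b d c = -curv4Cov g A y v a b c d :=
  (h.curv4_line hy v a b d c).unique ((h.curv4_line hy v a b c d).neg.congr_of_eventuallyEq (by
    filter_upwards [h.eventually_line_mem hy v] with t ht using h.curv4_swap₃₄ ht ..))

theorem curv4Cov_pair (v a b c d : E) : curv4Cov g A y v a b c d = curv4Cov g A y v c d a b :=
  (h.curv4_line hy v a b c d).unique ((h.curv4_line hy v c d a b).congr_of_eventuallyEq (by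
    filter_upwards [h.eventually_line_mem hy v] with t ht using h.curv4_pair ht ..))

end IsLeviCivita

variable {ι : Type*} [Fintype ι]

/-- Differentiable orthonormal frames `e` of the metric `g` on `Ω`. -/
structure IsOrthonormalFrame [DecidableEq ι] (g : E → E →L[ℝ] E →L[ℝ] ℝ) (e : ι → E → E)
    (Ω : Set E) : Prop where
  differentiableAt : ∀ i, ∀ y ∈ Ω, DifferentiableAt ℝ (e i) y
  orthonormal : ∀ y ∈ Ω, ∀ i j, g y (e i y) (e j y) = if i = j then 1 else 0
  span : ∀ y ∈ Ω, ∀ a, a = ∑ i, g y a (e i y) • e i y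

/-- The covariant derivative `∇_v e_i`. -/
def frameCov (A : E → E →L[ℝ] E →L[ℝ] E) (e : ι → E → E) (y v : E) (i : ι) : E :=
  fderiv ℝ (e i) y v + A y v (e i y)

/-- The Ricci tensor, as a contraction over an orthonormal frame. -/
def ric (g : E → E →L[ℝ] E →L[ℝ] ℝ) (A : E → E →L[ℝ] E →L[ℝ] E) (e : ι → E → E) (y b c : E) : ℝ :=
  ∑ i, curv4 g A y (e i y) b c (e i y)

/-- The covariant derivative of the Ricci tensor. -/
def ricCov (g : E → E →L[ℝ] E →L[ℝ] ℝ) (A : E → E →L[ℝ] E →L[ℝ] E) (e : ι → E → E)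
    (y v b c : E) : ℝ :=
  ∑ i, curv4Cov g A y v (e i y) b c (e i y)

/-- The scalar curvature. -/
def scal (g : E → E →L[ℝ] E →L[ℝ] ℝ) (A : E → E →L[ℝ] E →L[ℝ] E) (e : ι → E → E) (y : E) : ℝ :=
  ∑ i, ric g A e y (e i y) (e i y)

/-- The differential of the scalar curvature. -/
def scalCov (g : E → E →L[ℝ] E →L[ℝ] ℝ) (A : E → E →L[ℝ] E →L[ℝ] E) (e : ι → E → E) (y v : E) : ℝ :=
  ∑ i, ricCov g A e y v (e i y) (e i y)

variable {e : ι → E → E}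

section Linearity

variable (g A e) (y b c v v' : E) (r : ℝ)

theorem ric_add₁ : ric g A e y (v + v') c = ric g A e y v c + ric g A e y v' c := by
  simp only [ric, curv4_add₂, Finset.sum_add_distrib]
theorem ric_add₂ : ric g A e y c (v + v') = ric g A e y c v + ric g A e y c v' := by
  simp only [ric, curv4_add₃, Finset.sum_add_distrib]
theorem ric_smul₁ : ric g A e y (r • v) c = r * ric g A e y v c := by
  simp only [ric, curv4_smul₂, Finset.mul_sum]
theorem ric_smul₂ : ric g A e y c (r • v) = r * ric g A e y c v := by
  simp only [ric, curv4_smul₃, Finset.mul_sum]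
theorem ricCov_add : ricCov g A e y (v + v') b c = ricCov g A e y v b c + ricCov g A e y v' b c :=
    by
  simp only [ricCov, curv4Cov_add, Finset.sum_add_distrib]
theorem ricCov_smul : ricCov g A e y (r • v) b c = r * ricCov g A e y v b c := by
  simp only [ricCov, curv4Cov_smul, Finset.mul_sum]
theorem scalCov_add : scalCov g A e y (v + v') = scalCov g A e y v + scalCov g A e y v' := by
  simp only [scalCov, ricCov_add, Finset.sum_add_distrib]
theorem scalCov_smul : scalCov g A e y (r • v) = r * scalCov g A e y v := by
  simp only [scalCov, ricCov_smul, Finset.mul_sum]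

/-- The Ricci tensor as a bilinear form. -/
def ricLin : E →ₗ[ℝ] E →ₗ[ℝ] ℝ :=
  LinearMap.mk₂ ℝ (ric g A e y) (fun a b c => ric_add₁ g A e y c a b)
    (fun r a c => ric_smul₁ g A e y c a r) (fun c a b => ric_add₂ g A e y c a b)
    (fun r c a => ric_smul₂ g A e y c a r)

/-- The curvature as a bilinear form in the outer arguments. -/
def curv4Outer : E →ₗ[ℝ] E →ₗ[ℝ] ℝ :=
  LinearMap.mk₂ ℝ (fun a d => curv4 g A y a b c d) (fun a a' d => curv4_add₁ g A y a b c d a')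
    (fun r a d => curv4_smul₁ g A y a b c d r) (fun a d d' => curv4_add₄ g A y d a b c d')
    (fun r a d => curv4_smul₄ g A y d a b c r)

end Linearity

variable [DecidableEq ι]

/-- Contraction of a linear functional with a frame. -/
theorem IsOrthonormalFrame.sum_mul (he : IsOrthonormalFrame g e Ω) {y : E} (hy : y ∈ Ω)
    (f : E →ₗ[ℝ] ℝ) (a : E) : ∑ i, f (e i y) * g y a (e i y) = f a := by
  conv_rhs => rw [he.span y hy a]
  rw [map_sum]
  exact Finset.sum_congr rfl fun i _ => by rw [map_smul, smul_eq_mul, mul_comm]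

theorem frame_hasCovDerivAt (he : IsOrthonormalFrame g e Ω) {γ : ℝ → E} {v : E} {t : ℝ}
    (ht : γ t ∈ Ω) (hγ : HasDerivAt γ v t) (i : ι) :
    HasCovDerivAt A γ v (fun t => e i (γ t)) (frameCov A e (γ t) v i) t := by
  have := (he.differentiableAt i _ ht).hasFDerivAt.comp_hasDerivAt t hγ
  exact this.congr_deriv (by simp only [frameCov, add_sub_cancel_right])

section

variable (h : IsLeviCivita g A Ω) (he : IsOrthonormalFrame g e Ω)
include h he

section Point

variable {y : E} (hy : y ∈ Ω)
include hy

theorem frameCov_skew (v : E) (i j : ι) :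
    g y (frameCov A e y v i) (e j y) = -g y (frameCov A e y v j) (e i y) := by
  have h1 := h.metric_hasDerivAt (γ := fun t : ℝ => y + t • v) (t := 0) (by simpa using hy)
    (hasDerivAt_line y v 0) (frame_hasCovDerivAt he (by simpa using hy) (hasDerivAt_line y v 0) i)
    (frame_hasCovDerivAt he (by simpa using hy) (hasDerivAt_line y v 0) j)
  have h2 := h1.unique ((hasDerivAt_const (0 : ℝ) (if i = j then (1 : ℝ) else
      0)).congr_of_eventuallyEq
    (by filter_upwards [h.eventually_line_mem hy v] with t ht using he.orthonormal _ ht i j))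
  simp only [zero_smul, add_zero] at h2
  rw [h.symm y hy (frameCov A e y v j)]
  linarith

/-- The matrix of ∇e in the frame is skew and meets the symmetrisation of β. Hence traces over the
moving frame may be differentiated as if the frame were parallel. -/
theorem sum_frameCov_eq_zero (β : E →ₗ[ℝ] E →ₗ[ℝ] ℝ) (v : E) :
    ∑ i, (β (frameCov A e y v i) (e i y) + β (e i y) (frameCov A e y v i)) = 0 := by
  let w : ι → ι → ℝ := fun i j => g y (frameCov A e y v i) (e j y)
  have hD : ∀ i, frameCov A e y v i = ∑ j, w i j • e j y := fun i => he.span y hy _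
  rw [← sum_skew_mul_symm_eq_zero Finset.univ w (fun i j => β (e j y) (e i y) + β (e i y) (e j y))
    (fun i j => frameCov_skew h he hy v i j) (fun i j => add_comm _ _)]
  refine Finset.sum_congr rfl fun i _ => ?_
  rw [hD]
  simp only [map_sum, map_smul, LinearMap.sum_apply, LinearMap.smul_apply, smul_eq_mul,
    ← Finset.sum_add_distrib]
  exact Finset.sum_congr rfl fun j _ => by ring

omit he in
theorem ric_symm (b c : E) : ric g A e y b c = ric g A e y c b := by
  refine Finset.sum_congr rfl fun i _ => ?_
  rw [h.curv4_pair hy, curv4_swap, h.curv4_swap₃₄ hy, neg_neg]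

omit he in
theorem ricCov_symm (v b c : E) : ricCov g A e y v b c = ricCov g A e y v c b := by
  refine Finset.sum_congr rfl fun i _ => ?_
  rw [h.curv4Cov_pair hy, h.curv4Cov_swap hy, h.curv4Cov_swap₃₄ hy, neg_neg]

omit he in
/-- The contracted second Bianchi identity. -/
theorem div_curv4 (b c d : E) : ∑ k, curv4Cov g A y (e k y) (e k y) b c d
    = ricCov g A e y d c b - ricCov g A e y c d b := by
  rw [ricCov, ricCov, ← Finset.sum_sub_distrib]
  refine Finset.sum_congr rfl fun k _ => ?_
  have e1 := h.curv4Cov_bianchi₂ hy (e k y) c d b (e k y)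
  have e2 := h.curv4Cov_pair hy (e k y) c d b (e k y)
  have e3 := h.curv4Cov_swap hy (e k y) (e k y) b c d
  have e4 := h.curv4Cov_swap hy c (e k y) d b (e k y)
  linarith

omit he in
-- A double trace of ∇R is evaluated in two ways, by pair symmetry and by `div_curv4`.
theorem scalCov_eq (d : E) : scalCov g A e y d = 2 * ∑ k, ricCov g A e y (e k y) d (e k y) := by
  have e1 : ∑ j, ∑ k, curv4Cov g A y (e k y) (e k y) (e j y) (e j y) d
      = ∑ k, ricCov g A e y (e k y) d (e k y) := by
    rw [Finset.sum_comm]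
    exact Finset.sum_congr rfl fun k _ => Finset.sum_congr rfl fun j _ => h.curv4Cov_pair hy ..
  have e2 : ∑ j, ∑ k, curv4Cov g A y (e k y) (e k y) (e j y) (e j y) d
      = scalCov g A e y d - ∑ k, ricCov g A e y (e k y) d (e k y) := by
    rw [scalCov, ← Finset.sum_sub_distrib]
    exact Finset.sum_congr rfl fun j _ => div_curv4 h hy ..
  linarith

end Point

variable {γ X Y : ℝ → E} {v DX DY : E} {t : ℝ}

theorem ric_hasDerivAt (ht : γ t ∈ Ω) (hγ : HasDerivAt γ v t)
    (hX : HasCovDerivAt A γ v X DX t) (hY : HasCovDerivAt A γ v Y DY t) :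
    HasDerivAt (fun t => ric g A e (γ t) (X t) (Y t)) (ricCov g A e (γ t) v (X t) (Y t)
      + ric g A e (γ t) DX (Y t) + ric g A e (γ t) (X t) DY) t := by
  refine (HasDerivAt.fun_sum fun i _ => h.curv4_hasDerivAt ht hγ (frame_hasCovDerivAt he ht hγ i)
    hX hY (frame_hasCovDerivAt he ht hγ i)).congr_deriv ?_
  have := sum_frameCov_eq_zero h he ht (curv4Outer g A (γ t) (X t) (Y t)) v
  simp only [curv4Outer, LinearMap.mk₂_apply, Finset.sum_add_distrib] at this
  simp only [ric, ricCov, Finset.sum_add_distrib]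
  linarith

theorem scal_hasDerivAt (ht : γ t ∈ Ω) (hγ : HasDerivAt γ v t) :
    HasDerivAt (fun t => scal g A e (γ t)) (scalCov g A e (γ t) v) t := by
  refine (HasDerivAt.fun_sum fun i _ => ric_hasDerivAt h he ht hγ (frame_hasCovDerivAt he ht hγ i)
    (frame_hasCovDerivAt he ht hγ i)).congr_deriv ?_
  have := sum_frameCov_eq_zero h he ht (ricLin g A e (γ t)) v
  simp only [ricLin, LinearMap.mk₂_apply, Finset.sum_add_distrib] at this
  simp only [scalCov, Finset.sum_add_distrib]
  linarith

end

end Frames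

/-! ### Consequences of the soliton equation and of harmonic Weyl curvature. -/

section SolitonFrame

set_option linter.unusedSectionVars false

open Filter Topology

variable {E : Type*} [NormedAddCommGroup E] [NormedSpace ℝ E]
  {g : E → E →L[ℝ] E →L[ℝ] ℝ} {A : E → E →L[ℝ] E →L[ℝ] E} {Ω : Set E}

/-- The Hessian of `u`. -/
def hess (A : E → E →L[ℝ] E →L[ℝ] E) (u : E → ℝ) (y a b : E) : ℝ :=
  fderiv ℝ (fderiv ℝ u) y a b - fderiv ℝ u y (A y a b)

/-- The covariant derivative of the Hessian of `u`. -/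
def hessCov (A : E → E →L[ℝ] E →L[ℝ] E) (u : E → ℝ) (y v a b : E) : ℝ :=
  fderiv ℝ (fderiv ℝ (fderiv ℝ u)) y v a b - fderiv ℝ (fderiv ℝ u) y v (A y a b)
    - fderiv ℝ u y (fderiv ℝ A y v a b) - hess A u y (A y v a) b - hess A u y a (A y v b)

namespace IsLeviCivita

variable (h : IsLeviCivita g A Ω) {u : E → ℝ} (hu : ∀ y ∈ Ω, ContDiffAt ℝ ∞ u y)
include h hu

theorem du_hasDerivAt {γ X : ℝ → E} {v DX : E} {t : ℝ} (ht : γ t ∈ Ω) (hγ : HasDerivAt γ v t)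
    (hX : HasCovDerivAt A γ v X DX t) :
    HasDerivAt (fun t => fderiv ℝ u (γ t) (X t))
      (hess A u (γ t) v (X t) + fderiv ℝ u (γ t) DX) t := by
  have h1 : HasDerivAt (fun t => fderiv ℝ u (γ t)) (fderiv ℝ (fderiv ℝ u) (γ t) v) t :=
    ((((hu _ ht).fderiv_right (m := 1) (by norm_cast)).differentiableAt
      (by norm_num)).hasFDerivAt).comp_hasDerivAt t hγ
  refine (h1.clm_apply hX).congr_deriv ?_
  simp only [hess, map_sub]
  ring

variable {y : E} (hy : y ∈ Ω)
include hy

theorem hess_line (v a b : E) :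
    HasDerivAt (fun t : ℝ => hess A u (y + t • v) (a - t • A y v a) (b - t • A y v b))
      (hessCov A u y v a b) 0 := by
  have hy0 : y + (0 : ℝ) • v ∈ Ω := by simpa using hy
  have hγ := hasDerivAt_line y v 0
  have c1 : ContDiffAt ℝ ∞ (fderiv ℝ u) (y + (0 : ℝ) • v) :=
    (hu _ hy0).fderiv_right (m := ∞) (by norm_cast)
  have c2 : ContDiffAt ℝ ∞ (fderiv ℝ (fderiv ℝ u)) (y + (0 : ℝ) • v) :=
    c1.fderiv_right (m := ∞) (by norm_cast)
  have h1 := (c1.differentiableAt (by norm_num)).hasFDerivAt.comp_hasDerivAt (0 : ℝ) hγ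
  have h2 := (c2.differentiableAt (by norm_num)).hasFDerivAt.comp_hasDerivAt (0 : ℝ) hγ
  have hX : ∀ a, HasDerivAt (fun t : ℝ => a - t • A y v a) (-A y v a) 0 := fun a => by
    have := hasCovDerivAt_line (A := A) y v a
    simpa [HasCovDerivAt] using this
  have h3 := h.connection_hasDerivAt (γ := fun t : ℝ => y + t • v) hy0 hγ (hX a) (hX b)
  refine (((h2.clm_apply (hX a)).clm_apply (hX b)).sub (h1.clm_apply h3)).congr_deriv ?_
  simp only [zero_smul, add_zero, sub_zero, hessCov, hess, map_neg, map_add, neg_apply, add_apply,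
    Function.comp]
  ring

/-- Third derivatives of u are symmetric; what survives antisymmetrisation is the curvature acting
on du. -/
theorem ricci_identity (v a b : E) :
    hessCov A u y v a b - hessCov A u y a v b = -fderiv ℝ u y (curv A y v a b) := by
  have c1 : ContDiffAt ℝ ∞ (fderiv ℝ u) y := (hu _ hy).fderiv_right (m := ∞) (by norm_cast)
  have s2 : ∀ v a, fderiv ℝ (fderiv ℝ u) y v a = fderiv ℝ (fderiv ℝ u) y a v := fun v a =>
    ((hu y hy).isSymmSndFDerivAt
      (by simp only [minSmoothness_of_isRCLikeNormedField]; norm_cast)).eq v a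
  have s3 : fderiv ℝ (fderiv ℝ (fderiv ℝ u)) y v a = fderiv ℝ (fderiv ℝ (fderiv ℝ u)) y a v :=
    (c1.isSymmSndFDerivAt
      (by simp only [minSmoothness_of_isRCLikeNormedField]; norm_cast)).eq v a
  simp only [hessCov, hess, curv, map_add, map_sub]
  rw [s3, h.torsion_free y hy a v, s2 v (A y a b), s2 a (A y v b)]
  ring

end IsLeviCivita

/-- A gradient Ricci soliton with harmonic Weyl tensor on an open set of a vector space, together
with an orthonormal frame `e` of eigenvectors of the Ricci tensor such that `∇u = ψ e_0`. -/
structure IsSolitonFrame {ι : Type*} [Fintype ι] [DecidableEq ι] (g : E → E →L[ℝ] E →L[ℝ] ℝ)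
    (A : E → E →L[ℝ] E →L[ℝ] E) (e : ι → E → E) (Ω : Set E) (o : ι) (u : E → ℝ) (lam : ℝ)
    (ψ : E → ℝ) (ev : ι → E → ℝ) : Prop where
  lc : IsLeviCivita g A Ω
  frame : IsOrthonormalFrame g e Ω
  smooth : ∀ y ∈ Ω, ContDiffAt ℝ ∞ u y
  soliton : ∀ y ∈ Ω, ∀ a b, hess A u y a b = -ric g A e y a b + lam * g y a b
  eigen : ∀ i, ∀ y ∈ Ω, ∀ b, ric g A e y (e i y) b = ev i y * g y (e i y) b
  grad : ∀ y ∈ Ω, ∀ b, fderiv ℝ u y b = ψ y * g y (e o y) b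
  grad_ne_zero : ∀ y ∈ Ω, ψ y ≠ 0
  card : 4 ≤ Fintype.card ι
  div_weyl : ∀ y ∈ Ω, ∀ b c d, ∑ k, (curv4Cov g A y (e k y) (e k y) b c d
    - 1 / ((Fintype.card ι : ℝ) - 2) * (ricCov g A e y (e k y) b c * g y (e k y) d
      + ricCov g A e y (e k y) (e k y) d * g y b c - ricCov g A e y (e k y) (e k y) c * g y b d
      - ricCov g A e y (e k y) b d * g y (e k y) c)
    + scalCov g A e y (e k y) / (((Fintype.card ι : ℝ) - 1) * ((Fintype.card ι : ℝ) - 2))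
      * (g y b c * g y (e k y) d - g y (e k y) c * g y b d)) = 0

namespace IsSolitonFrame

variable {ι : Type*} [Fintype ι] [DecidableEq ι] {e : ι → E → E} {o : ι} {u : E → ℝ} {lam : ℝ}
  {ψ : E → ℝ} {ev : ι → E → ℝ} (S : IsSolitonFrame g A e Ω o u lam ψ ev)
include S

section Point

variable {y : E} (hy : y ∈ Ω)
include hy

/-- The soliton equation is differentiated along first-order parallel fields; the term λg drops out
because the metric is parallel. -/
theorem hessCov_eq (v a b : E) : hessCov A u y v a b = -ricCov g A e y v a b := by
  have hy0 : y + (0 : ℝ) • v ∈ Ω := by simpa using hy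
  have h1 := (ric_hasDerivAt S.lc S.frame (γ := fun t : ℝ => y + t • v) hy0
    (hasDerivAt_line y v 0) (hasCovDerivAt_line y v a) (hasCovDerivAt_line y v b)).neg.add
    ((S.lc.metric_hasDerivAt (γ := fun t : ℝ => y + t • v) hy0 (hasDerivAt_line y v 0)
    (hasCovDerivAt_line y v a) (hasCovDerivAt_line y v b)).const_mul lam)
  have h2 := (S.lc.hess_line S.smooth hy v a b).unique (h1.congr_of_eventuallyEq (by
    filter_upwards [S.lc.eventually_line_mem hy v] with t ht using S.soliton _ ht _ _))
  have r1 : ∀ c, ric g A e y 0 c = 0 := fun c => by simpa using ric_smul₁ g A e y c 0 (0 : ℝ)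
  have r2 : ∀ c, ric g A e y c 0 = 0 := fun c => by simpa using ric_smul₂ g A e y c 0 (0 : ℝ)
  rw [h2]
  simp [r1, r2]

theorem ricCov_comm (v a b : E) : ricCov g A e y v a b - ricCov g A e y a v b
    = ψ y * curv4 g A y v a b (e o y) := by
  have := S.lc.ricci_identity S.smooth hy v a b
  rw [S.hessCov_eq hy, S.hessCov_eq hy, S.grad y hy, S.lc.symm y hy] at this
  simp only [curv4]
  linarith

/-- Trace of `ricCov_comm`: the divergence of the Ricci tensor is half of dR, leaving half of dR
equal to ψ r(e_o, ·). -/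
theorem scalCov_eq_ric (v : E) : scalCov g A e y v = 2 * (ψ y * ric g A e y (e o y) v) := by
  have h1 : ∑ j, (ricCov g A e y v (e j y) (e j y) - ricCov g A e y (e j y) v (e j y))
      = ψ y * ric g A e y (e o y) v := by
    rw [ric, Finset.mul_sum]
    refine Finset.sum_congr rfl fun j _ => ?_
    rw [S.ricCov_comm hy, S.lc.curv4_pair hy]
  have h2 := scalCov_eq S.lc (e := e) hy v
  rw [Finset.sum_sub_distrib] at h1
  simp only [scalCov] at h2 ⊢
  linarith

/-- The Cotton tensor vanishes: after the contracted Bianchi identities the divergence of the Weyl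
tensor is a multiple of it, with a factor n - 3. -/
theorem ricCov_comm' (b c d : E) : ricCov g A e y d b c - ricCov g A e y c b d
    = 1 / (2 * ((Fintype.card ι : ℝ) - 1)) * (scalCov g A e y d * g y b c
      - scalCov g A e y c * g y b d) := by
  have h0 := S.div_weyl y hy b c d
  have hn : (4 : ℝ) ≤ Fintype.card ι := by exact_mod_cast S.card
  set n : ℝ := (Fintype.card ι : ℝ) with hndef
  let ricL : E → E → E →ₗ[ℝ] ℝ := fun b c =>
    { toFun := fun v => ricCov g A e y v b c
      map_add' := fun v v' => ricCov_add g A e y b c v v'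
      map_smul' := fun r v => ricCov_smul g A e y b c v r }
  let scL : E →ₗ[ℝ] ℝ :=
    { toFun := scalCov g A e y
      map_add' := fun v v' => scalCov_add g A e y v v'
      map_smul' := fun r v => scalCov_smul g A e y v r }
  have f1 : ∀ b c d, ∑ k, ricCov g A e y (e k y) b c * g y (e k y) d = ricCov g A e y d b c :=
    fun b c d => by
      simp only [S.lc.symm y hy (e _ y)]
      exact S.frame.sum_mul hy (ricL b c) d
  have f2 : ∀ d, ∑ k, scalCov g A e y (e k y) * g y (e k y) d = scalCov g A e y d := fun d => by
    simp only [S.lc.symm y hy (e _ y)]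
    exact S.frame.sum_mul hy scL d
  have f3 : ∀ d, ∑ k, ricCov g A e y (e k y) (e k y) d = scalCov g A e y d / 2 := fun d => by
    have := scalCov_eq S.lc (e := e) hy d
    have h' : ∑ k, ricCov g A e y (e k y) (e k y) d = ∑ k, ricCov g A e y (e k y) d (e k y) :=
      Finset.sum_congr rfl fun k _ => ricCov_symm S.lc hy _ _ _
    linarith
  have e1 : ∀ k, curv4Cov g A y (e k y) (e k y) b c d
    - 1 / (n - 2) * (ricCov g A e y (e k y) b c * g y (e k y) d
      + ricCov g A e y (e k y) (e k y) d * g y b c - ricCov g A e y (e k y) (e k y) c * g y b d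
      - ricCov g A e y (e k y) b d * g y (e k y) c)
    + scalCov g A e y (e k y) / ((n - 1) * (n - 2))
      * (g y b c * g y (e k y) d - g y (e k y) c * g y b d)
    = curv4Cov g A y (e k y) (e k y) b c d
    - 1 / (n - 2) * (ricCov g A e y (e k y) b c * g y (e k y) d)
    - 1 / (n - 2) * g y b c * ricCov g A e y (e k y) (e k y) d
    + 1 / (n - 2) * g y b d * ricCov g A e y (e k y) (e k y) c
    + 1 / (n - 2) * (ricCov g A e y (e k y) b d * g y (e k y) c)
    + g y b c / ((n - 1) * (n - 2)) * (scalCov g A e y (e k y) * g y (e k y) d)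
    - g y b d / ((n - 1) * (n - 2)) * (scalCov g A e y (e k y) * g y (e k y) c) := fun k => by ring
  simp only [e1, Finset.sum_add_distrib, Finset.sum_sub_distrib, ← Finset.mul_sum, f1, f2, f3,
    div_curv4 S.lc (e := e) hy] at h0
  rw [ricCov_symm S.lc hy d c b, ricCov_symm S.lc hy c d b] at h0
  have n1 : n - 1 ≠ 0 := by linarith
  have n2 : n - 2 ≠ 0 := by linarith
  -- The bound n ≥ 4 is needed for this cancellation.
  have n3 : n - 3 ≠ 0 := by linarith
  rw [one_div, eq_inv_mul_iff_mul_eq₀ (mul_ne_zero two_ne_zero n1)]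
  refine mul_left_cancel₀ n3 ?_
  field_simp at h0
  linear_combination h0

/-- The components of the curvature tensor with one index in the direction of `∇u`. -/
theorem curv4_first (a b c : E) : curv4 g A y a b c (e o y)
    = ev o y / ((Fintype.card ι : ℝ) - 1)
      * (g y (e o y) a * g y b c - g y (e o y) b * g y a c) := by
  have hn : (4 : ℝ) ≤ Fintype.card ι := by exact_mod_cast S.card
  have n1 : (Fintype.card ι : ℝ) - 1 ≠ 0 := by linarith
  -- The antisymmetrised ∇r is computed twice. The Ricci identity gives ψ R(a,b,c,e_o); the
  -- vanishing Cotton tensor gives terms in dR = 2ψ r(e_o, ·), and e_o is a Ricci eigenvector.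
  have h1 := S.ricCov_comm hy a b c
  rw [ricCov_symm S.lc hy b a c, ricCov_symm S.lc hy a b c, ricCov_symm S.lc hy b c a] at h1
  have h2 := S.ricCov_comm' hy c b a
  rw [ricCov_symm S.lc hy b c a] at h2
  rw [h2, S.scalCov_eq_ric hy, S.scalCov_eq_ric hy, S.eigen o y hy, S.eigen o y hy,
    S.lc.symm y hy c b, S.lc.symm y hy c a] at h1
  refine mul_left_cancel₀ (S.grad_ne_zero y hy) (h1.symm.trans ?_)
  field_simp

end Point

end IsSolitonFrame

end SolitonFrame

/-! ### Evolution equations along the integral curves of the unit gradient. -/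

section RadialEvolution

set_option linter.unusedSectionVars false

open Filter Topology

variable {E : Type*} [NormedAddCommGroup E] [NormedSpace ℝ E]
  {g : E → E →L[ℝ] E →L[ℝ] ℝ} {A : E → E →L[ℝ] E →L[ℝ] E} {Ω : Set E}
  {ι : Type*} [Fintype ι] [DecidableEq ι] {e : ι → E → E}

theorem IsOrthonormalFrame.ext (he : IsOrthonormalFrame g e Ω) {y : E} (hy : y ∈ Ω) {a b : E}
    (h : ∀ j, g y a (e j y) = g y b (e j y)) : a = b := by
  rw [he.span y hy a, he.span y hy b]
  simp only [h]

/-- The eigenvalue of the second fundamental form of the level sets in the direction of `e_i`. -/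
def shape (lam : ℝ) (ψ : E → ℝ) (ev : ι → E → ℝ) (i : ι) (y : E) : ℝ := (lam - ev i y) / ψ y

namespace IsSolitonFrame

variable {o : ι} {u : E → ℝ} {lam : ℝ}
  {ψ : E → ℝ} {ev : ι → E → ℝ} (S : IsSolitonFrame g A e Ω o u lam ψ ev)
include S

section Point

variable {y : E} (hy : y ∈ Ω)
include hy

theorem hess_frame (i : ι) (b : E) : hess A u y (e i y) b = (lam - ev i y) * g y (e i y) b := by
  rw [S.soliton y hy, S.eigen i y hy]
  ring

theorem shape_mul (i : ι) : ψ y * shape lam ψ ev i y = lam - ev i y :=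
  mul_div_cancel₀ _ (S.grad_ne_zero y hy)

theorem frameCov_inner_self (v : E) (i : ι) : g y (frameCov A e y v i) (e i y) = 0 := by
  have := frameCov_skew S.lc S.frame hy v i i
  linarith

theorem frameCov_first_inner (v b : E) : ψ y * g y (frameCov A e y v o) b
    = hess A u y v b - hess A u y v (e o y) * g y (e o y) b := by
  have hy0 : y + (0 : ℝ) • v ∈ Ω := by simpa using hy
  have hγ := hasDerivAt_line y v 0
  have he := frame_hasCovDerivAt (A := A) S.frame (γ := fun t : ℝ => y + t • v) hy0 hγ o
  have hb := hasCovDerivAt_line (A := A) y v b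
  have h1 := S.lc.du_hasDerivAt S.smooth (γ := fun t : ℝ => y + t • v) hy0 hγ hb
  have h2 := (S.lc.du_hasDerivAt S.smooth (γ := fun t : ℝ => y + t • v) hy0 hγ he).mul
    (S.lc.metric_hasDerivAt (γ := fun t : ℝ => y + t • v) hy0 hγ he hb)
  have h3 := h1.unique (h2.congr_of_eventuallyEq (by
    filter_upwards [S.lc.eventually_line_mem hy v] with t ht
    simp only [Pi.mul_apply, S.grad _ ht, S.frame.orthonormal _ ht, if_true, mul_one]))
  simp only [zero_smul, add_zero, sub_zero, map_zero, S.grad y hy,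
    S.lc.symm y hy (e o y) (frameCov A e y v o), S.frameCov_inner_self hy,
    S.frame.orthonormal y hy, if_true] at h3
  linarith

theorem frameCov_first {i : ι} (hi : i ≠ o) :
    frameCov A e y (e i y) o = shape lam ψ ev i y • e i y := by
  refine S.frame.ext hy fun j => mul_left_cancel₀ (S.grad_ne_zero y hy) ?_
  rw [S.frameCov_first_inner hy, S.hess_frame hy, S.hess_frame hy, S.frame.orthonormal y hy i o,
    if_neg hi, map_smul, smul_apply, smul_eq_mul, ← mul_assoc, S.shape_mul hy]
  ring

theorem frameCov_first_self : frameCov A e y (e o y) o = 0 := by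
  refine S.frame.ext hy fun j => mul_left_cancel₀ (S.grad_ne_zero y hy) ?_
  rw [S.frameCov_first_inner hy, S.hess_frame hy, S.hess_frame hy, S.frame.orthonormal y hy o o,
    if_pos rfl, map_zero, zero_apply]
  ring

/-- `curv4_first` is differentiated in a level direction, with r(e_o,e_o) in place of the
eigenvalue. The derivative of that factor drops out because e_p and e_q are orthogonal to e_o; the
derivative of e_o gives the shape factor. -/
theorem curv4Cov_first {i p q : ι} (hi : i ≠ o) (hp : p ≠ o) (hq : q ≠ o) (c : E) :
    curv4Cov g A y (e i y) (e p y) (e q y) c (e o y) = -shape lam ψ ev i y *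
      (curv4 g A y (e p y) (e q y) c (e i y) - ev o y / ((Fintype.card ι : ℝ) - 1)
        * (g y (e i y) (e p y) * g y (e q y) c - g y (e i y) (e q y) * g y (e p y) c)) := by
  have hy0 : y + (0 : ℝ) • e i y ∈ Ω := by simpa using hy
  have hγ := hasDerivAt_line y (e i y) 0
  have he := frame_hasCovDerivAt (A := A) S.frame (γ := fun t : ℝ => y + t • e i y) hy0 hγ o
  have hl := hasCovDerivAt_line (A := A) y (e i y)
  have h1 := S.lc.curv4_hasDerivAt (γ := fun t : ℝ => y + t • e i y) hy0 hγ (hl (e p y))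
    (hl (e q y)) (hl c) he
  have hm := fun {X Y : ℝ → E} {DX DY : E} =>
    S.lc.metric_hasDerivAt (γ := fun t : ℝ => y + t • e i y) (X := X) (Y := Y) (DX := DX) (DY := DY)
      hy0 hγ
  have hr := (ric_hasDerivAt S.lc S.frame (γ := fun t : ℝ => y + t • e i y) hy0 hγ he he).div_const
    ((Fintype.card ι : ℝ) - 1)
  have h2 := hr.mul (((hm he (hl (e p y))).mul (hm (hl (e q y)) (hl c))).sub
    ((hm he (hl (e q y))).mul (hm (hl (e p y)) (hl c))))
  have h3 := h1.unique (h2.congr_of_eventuallyEq (by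
    filter_upwards [S.lc.eventually_line_mem hy (e i y)] with t ht
    simp only [Pi.mul_apply, Pi.sub_apply, S.curv4_first ht, S.eigen o _ ht,
      S.frame.orthonormal _ ht, if_true, mul_one]))
  have z1 : curv4 g A y 0 (e q y) c (e o y) = 0 := by simp [curv4, curv]
  have z2 : curv4 g A y (e p y) 0 c (e o y) = 0 := by simp [curv4, curv]
  have z3 : curv4 g A y (e p y) (e q y) 0 (e o y) = 0 := by simp [curv4, curv]
  simp only [zero_smul, add_zero, sub_zero, map_zero, zero_apply, S.frameCov_first hy hi,
    Pi.mul_apply, Pi.sub_apply, z1, z2, z3, curv4_smul₄, map_smul, smul_apply, smul_eq_mul,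
    S.frame.orthonormal y hy o, if_neg hp.symm, if_neg hq.symm, zero_mul, mul_zero, zero_add] at h3
  rw [S.eigen o y hy, S.frame.orthonormal y hy o o, if_pos rfl] at h3
  linear_combination h3

/-- The radial covariant derivative of the sectional curvatures of the level directions. -/
theorem curv4Cov_radial {i j : ι} (hi : i ≠ o) (hj : j ≠ o) (hij : i ≠ j) :
    curv4Cov g A y (e o y) (e i y) (e j y) (e j y) (e i y)
      = -(shape lam ψ ev i y + shape lam ψ ev j y) * (curv4 g A y (e i y) (e j y) (e j y) (e i y)
        - ev o y / ((Fintype.card ι : ℝ) - 1)) := by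
  -- The second Bianchi identity trades the radial derivative for two tangential ones, and pair
  -- symmetry moves e_o into the last slot, where `curv4Cov_first` applies.
  have b := S.lc.curv4Cov_bianchi₂ hy (e o y) (e i y) (e j y) (e j y) (e i y)
  have b1 : curv4Cov g A y (e i y) (e j y) (e o y) (e j y) (e i y)
      = curv4Cov g A y (e i y) (e j y) (e i y) (e j y) (e o y) := S.lc.curv4Cov_pair hy ..
  have b2 : curv4Cov g A y (e j y) (e o y) (e i y) (e j y) (e i y)
      = -curv4Cov g A y (e j y) (e j y) (e i y) (e i y) (e o y) := by
    rw [S.lc.curv4Cov_pair hy, S.lc.curv4Cov_swap₃₄ hy]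
  have c1 := curv4_swap g A y (e i y) (e j y) (e j y) (e i y)
  have c2 : curv4 g A y (e j y) (e i y) (e i y) (e j y)
      = curv4 g A y (e i y) (e j y) (e j y) (e i y) := by
    rw [curv4_swap, S.lc.curv4_swap₃₄ hy, neg_neg]
  rw [b1, b2, S.curv4Cov_first hy hi hj hi, S.curv4Cov_first hy hj hj hi, c1, c2] at b
  simp only [S.frame.orthonormal y hy, if_true, if_neg hij, if_neg hij.symm] at b
  linear_combination b

/-- The eigenvector equation of e_o, with eigenvalue r(e_o,e_o), is differentiated in the direction
e_i, using ∇_{e_i} e_o = ζ_i e_i. -/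
theorem ricCov_first {i : ι} (hi : i ≠ o) {j : ι} (hj : j ≠ o) :
    ricCov g A e y (e i y) (e o y) (e j y)
      = if i = j then shape lam ψ ev i y * (ev o y - ev i y) else 0 := by
  have hy0 : y + (0 : ℝ) • e i y ∈ Ω := by simpa using hy
  have hγ := hasDerivAt_line y (e i y) 0
  have he := frame_hasCovDerivAt (A := A) S.frame (γ := fun t : ℝ => y + t • e i y) hy0 hγ o
  have hl := hasCovDerivAt_line (A := A) y (e i y) (e j y)
  have h1 := ric_hasDerivAt S.lc S.frame (γ := fun t : ℝ => y + t • e i y) hy0 hγ he hl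
  have h2 := (ric_hasDerivAt S.lc S.frame (γ := fun t : ℝ => y + t • e i y) hy0 hγ he he).mul
    (S.lc.metric_hasDerivAt (γ := fun t : ℝ => y + t • e i y) hy0 hγ he hl)
  have h3 := h1.unique (h2.congr_of_eventuallyEq (by
    filter_upwards [S.lc.eventually_line_mem hy (e i y)] with t ht
    simp only [Pi.mul_apply, S.eigen o _ ht, S.frame.orthonormal _ ht, if_true, mul_one]))
  have r2 : ∀ c, ric g A e y c 0 = 0 := fun c => by simpa using ric_smul₂ g A e y c 0 (0 : ℝ)
  simp only [zero_smul, add_zero, sub_zero, map_zero, S.frameCov_first hy hi,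
    r2, ric_smul₁, map_smul, smul_apply, smul_eq_mul,
    S.frame.orthonormal y hy o, if_neg hj.symm, mul_zero, zero_add] at h3
  rw [S.eigen o y hy, S.eigen i y hy, S.frame.orthonormal y hy o o, S.frame.orthonormal y hy i j,
    if_pos rfl] at h3
  split_ifs at h3 ⊢ <;> linarith

/-- `ricCov_comm` exchanges the radial derivative for `ricCov_first` plus a curvature term known
from `curv4_first`. -/
theorem ricCov_radial {i : ι} (hi : i ≠ o) {j : ι} (hj : j ≠ o) :
    ricCov g A e y (e o y) (e i y) (e j y) = if i = j then
      ψ y * (ev o y / ((Fintype.card ι : ℝ) - 1)) + shape lam ψ ev i y * (ev o y - ev i y)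
        else 0 := by
  have h1 := S.ricCov_comm hy (e o y) (e i y) (e j y)
  rw [S.ricCov_first hy hi hj, S.curv4_first hy] at h1
  simp only [S.frame.orthonormal y hy, if_neg hj.symm, if_true] at h1
  split_ifs at h1 ⊢ <;> linarith

theorem scal_eq : scal g A e y = ∑ i, ev i y := by
  refine Finset.sum_congr rfl fun i _ => ?_
  rw [S.eigen i y hy, S.frame.orthonormal y hy, if_pos rfl, mul_one]

end Point

section Curve

variable {γ : ℝ → E} {t : ℝ} (ht : γ t ∈ Ω) (hγ : HasDerivAt γ (e o (γ t)) t)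
include ht hγ

theorem eventually_mem : ∀ᶠ x in 𝓝 t, γ x ∈ Ω :=
  hγ.continuousAt.eventually_mem (S.lc.isOpen.mem_nhds ht)

/-- The derivative of a unit vector is orthogonal to it, so the motion of the eigenvector does not
contribute. -/
theorem ev_hasDerivAt {i : ι} (hi : i ≠ o) : HasDerivAt (fun t => ev i (γ t))
    (ψ (γ t) * (ev o (γ t) / ((Fintype.card ι : ℝ) - 1))
      + shape lam ψ ev i (γ t) * (ev o (γ t) - ev i (γ t))) t := by
  have he := frame_hasCovDerivAt (A := A) S.frame ht hγ i
  have h1 := ric_hasDerivAt S.lc S.frame ht hγ he he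
  have h2 := h1.congr_of_eventuallyEq (f₁ := fun t => ev i (γ t)) (by
    filter_upwards [S.eventually_mem ht hγ] with t ht
    rw [S.eigen i _ ht, S.frame.orthonormal _ ht, if_pos rfl, mul_one])
  refine h2.congr_deriv ?_
  rw [S.ricCov_radial ht hi hi, if_pos rfl, ric_symm S.lc ht (frameCov _ _ _ _ _),
    S.eigen i _ ht, S.lc.symm _ ht, S.frameCov_inner_self ht]
  ring

/-- Derivative of r(e_i,e_j) = 0, whose tensorial part vanishes by `ricCov_radial`: the frame only
rotates inside Ricci eigenspaces. -/
theorem frameCov_inner_eq_zero {i j : ι} (hi : i ≠ o) (hj : j ≠ o) :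
    (ev i (γ t) - ev j (γ t)) * g (γ t) (frameCov A e (γ t) (e o (γ t)) i) (e j (γ t)) = 0 := by
  rcases eq_or_ne i j with rfl | hij
  · rw [sub_self, zero_mul]
  have h1 := ric_hasDerivAt S.lc S.frame ht hγ (frame_hasCovDerivAt (A := A) S.frame ht hγ i)
    (frame_hasCovDerivAt (A := A) S.frame ht hγ j)
  have h2 := h1.unique ((hasDerivAt_const t (0 : ℝ)).congr_of_eventuallyEq (by
    filter_upwards [S.eventually_mem ht hγ] with t ht
    rw [S.eigen i _ ht, S.frame.orthonormal _ ht, if_neg hij, mul_zero]))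
  rw [S.ricCov_radial ht hi hj, if_neg hij, ric_symm S.lc ht (frameCov _ _ _ _ _),
    S.eigen i _ ht, S.eigen j _ ht, S.lc.symm _ ht (e i (γ t)), S.lc.symm _ ht (e j (γ t)),
    frameCov_skew S.lc S.frame ht _ j i] at h2
  linear_combination (-1) * h2

theorem grad_hasDerivAt : HasDerivAt (fun t => ψ (γ t)) (lam - ev o (γ t)) t := by
  have h1 := S.lc.du_hasDerivAt S.smooth ht hγ (frame_hasCovDerivAt (A := A) S.frame ht hγ o)
  have h2 := h1.congr_of_eventuallyEq (f₁ := fun t => ψ (γ t)) (by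
    filter_upwards [S.eventually_mem ht hγ] with t ht
    rw [S.grad _ ht, S.frame.orthonormal _ ht, if_pos rfl, mul_one])
  refine h2.congr_deriv ?_
  rw [S.hess_frame ht, S.frameCov_first_self ht, S.frame.orthonormal _ ht, if_pos rfl, map_zero]
  ring

theorem shape_hasDerivAt {i : ι} (hi : i ≠ o) : HasDerivAt (fun t => shape lam ψ ev i (γ t))
    (-(shape lam ψ ev i (γ t)) ^ 2 - ev o (γ t) / ((Fintype.card ι : ℝ) - 1)) t := by
  have h0 := S.grad_ne_zero _ ht
  refine (((S.ev_hasDerivAt ht hγ hi).const_sub lam).div (S.grad_hasDerivAt ht hγ) h0).congr_deriv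
      ?_
  simp only [shape]
  generalize ev o (γ t) / ((Fintype.card ι : ℝ) - 1) = s
  field_simp
  ring

/-- The first eigenvalue is the scalar curvature minus the others, and dR(e_o) = 2ψλ₁. -/
theorem ev_first_hasDerivAt : ∃ x, HasDerivAt (fun t => ev o (γ t)) x t ∧
    x + ∑ i : {i // i ≠ o}, (ψ (γ t) * (ev o (γ t) / ((Fintype.card ι : ℝ) - 1))
      + shape lam ψ ev i (γ t) * (ev o (γ t) - ev i (γ t))) = 2 * (ψ (γ t) * ev o (γ t)) := by
  have h1 := scal_hasDerivAt S.lc S.frame ht hγ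
  rw [S.scalCov_eq_ric ht, S.eigen o _ ht, S.frame.orthonormal _ ht, if_pos rfl, mul_one] at h1
  have h2 := HasDerivAt.fun_sum (u := Finset.univ) fun (i : {i // i ≠ o}) _ =>
    S.ev_hasDerivAt ht hγ i.2
  refine ⟨_, (h1.sub h2).congr_of_eventuallyEq ?_, sub_add_cancel _ _⟩
  filter_upwards [S.eventually_mem ht hγ] with t ht
  rw [Pi.sub_apply, S.scal_eq ht, Fintype.sum_eq_add_sum_subtype_ne _ o, add_sub_cancel_right]

/-- The four Leibniz terms pair up by curvature symmetries. Expanding ∇_{e_o} e_i in the frame needs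
only level directions, because ∇_{e_o} e_o = 0. -/
theorem curv4_hasDerivAt_radial {i j : ι} (hi : i ≠ o) (hj : j ≠ o) :
    HasDerivAt (fun t => curv4 g A (γ t) (e i (γ t)) (e j (γ t)) (e j (γ t)) (e i (γ t)))
      (curv4Cov g A (γ t) (e o (γ t)) (e i (γ t)) (e j (γ t)) (e j (γ t)) (e i (γ t))
        + 2 * ∑ k : {k // k ≠ o}, g (γ t) (frameCov A e (γ t) (e o (γ t)) i) (e k (γ t))
            * curv4 g A (γ t) (e i (γ t)) (e j (γ t)) (e j (γ t)) (e k (γ t))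
        + 2 * ∑ k : {k // k ≠ o}, g (γ t) (frameCov A e (γ t) (e o (γ t)) j) (e k (γ t))
            * curv4 g A (γ t) (e j (γ t)) (e i (γ t)) (e i (γ t)) (e k (γ t))) t := by
  have he := fun i => frame_hasCovDerivAt (A := A) S.frame ht hγ i
  refine (S.lc.curv4_hasDerivAt ht hγ (he i) (he j) (he j) (he i)).congr_deriv ?_
  have key : ∀ i j, i ≠ o → curv4 g A (γ t) (e i (γ t)) (e j (γ t)) (e j (γ t))
      (frameCov A e (γ t) (e o (γ t)) i)
      = ∑ k : {k // k ≠ o}, g (γ t) (frameCov A e (γ t) (e o (γ t)) i) (e k (γ t))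
            * curv4 g A (γ t) (e i (γ t)) (e j (γ t)) (e j (γ t)) (e k (γ t)) := by
    intro i j hi
    have h1 := S.frame.sum_mul ht (curv4Outer g A (γ t) (e j (γ t)) (e j (γ t)) (e i (γ t)))
      (frameCov A e (γ t) (e o (γ t)) i)
    simp only [curv4Outer, LinearMap.mk₂_apply] at h1
    rw [← h1, Fintype.sum_eq_add_sum_subtype_ne _ o, frameCov_skew S.lc S.frame ht,
      S.frameCov_first_self ht, map_zero, zero_apply, neg_zero, mul_zero, zero_add]
    exact Finset.sum_congr rfl fun k _ => mul_comm _ _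
  have sym : ∀ a b d, curv4 g A (γ t) a b b d = curv4 g A (γ t) d b b a := fun a b d => by
    rw [S.lc.curv4_pair ht, curv4_swap, S.lc.curv4_swap₃₄ ht, neg_neg]
  rw [← key i j hi, ← key j i hj]
  have e1 := sym (frameCov A e (γ t) (e o (γ t)) i) (e j (γ t)) (e i (γ t))
  have e2 : curv4 g A (γ t) (e i (γ t)) (frameCov A e (γ t) (e o (γ t)) j) (e j (γ t)) (e i (γ t))
      = curv4 g A (γ t) (e j (γ t)) (e i (γ t)) (e i (γ t)) (frameCov A e (γ t) (e o (γ t)) j) :=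
    S.lc.curv4_pair ht ..
  have e3 : curv4 g A (γ t) (e i (γ t)) (e j (γ t)) (frameCov A e (γ t) (e o (γ t)) j) (e i (γ t))
      = curv4 g A (γ t) (e j (γ t)) (e i (γ t)) (e i (γ t)) (frameCov A e (γ t) (e o (γ t)) j) := by
    rw [curv4_swap, S.lc.curv4_swap₃₄ ht, neg_neg]
  linarith

end Curve

/-- Along an integral curve of `e_0 = ∇u / |∇u|`, at most two of the shape eigenvalues differ. -/
theorem not_three_distinct {a b t₀ : ℝ} (ht₀ : t₀ ∈ Set.Ioo a b) {γ : ℝ → E}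
    (hmem : ∀ t ∈ Set.Ioo a b, γ t ∈ Ω)
    (hγ : ∀ t ∈ Set.Ioo a b, HasDerivAt γ (e o (γ t)) t) {i j k : ι} (hi : i ≠ o) (hj : j ≠ o)
    (hk : k ≠ o) (hij : ev i (γ t₀) ≠ ev j (γ t₀)) (hjk : ev j (γ t₀) ≠ ev k (γ t₀))
    (hik : ev i (γ t₀) ≠ ev k (γ t₀)) : False := by
  have hcard : (Fintype.card {i // i ≠ o} : ℝ) = (Fintype.card ι : ℝ) - 1 := by
    have := Fintype.card_subtype_compl (fun i => i = o)
    rw [Fintype.card_subtype_eq] at this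
    rw [show Fintype.card {i // i ≠ o} = Fintype.card ι - 1 from this,
      Nat.cast_sub (by have := S.card; omega), Nat.cast_one]
  have hn : (4 : ℝ) ≤ Fintype.card ι := by exact_mod_cast S.card
  have hn1 : (Fintype.card ι : ℝ) - 1 ≠ 0 := by linarith
  have hne : ∀ i j, ev i (γ t₀) ≠ ev j (γ t₀) →
      shape lam ψ ev i (γ t₀) ≠ shape lam ψ ev j (γ t₀) := fun i j h h' => h (by
    have h1 := S.shape_mul (hmem t₀ ht₀) i
    have h2 := S.shape_mul (hmem t₀ ht₀) j
    rw [h'] at h1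
    linarith)
  have hself : ∀ t a b c, curv4 g A (γ t) a a b c = 0 := fun t a b c => by
    have := curv4_swap g A (γ t) a a b c
    linarith
  -- The diagonal of L is set to zero; its evolution equation still holds because R(e_i,e_i,·,·) =
  -- 0. Off the diagonal, the terms in s coming from K_ij' and from (ζ_i ζ_j)' cancel.
  refine riccati_not_three_distinct (ι := {i // i ≠ o})
    (ζ := fun i t => shape lam ψ ev i (γ t))
    (s := fun t => ev o (γ t) / ((Fintype.card ι : ℝ) - 1)) (ψ := fun t => ψ (γ t)) (lam := lam)
    (L := fun i j t => if i = j then 0 else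
      curv4 g A (γ t) (e i (γ t)) (e j (γ t)) (e j (γ t)) (e i (γ t))
        + shape lam ψ ev i (γ t) * shape lam ψ ev j (γ t))
    (w := fun i j t => g (γ t) (frameCov A e (γ t) (e o (γ t)) i) (e j (γ t)))
    (S := fun j i k t => curv4 g A (γ t) (e i (γ t)) (e j (γ t)) (e j (γ t)) (e k (γ t)))
    ht₀ ?_ ?_ ?_ ?_ ?_ ?_ ?_ ?_ ?_ (i := ⟨i, hi⟩) (j := ⟨j, hj⟩) (k := ⟨k, hk⟩)
    (hne i j hij) (hne j k hjk) (hne i k hik)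
  · exact fun i t ht => S.shape_hasDerivAt (hmem t ht) (hγ t ht) i.2
  · intro t ht
    rw [hcard, mul_div_cancel₀ _ hn1]
    exact S.grad_hasDerivAt (hmem t ht) (hγ t ht)
  · exact fun t ht => S.grad_ne_zero _ (hmem t ht)
  · intro t ht
    obtain ⟨x, hx, he⟩ := S.ev_first_hasDerivAt (hmem t ht) (hγ t ht)
    refine ⟨x / ((Fintype.card ι : ℝ) - 1), hx.div_const _, ?_⟩
    rw [hcard, mul_div_cancel₀ _ hn1, mul_div_cancel₀ _ hn1]
    have h1 : ∀ i : {i // i ≠ o}, ψ (γ t) * (ev o (γ t) / ((Fintype.card ι : ℝ) - 1))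
        + shape lam ψ ev i (γ t) * (ev o (γ t) - ev i (γ t))
        = ψ (γ t) * (ev o (γ t) / ((Fintype.card ι : ℝ) - 1))
          - (lam - ev o (γ t)) * shape lam ψ ev i (γ t)
          + ψ (γ t) * shape lam ψ ev i (γ t) ^ 2 := fun i => by
      have := S.shape_mul (hmem t ht) i
      linear_combination (-shape lam ψ ev i (γ t)) * this
    simp only [h1, Finset.sum_add_distrib, Finset.sum_sub_distrib, ← Finset.mul_sum,
      Finset.sum_const, nsmul_eq_mul, Finset.card_univ] at he
    rw [hcard] at he
    field_simp at he
    linear_combination he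
  · intro i j t ht
    have hr := S.curv4_hasDerivAt_radial (hmem t ht) (hγ t ht) i.2 j.2
    rcases eq_or_ne i j with rfl | hij
    · simp only [if_true, hself, mul_zero, Finset.sum_const_zero, add_zero]
      exact hasDerivAt_const t 0
    · simp only [if_neg hij]
      have hij' : (i : ι) ≠ j := fun h => hij (Subtype.ext h)
      rw [S.curv4Cov_radial (hmem t ht) i.2 j.2 hij'] at hr
      refine (hr.add ((S.shape_hasDerivAt (hmem t ht) (hγ t ht) i.2).mul
        (S.shape_hasDerivAt (hmem t ht) (hγ t ht) j.2))).congr_deriv ?_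
      ring
  · exact fun i j t ht => frameCov_skew S.lc S.frame (hmem t ht) _ _ _
  · intro i j t ht
    have := S.frameCov_inner_eq_zero (hmem t ht) (hγ t ht) i.2 j.2
    have h0 : shape lam ψ ev i (γ t) - shape lam ψ ev j (γ t)
        = -(ev i (γ t) - ev j (γ t)) / ψ (γ t) := by simp only [shape]; ring
    rw [h0, div_mul_eq_mul_div, neg_mul, this, neg_zero, zero_div]
  · intro i j k t ht
    rw [S.lc.curv4_pair (hmem t ht), curv4_swap, S.lc.curv4_swap₃₄ (hmem t ht), neg_neg]
  · intro i t ht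
    have hy := hmem t ht
    -- In the trace defining the Ricci curvature of e_i, the direction e_o contributes exactly s.
    have h1 : ev i (γ t) = ev o (γ t) / ((Fintype.card ι : ℝ) - 1) + ∑ j : {j // j ≠ o},
        curv4 g A (γ t) (e i (γ t)) (e j (γ t)) (e j (γ t)) (e i (γ t)) := by
      have h2 := S.eigen i _ hy (e i (γ t))
      rw [S.frame.orthonormal _ hy, if_pos rfl, mul_one] at h2
      rw [← h2, ric, Fintype.sum_eq_add_sum_subtype_ne _ o]
      congr 1
      · rw [S.curv4_first hy]
        simp [S.frame.orthonormal _ hy, i.2.symm]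
      · exact Finset.sum_congr rfl fun j _ => by
          rw [curv4_swap, S.lc.curv4_swap₃₄ hy, neg_neg]
    have h3 : ∀ j : {j // j ≠ o}, (if i = j then 0 else
        curv4 g A (γ t) (e i (γ t)) (e j (γ t)) (e j (γ t)) (e i (γ t))
        + shape lam ψ ev i (γ t) * shape lam ψ ev j (γ t))
        = curv4 g A (γ t) (e i (γ t)) (e j (γ t)) (e j (γ t)) (e i (γ t))
        + shape lam ψ ev i (γ t) * shape lam ψ ev j (γ t)
        - if i = j then shape lam ψ ev i (γ t) ^ 2 else 0 := fun j => by
      split_ifs with hij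
      · subst hij
        rw [hself]; ring
      · ring
    simp only [h3, Finset.sum_sub_distrib, Finset.sum_add_distrib, ← Finset.mul_sum,
      Finset.sum_ite_eq, Finset.mem_univ, if_true]
    have := S.shape_mul hy i
    linarith

end IsSolitonFrame

end RadialEvolution

/-! ### Metrics given by component matrices. -/

section CoordinateFrames

open Filter Topology

theorem contDiffAt_det {E : Type*} [NormedAddCommGroup E] [NormedSpace ℝ E] {n : ℕ}
    {f : E → Matrix (Fin n) (Fin n) ℝ} {y : E} (h : ∀ i j, ContDiffAt ℝ ∞ (fun z => f z i j) y) :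
    ContDiffAt ℝ ∞ (fun z => (f z).det) y := by
  simp only [Matrix.det_apply']
  exact ContDiffAt.sum fun σ _ => contDiffAt_const.mul (contDiffAt_prod fun i _ => h _ _)

theorem contDiffAt_matrix_inv {E : Type*} [NormedAddCommGroup E] [NormedSpace ℝ E] {n : ℕ}
    {f : E → Matrix (Fin n) (Fin n) ℝ} {y : E} (h : ∀ i j, ContDiffAt ℝ ∞ (fun z => f z i j) y)
    (hdet : (f y).det ≠ 0) (i j : Fin n) : ContDiffAt ℝ ∞ (fun z => (f z)⁻¹ i j) y := by
  simp only [Matrix.inv_def, Matrix.smul_apply, Matrix.adjugate_apply, smul_eq_mul,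
    Ring.inverse_eq_inv']
  refine ((contDiffAt_det h).inv hdet).mul (contDiffAt_det fun k l => ?_)
  by_cases hk : k = j
  · subst hk
    simp only [Matrix.updateRow_self]
    exact contDiffAt_const
  · simp only [Matrix.updateRow_ne hk]
    exact h k l

variable {n : ℕ}

/-- The `i`-th standard basis vector. -/
def stdVec (i : Fin n) : EuclideanSpace ℝ (Fin n) := EuclideanSpace.single i 1

theorem eq_sum_stdVec (a : EuclideanSpace ℝ (Fin n)) : a = ∑ i, a i • stdVec i := by
  ext k
  simp [stdVec, Pi.single_apply]

theorem stdVec_apply (i k : Fin n) : (stdVec i : EuclideanSpace ℝ (Fin n)) k = if k = i then 1 else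
    0 := by
  simp [stdVec]

theorem IsLinearMap.apply_eq_sum {f : EuclideanSpace ℝ (Fin n) → ℝ} (hf : IsLinearMap ℝ f)
    (a : EuclideanSpace ℝ (Fin n)) :
    f a = ∑ i, a i * f (stdVec i) := by
  conv_lhs => rw [eq_sum_stdVec a]
  have := map_sum (hf.mk' f) (fun i => a i • stdVec i) Finset.univ
  simpa only [map_smul, IsLinearMap.mk'_apply, smul_eq_mul] using this

theorem eq_of_forall_stdVec {f f' : EuclideanSpace ℝ (Fin n) → ℝ} (hf : IsLinearMap ℝ f)
    (hf' : IsLinearMap ℝ f')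
    (h : ∀ i, f (stdVec i) = f' (stdVec i)) (a : EuclideanSpace ℝ (Fin n)) : f a = f' a := by
  rw [IsLinearMap.apply_eq_sum hf, IsLinearMap.apply_eq_sum hf']
  simp only [h]

/-- The metric with components `G`, as a bilinear form. -/
def metricForm (G : EuclideanSpace ℝ (Fin n) → Matrix (Fin n) (Fin n) ℝ)
    (y : EuclideanSpace ℝ (Fin n)) : EuclideanSpace ℝ (Fin n) →L[ℝ] EuclideanSpace ℝ (Fin n) →L[ℝ]
    ℝ :=
  ∑ i, ∑ j, G y i j • (EuclideanSpace.proj i : EuclideanSpace ℝ (Fin n) →L[ℝ] ℝ).smulRight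
    (EuclideanSpace.proj j : EuclideanSpace ℝ (Fin n) →L[ℝ] ℝ)

/-- The Christoffel symbols of `G`, as a bilinear map. -/
def christoffelMap (G : EuclideanSpace ℝ (Fin n) → Matrix (Fin n) (Fin n) ℝ)
    (y : EuclideanSpace ℝ (Fin n)) : EuclideanSpace ℝ (Fin n) →L[ℝ] EuclideanSpace ℝ (Fin n) →L[ℝ]
    EuclideanSpace ℝ (Fin n) :=
  ∑ i, ∑ j, ∑ k, christoffel G y k i j • (EuclideanSpace.proj i : EuclideanSpace ℝ (Fin n) →L[ℝ]
      ℝ).smulRight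
    ((EuclideanSpace.proj j : EuclideanSpace ℝ (Fin n) →L[ℝ] ℝ).smulRight (stdVec k))

theorem metricForm_apply (G : EuclideanSpace ℝ (Fin n) → Matrix (Fin n) (Fin n) ℝ)
    (y a b : EuclideanSpace ℝ (Fin n)) :
    metricForm G y a b = ∑ i, ∑ j, G y i j * (a i * b j) := by
  simp [metricForm]

theorem metricForm_stdVec (G : EuclideanSpace ℝ (Fin n) → Matrix (Fin n) (Fin n) ℝ)
    (y : EuclideanSpace ℝ (Fin n)) (i j : Fin n) :
    metricForm G y (stdVec i) (stdVec j) = G y i j := by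
  simp [metricForm_apply, stdVec_apply]

theorem christoffelMap_apply (G : EuclideanSpace ℝ (Fin n) → Matrix (Fin n) (Fin n) ℝ)
    (y a b : EuclideanSpace ℝ (Fin n)) (k : Fin n) :
    christoffelMap G y a b k = ∑ i, ∑ j, christoffel G y k i j * (a i * b j) := by
  simp [christoffelMap, stdVec_apply]

theorem christoffelMap_stdVec (G : EuclideanSpace ℝ (Fin n) → Matrix (Fin n) (Fin n) ℝ)
    (y : EuclideanSpace ℝ (Fin n)) (i j k : Fin n) :
    christoffelMap G y (stdVec i) (stdVec j) k = christoffel G y k i j := by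
  simp [christoffelMap_apply, stdVec_apply]

theorem pderiv_hasDerivAt {φ : EuclideanSpace ℝ (Fin n) → ℝ} {y : EuclideanSpace ℝ (Fin n)}
    (h : DifferentiableAt ℝ φ y) (i : Fin n) :
    HasDerivAt (fun t : ℝ => φ (y + t • stdVec i)) (pderiv i φ y) 0 := by
  have h' : HasFDerivAt φ (fderiv ℝ φ y) (y + (0 : ℝ) • stdVec i) := by
    simpa using h.hasFDerivAt
  exact h'.comp_hasDerivAt (0 : ℝ) (hasDerivAt_line y (stdVec i) 0)

theorem contDiffAt_pderiv {φ : EuclideanSpace ℝ (Fin n) → ℝ} {y : EuclideanSpace ℝ (Fin n)}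
    (h : ContDiffAt ℝ ∞ φ y) (i : Fin n) :
    ContDiffAt ℝ ∞ (fun z => pderiv i φ z) y :=
  (h.fderiv_right (m := ∞) (by norm_cast)).clm_apply contDiffAt_const

/-- A smooth frame `e`, orthonormal for the symmetric matrices `G`, on an open set of `ℝⁿ`. -/
structure IsCoordFrame (G : EuclideanSpace ℝ (Fin n) → Matrix (Fin n) (Fin n) ℝ)
    (e : Fin n → EuclideanSpace ℝ (Fin n) → EuclideanSpace ℝ (Fin n))
    (Ω : Set (EuclideanSpace ℝ (Fin n))) :
    Prop where
  isOpen : IsOpen Ω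
  symm : ∀ y ∈ Ω, ∀ i j, G y i j = G y j i
  smooth : ∀ i, ∀ y ∈ Ω, ContDiffAt ℝ ∞ (e i) y
  orthonormal : ∀ y ∈ Ω, ∀ i j, ∑ k, ∑ l, G y k l * (e i y k * e j y l) = if i = j then 1 else 0

namespace IsCoordFrame

variable {G : EuclideanSpace ℝ (Fin n) → Matrix (Fin n) (Fin n) ℝ}
    {e : Fin n → EuclideanSpace ℝ (Fin n) → EuclideanSpace ℝ (Fin n)}
    {Ω : Set (EuclideanSpace ℝ (Fin n))}
  (h : IsCoordFrame G e Ω)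
include h

/-- The matrix with columns `e_i`. -/
theorem frame_mul_transpose_mul {y : EuclideanSpace ℝ (Fin n)} (hy : y ∈ Ω) :
    (Matrix.of fun k i => e i y k) * (Matrix.of fun k i => e i y k).transpose * G y = 1 := by
  rw [Matrix.mul_assoc]
  refine mul_eq_one_comm.1 ?_
  ext i j
  have := h.orthonormal y hy i j
  simp only [Matrix.mul_apply, Matrix.transpose_apply, Matrix.of_apply, Matrix.one_apply,
    Finset.sum_mul]
  rw [← this, Finset.sum_comm]
  exact Finset.sum_congr rfl fun k _ => Finset.sum_congr rfl fun l _ => by ring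

theorem inv_apply {y : EuclideanSpace ℝ (Fin n)} (hy : y ∈ Ω) (k l : Fin n) : (G y)⁻¹ k l = ∑ p, e
    p y k * e p y l := by
  rw [Matrix.inv_eq_left_inv (h.frame_mul_transpose_mul hy)]
  simp [Matrix.mul_apply]

theorem det_ne_zero {y : EuclideanSpace ℝ (Fin n)} (hy : y ∈ Ω) : (G y).det ≠ 0 := by
  have := congrArg Matrix.det (h.frame_mul_transpose_mul hy)
  rw [Matrix.det_mul, Matrix.det_one] at this
  exact right_ne_zero_of_mul_eq_one this

theorem contDiffAt_frame_apply {y : EuclideanSpace ℝ (Fin n)} (hy : y ∈ Ω) (p k : Fin n) :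
    ContDiffAt ℝ ∞ (fun z => e p z k) y :=
  (EuclideanSpace.proj (𝕜 := ℝ) k).contDiff.contDiffAt.comp y (h.smooth p y hy)

theorem contDiffAt_inv {y : EuclideanSpace ℝ (Fin n)} (hy : y ∈ Ω) (k l : Fin n) :
    ContDiffAt ℝ ∞ (fun z => (G z)⁻¹ k l) y := by
  refine ContDiffAt.congr_of_eventuallyEq (f := fun z => ∑ p, e p z k * e p z l) ?_ ?_
  · exact ContDiffAt.sum fun p _ =>
      (h.contDiffAt_frame_apply hy p k).mul (h.contDiffAt_frame_apply hy p l)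
  · filter_upwards [h.isOpen.mem_nhds hy] with z hz using h.inv_apply hz k l

/-- G⁻¹ = Σ e_p e_pᵀ is smooth because the frame is, and G is recovered as its inverse. -/
theorem contDiffAt_metric {y : EuclideanSpace ℝ (Fin n)} (hy : y ∈ Ω) (k l : Fin n) :
    ContDiffAt ℝ ∞ (fun z => G z k l) y := by
  refine (contDiffAt_matrix_inv (h.contDiffAt_inv hy) ?_ k l).congr_of_eventuallyEq ?_
  · rw [Matrix.det_nonsing_inv, Ring.inverse_eq_inv']
    exact inv_ne_zero (h.det_ne_zero hy)
  · filter_upwards [h.isOpen.mem_nhds hy] with z hz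
    rw [Matrix.nonsing_inv_nonsing_inv _ (h.det_ne_zero hz).isUnit]

theorem contDiffAt_christoffel {y : EuclideanSpace ℝ (Fin n)} (hy : y ∈ Ω) (k i j : Fin n) :
    ContDiffAt ℝ ∞ (fun z => christoffel G z k i j) y := by
  unfold christoffel
  exact contDiffAt_const.mul (ContDiffAt.sum fun l _ => (h.contDiffAt_inv hy k l).mul
    (((contDiffAt_pderiv (h.contDiffAt_metric hy j l) i).add
      (contDiffAt_pderiv (h.contDiffAt_metric hy i l) j)).sub
      (contDiffAt_pderiv (h.contDiffAt_metric hy i j) l)))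

theorem contDiffAt_metricForm {y : EuclideanSpace ℝ (Fin n)} (hy : y ∈ Ω) : ContDiffAt ℝ ∞
    (metricForm G) y := by
  unfold metricForm
  exact ContDiffAt.sum fun i _ => ContDiffAt.sum fun j _ =>
    (h.contDiffAt_metric hy i j).smul contDiffAt_const

theorem contDiffAt_christoffelMap {y : EuclideanSpace ℝ (Fin n)} (hy : y ∈ Ω) :
    ContDiffAt ℝ ∞ (christoffelMap G) y := by
  unfold christoffelMap
  exact ContDiffAt.sum fun i _ => ContDiffAt.sum fun j _ => ContDiffAt.sum fun k _ =>
    (h.contDiffAt_christoffel hy k i j).smul contDiffAt_const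

theorem christoffel_symm {y : EuclideanSpace ℝ (Fin n)} (hy : y ∈ Ω) (k i j : Fin n) :
    christoffel G y k i j = christoffel G y k j i := by
  unfold christoffel
  have : ∀ l, pderiv l (fun z => G z i j) y = pderiv l (fun z => G z j i) y := fun l => by
    unfold pderiv
    rw [Filter.EventuallyEq.fderiv_eq (𝕜 := ℝ) (f₁ := fun z => G z i j) (f := fun z => G z j i)]
    filter_upwards [h.isOpen.mem_nhds hy] with z hz using h.symm z hz i j
  simp only [this]
  congr 1
  exact Finset.sum_congr rfl fun l _ => by ring

theorem pderiv_metric {y : EuclideanSpace ℝ (Fin n)} (hy : y ∈ Ω) (m i j : Fin n) : pderiv m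
    (fun z => G z i j) y
    = ∑ l, (christoffel G y l m i * G y l j + christoffel G y l m j * G y i l) := by
  have hs : ∀ a b l, pderiv l (fun z => G z a b) y = pderiv l (fun z => G z b a) y :=
    fun a b l => by
      unfold pderiv
      rw [Filter.EventuallyEq.fderiv_eq (𝕜 := ℝ) (f₁ := fun z => G z a b) (f := fun z => G z b a)]
      filter_upwards [h.isOpen.mem_nhds hy] with z hz using h.symm z hz a b
  -- Lowering the index of the Christoffel symbol; adding two such expressions leaves one derivative
  -- of the metric.
  have key : ∀ a b c, ∑ l, christoffel G y l a b * G y l c = 1 / 2 * (pderiv a (fun z => G z b c) y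
      + pderiv b (fun z => G z a c) y - pderiv c (fun z => G z a b) y) := by
    intro a b c
    have hinv : ∀ q, ∑ l, (G y)⁻¹ l q * G y l c = if q = c then 1 else 0 := fun q => by
      have h1 := congrFun (congrFun (Matrix.nonsing_inv_mul (G y) (h.det_ne_zero hy).isUnit) q) c
      rw [Matrix.mul_apply, Matrix.one_apply] at h1
      rw [← h1]
      refine Finset.sum_congr rfl fun l _ => ?_
      rw [h.inv_apply hy, h.inv_apply hy]
      simp only [mul_comm]
    simp only [christoffel, mul_assoc, Finset.sum_mul, ← Finset.mul_sum]
    congr 1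
    rw [Finset.sum_comm]
    have : ∀ q, ∑ l, (G y)⁻¹ l q * ((pderiv a (fun z => G z b q) y
        + pderiv b (fun z => G z a q) y - pderiv q (fun z => G z a b) y) * G y l c)
        = (pderiv a (fun z => G z b q) y + pderiv b (fun z => G z a q) y
          - pderiv q (fun z => G z a b) y) * if q = c then 1 else 0 := fun q => by
      rw [← hinv, Finset.mul_sum]
      exact Finset.sum_congr rfl fun l _ => by ring
    simp only [this, mul_ite, mul_one, mul_zero, Finset.sum_ite_eq', Finset.mem_univ, if_true]
  have h2 : ∀ l, christoffel G y l m j * G y i l = christoffel G y l m j * G y l i := fun l => by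
    rw [h.symm y hy i l]
  simp only [h2, Finset.sum_add_distrib, key]
  rw [hs j i m]
  ring

theorem isLeviCivita : IsLeviCivita (metricForm G) (christoffelMap G) Ω where
  isOpen := h.isOpen
  smooth_metric _ hy := h.contDiffAt_metricForm hy
  smooth _ hy := h.contDiffAt_christoffelMap hy
  symm y hy a b := by
    rw [metricForm_apply, metricForm_apply, Finset.sum_comm]
    exact Finset.sum_congr rfl fun i _ => Finset.sum_congr rfl fun j _ => by
      rw [h.symm y hy]; ring
  torsion_free y hy a b := by
    ext k
    rw [christoffelMap_apply, christoffelMap_apply, Finset.sum_comm]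
    exact Finset.sum_congr rfl fun i _ => Finset.sum_congr rfl fun j _ => by
      rw [h.christoffel_symm hy]; ring
  compat y hy v a b := by
    have hbasis : ∀ m i j : Fin n, fderiv ℝ (metricForm G) y (stdVec m) (stdVec i) (stdVec j)
        = metricForm G y (christoffelMap G y (stdVec m) (stdVec i)) (stdVec j)
          + metricForm G y (stdVec i) (christoffelMap G y (stdVec m) (stdVec j)) := by
      intro m i j
      have hf : HasFDerivAt (metricForm G) (fderiv ℝ (metricForm G) y)
          (y + (0 : ℝ) • stdVec m) := by
        simpa using ((h.contDiffAt_metricForm hy).differentiableAt (by norm_num)).hasFDerivAt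
      have h1 := ((hf.comp_hasDerivAt (0 : ℝ) (hasDerivAt_line y (stdVec m) 0)).clm_apply
        (hasDerivAt_const (0 : ℝ) (stdVec i))).clm_apply (hasDerivAt_const (0 : ℝ) (stdVec j))
      have h2 := pderiv_hasDerivAt
        ((h.contDiffAt_metric hy i j).differentiableAt (by norm_num)) m
      have h3 := h1.unique (h2.congr_of_eventuallyEq (Eventually.of_forall fun t => by
        simp only [Function.comp, metricForm_stdVec]))
      simp only [map_zero, add_zero, Function.comp] at h3
      rw [h3, h.pderiv_metric hy, metricForm_apply, metricForm_apply, Finset.sum_add_distrib]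
      simp [christoffelMap_stdVec, stdVec_apply, mul_comm]
    refine eq_of_forall_stdVec (f := fun v => fderiv ℝ (metricForm G) y v a b) (f' := fun v =>
      metricForm G y (christoffelMap G y v a) b + metricForm G y a (christoffelMap G y v b))
      ⟨fun _ _ => by simp, fun _ _ => by simp⟩
      ⟨fun _ _ => by simp; ring, fun _ _ => by simp; ring⟩ (fun m => ?_) v
    refine eq_of_forall_stdVec (f := fun a => fderiv ℝ (metricForm G) y (stdVec m) a b)
      (f' := fun a => metricForm G y (christoffelMap G y (stdVec m) a) b
        + metricForm G y a (christoffelMap G y (stdVec m) b))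
      ⟨fun _ _ => by simp, fun _ _ => by simp⟩
      ⟨fun _ _ => by simp; ring, fun _ _ => by simp; ring⟩ (fun i => ?_) a
    exact eq_of_forall_stdVec (f := fun b => fderiv ℝ (metricForm G) y (stdVec m) (stdVec i) b)
      (f' := fun b => metricForm G y (christoffelMap G y (stdVec m) (stdVec i)) b
        + metricForm G y (stdVec i) (christoffelMap G y (stdVec m) b))
      ⟨fun _ _ => by simp, fun _ _ => by simp⟩
      ⟨fun _ _ => by simp; ring, fun _ _ => by simp; ring⟩ (fun j => hbasis m i j) b

theorem isOrthonormalFrame : IsOrthonormalFrame (metricForm G) e Ω where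
  differentiableAt i y hy := (h.smooth i y hy).differentiableAt (by norm_num)
  orthonormal y hy i j := by rw [metricForm_apply, h.orthonormal y hy]
  span y hy a := by
    ext k
    have h1 := congrFun (congrArg (fun M => M.mulVec (fun l => a l))
      (h.frame_mul_transpose_mul hy)) k
    simp only [Matrix.one_mulVec] at h1
    rw [← h1]
    simp only [Matrix.mulVec, dotProduct, Matrix.mul_apply, Matrix.transpose_apply,
      Matrix.of_apply, Finset.sum_mul, metricForm_apply, WithLp.ofLp_sum, Finset.sum_apply,
      WithLp.ofLp_smul, Pi.smul_apply, smul_eq_mul]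
    rw [Finset.sum_congr rfl fun l _ => Finset.sum_comm, Finset.sum_comm]
    refine Finset.sum_congr rfl fun p _ => Finset.sum_congr rfl fun l _ =>
      Finset.sum_congr rfl fun m _ => ?_
    rw [h.symm y hy]; ring

end IsCoordFrame

end CoordinateFrames

/-! ### The Weyl tensor and its covariant derivative as multilinear forms. -/

section WeylForm

open Filter Topology

variable {E : Type*} [NormedAddCommGroup E] [NormedSpace ℝ E]
  (g : E → E →L[ℝ] E →L[ℝ] ℝ) (A : E → E →L[ℝ] E →L[ℝ] E)
  {ι : Type*} [Fintype ι] (e : ι → E → E)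

section Linearity

variable (y v v' a b c d : E) (r : ℝ)

theorem curvCov_add₂ : curvCov A y a b (v + v') c
    = curvCov A y a b v c + curvCov A y a b v' c := by
  simp only [curvCov, map_add, add_apply, curv_add₂]
  abel

theorem curvCov_smul₂ : curvCov A y a b (r • v) c = r • curvCov A y a b v c := by
  simp only [curvCov, map_smul, smul_apply, curv_smul₂, smul_sub, smul_add]

theorem curvCov_add₃ : curvCov A y a b c (v + v')
    = curvCov A y a b c v + curvCov A y a b c v' := by
  simp only [curvCov, map_add, curv_add₃]
  abel

theorem curvCov_smul₃ : curvCov A y a b c (r • v) = r • curvCov A y a b c v := by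
  simp only [curvCov, map_smul, curv_smul₃, smul_sub, smul_add]

theorem curv4Cov_add₂ : curv4Cov g A y a b (v + v') c d
    = curv4Cov g A y a b v c d + curv4Cov g A y a b v' c d := by
  simp only [curv4Cov, curvCov_add₂, map_add, add_apply]

theorem curv4Cov_smul₂ : curv4Cov g A y a b (r • v) c d = r * curv4Cov g A y a b v c d := by
  simp only [curv4Cov, curvCov_smul₂, map_smul, smul_apply, smul_eq_mul]

theorem curv4Cov_add₃ : curv4Cov g A y a b c (v + v') d
    = curv4Cov g A y a b c v d + curv4Cov g A y a b c v' d := by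
  simp only [curv4Cov, curvCov_add₃, map_add, add_apply]

theorem curv4Cov_smul₃ : curv4Cov g A y a b c (r • v) d = r * curv4Cov g A y a b c v d := by
  simp only [curv4Cov, curvCov_smul₃, map_smul, smul_apply, smul_eq_mul]

theorem curv4Cov_add₄ : curv4Cov g A y a b c d (v + v')
    = curv4Cov g A y a b c d v + curv4Cov g A y a b c d v' := by
  simp only [curv4Cov, map_add]

theorem curv4Cov_smul₄ : curv4Cov g A y a b c d (r • v) = r * curv4Cov g A y a b c d v := by
  simp only [curv4Cov, map_smul, smul_eq_mul]

theorem ricCov_add₁ : ricCov g A e y a (v + v') c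
    = ricCov g A e y a v c + ricCov g A e y a v' c := by
  simp only [ricCov, curv4Cov_add₂, Finset.sum_add_distrib]

theorem ricCov_smul₁ : ricCov g A e y a (r • v) c = r * ricCov g A e y a v c := by
  simp only [ricCov, curv4Cov_smul₂, Finset.mul_sum]

theorem ricCov_add₂ : ricCov g A e y a c (v + v')
    = ricCov g A e y a c v + ricCov g A e y a c v' := by
  simp only [ricCov, curv4Cov_add₃, Finset.sum_add_distrib]

theorem ricCov_smul₂ : ricCov g A e y a c (r • v) = r * ricCov g A e y a c v := by
  simp only [ricCov, curv4Cov_smul₃, Finset.mul_sum]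

end Linearity

/-- The Weyl tensor, evaluated at four vectors. -/
def weylForm (y a b c d : E) : ℝ :=
  curv4 g A y a b c d
    - 1 / ((Fintype.card ι : ℝ) - 2) * (ric g A e y b c * g y a d + ric g A e y a d * g y b c
      - ric g A e y a c * g y b d - ric g A e y b d * g y a c)
    + scal g A e y / (((Fintype.card ι : ℝ) - 1) * ((Fintype.card ι : ℝ) - 2))
      * (g y b c * g y a d - g y a c * g y b d)

/-- The covariant derivative `(∇_v W)(a,b,c,d)` of the Weyl tensor. -/
def weylCov (y v a b c d : E) : ℝ :=
  curv4Cov g A y v a b c d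
    - 1 / ((Fintype.card ι : ℝ) - 2) * (ricCov g A e y v b c * g y a d
      + ricCov g A e y v a d * g y b c - ricCov g A e y v a c * g y b d
      - ricCov g A e y v b d * g y a c)
    + scalCov g A e y v / (((Fintype.card ι : ℝ) - 1) * ((Fintype.card ι : ℝ) - 2))
      * (g y b c * g y a d - g y a c * g y b d)

section Linearity

variable (y a b c d : E)

theorem weylForm_linear₁ : IsLinearMap ℝ fun a => weylForm g A e y a b c d :=
  ⟨fun _ _ => by simp only [weylForm, curv4_add₁, ric_add₁, map_add, add_apply]; ring,
    fun _ _ => by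
      simp only [weylForm, curv4_smul₁, ric_smul₁, map_smul, smul_apply, smul_eq_mul]; ring⟩

theorem weylForm_linear₂ : IsLinearMap ℝ fun b => weylForm g A e y a b c d :=
  ⟨fun _ _ => by simp only [weylForm, curv4_add₂, ric_add₁, map_add, add_apply]; ring,
    fun _ _ => by
      simp only [weylForm, curv4_smul₂, ric_smul₁, map_smul, smul_apply, smul_eq_mul]; ring⟩

theorem weylForm_linear₃ : IsLinearMap ℝ fun c => weylForm g A e y a b c d :=
  ⟨fun _ _ => by simp only [weylForm, curv4_add₃, ric_add₂, map_add]; ring,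
    fun _ _ => by
      simp only [weylForm, curv4_smul₃, ric_smul₂, map_smul, smul_eq_mul]; ring⟩

theorem weylForm_linear₄ : IsLinearMap ℝ fun d => weylForm g A e y a b c d :=
  ⟨fun _ _ => by simp only [weylForm, curv4_add₄, ric_add₂, map_add]; ring,
    fun _ _ => by
      simp only [weylForm, curv4_smul₄, ric_smul₂, map_smul, smul_eq_mul]; ring⟩

variable (v : E)

theorem weylCov_linear : IsLinearMap ℝ fun v => weylCov g A e y v a b c d :=
  ⟨fun _ _ => by simp only [weylCov, curv4Cov_add, ricCov_add, scalCov_add]; ring,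
    fun _ _ => by
      simp only [weylCov, curv4Cov_smul, ricCov_smul, scalCov_smul, smul_eq_mul]; ring⟩

theorem weylCov_linear₁ : IsLinearMap ℝ fun a => weylCov g A e y v a b c d :=
  ⟨fun _ _ => by simp only [weylCov, curv4Cov_add₁, ricCov_add₁, map_add, add_apply]; ring,
    fun _ _ => by
      simp only [weylCov, curv4Cov_smul₁, ricCov_smul₁, map_smul, smul_apply, smul_eq_mul]; ring⟩

theorem weylCov_linear₂ : IsLinearMap ℝ fun b => weylCov g A e y v a b c d :=
  ⟨fun _ _ => by simp only [weylCov, curv4Cov_add₂, ricCov_add₁, map_add, add_apply]; ring,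
    fun _ _ => by
      simp only [weylCov, curv4Cov_smul₂, ricCov_smul₁, map_smul, smul_apply, smul_eq_mul]; ring⟩

theorem weylCov_linear₃ : IsLinearMap ℝ fun c => weylCov g A e y v a b c d :=
  ⟨fun _ _ => by simp only [weylCov, curv4Cov_add₃, ricCov_add₂, map_add]; ring,
    fun _ _ => by
      simp only [weylCov, curv4Cov_smul₃, ricCov_smul₂, map_smul, smul_eq_mul]; ring⟩

theorem weylCov_linear₄ : IsLinearMap ℝ fun d => weylCov g A e y v a b c d :=
  ⟨fun _ _ => by simp only [weylCov, curv4Cov_add₄, ricCov_add₂, map_add]; ring,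
    fun _ _ => by
      simp only [weylCov, curv4Cov_smul₄, ricCov_smul₂, map_smul, smul_eq_mul]; ring⟩

end Linearity

variable [DecidableEq ι] {g A e} {Ω : Set E} {γ X Y Z W : ℝ → E} {v DX DY DZ DW : E} {t : ℝ}

/-- The Leibniz rule shows that `weylCov` is the covariant derivative of `weylForm`: the metric is
parallel and contractions commute with ∇. -/
theorem weylForm_hasDerivAt (h : IsLeviCivita g A Ω) (he : IsOrthonormalFrame g e Ω)
    (ht : γ t ∈ Ω) (hγ : HasDerivAt γ v t)
    (hX : HasCovDerivAt A γ v X DX t) (hY : HasCovDerivAt A γ v Y DY t)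
    (hZ : HasCovDerivAt A γ v Z DZ t) (hW : HasCovDerivAt A γ v W DW t) :
    HasDerivAt (fun t => weylForm g A e (γ t) (X t) (Y t) (Z t) (W t))
      (weylCov g A e (γ t) v (X t) (Y t) (Z t) (W t) + weylForm g A e (γ t) DX (Y t) (Z t) (W t)
        + weylForm g A e (γ t) (X t) DY (Z t) (W t) + weylForm g A e (γ t) (X t) (Y t) DZ (W t)
        + weylForm g A e (γ t) (X t) (Y t) (Z t) DW) t := by
  have hr := fun {X Y DX DY} => ric_hasDerivAt h he ht hγ (X := X) (Y := Y) (DX := DX) (DY := DY)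
  have hg := fun {X Y DX DY} => h.metric_hasDerivAt ht hγ (X := X) (Y := Y) (DX := DX) (DY := DY)
  refine (((h.curv4_hasDerivAt ht hγ hX hY hZ hW).sub
    ((((((hr hY hZ).mul (hg hX hW)).add ((hr hX hW).mul (hg hY hZ))).sub
      ((hr hX hZ).mul (hg hY hW))).sub ((hr hY hW).mul (hg hX hZ))).const_mul
      (1 / ((Fintype.card ι : ℝ) - 2)))).add
    (((scal_hasDerivAt h he ht hγ).div_const
      (((Fintype.card ι : ℝ) - 1) * ((Fintype.card ι : ℝ) - 2))).mul
      (((hg hY hZ).mul (hg hX hW)).sub ((hg hX hZ).mul (hg hY hW))))).congr_deriv ?_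
  simp only [weylForm, weylCov, Pi.mul_apply, Pi.sub_apply]
  ring

end WeylForm

/-! ### Agreement of coordinate components with frame contractions. -/

namespace IsCoordFrame

open Filter Topology

variable {n : ℕ} {G : EuclideanSpace ℝ (Fin n) → Matrix (Fin n) (Fin n) ℝ}
  {e : Fin n → EuclideanSpace ℝ (Fin n) → EuclideanSpace ℝ (Fin n)}
  {Ω : Set (EuclideanSpace ℝ (Fin n))} (h : IsCoordFrame G e Ω) {y : EuclideanSpace ℝ (Fin n)}
  (hy : y ∈ Ω)
include h hy

theorem curv_stdVec (i j k l : Fin n) :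
    curv (christoffelMap G) y (stdVec i) (stdVec j) (stdVec k) l = riemannUp G y i j k l := by
  have hd : ∀ i j k, fderiv ℝ (christoffelMap G) y (stdVec i) (stdVec j) (stdVec k) l
      = pderiv i (fun z => christoffel G z l j k) y := by
    intro i j k
    have h1 := h.isLeviCivita.connection_hasDerivAt (γ := fun t : ℝ => y + t • stdVec i) (t := 0)
      (by simpa using hy) (hasDerivAt_line y (stdVec i) 0) (hasDerivAt_const (0 : ℝ) (stdVec j))
      (hasDerivAt_const (0 : ℝ) (stdVec k))
    have h2 := (EuclideanSpace.proj (𝕜 := ℝ) l).hasFDerivAt.comp_hasDerivAt (0 : ℝ) h1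
    have h3 := pderiv_hasDerivAt
      ((h.contDiffAt_christoffel hy l j k).differentiableAt (by norm_num)) i
    have h4 := h2.unique (h3.congr_of_eventuallyEq (Eventually.of_forall fun t => by
      simp [christoffelMap_stdVec]))
    simpa using h4
  have hA : ∀ i j k, christoffelMap G y (stdVec i) (christoffelMap G y (stdVec j) (stdVec k)) l
      = ∑ m, christoffel G y l i m * christoffel G y m j k := by
    intro i j k
    rw [christoffelMap_apply]
    simp [christoffelMap_stdVec, stdVec_apply]
  rw [curv, riemannUp, Finset.sum_sub_distrib, ← hA, ← hA, ← hd, ← hd]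
  simp only [PiLp.add_apply, PiLp.sub_apply]
  ring

theorem curv4_stdVec (i j k l : Fin n) : curv4 (metricForm G) (christoffelMap G) y
    (stdVec i) (stdVec j) (stdVec k) (stdVec l) = riemann G y i j k l := by
  rw [curv4, metricForm_apply, riemann]
  simp only [h.curv_stdVec hy, stdVec_apply, mul_ite, mul_one, mul_zero, Finset.sum_ite_eq',
    Finset.mem_univ, if_true]
  exact Finset.sum_congr rfl fun m _ => mul_comm _ _

/-- The trace of a linear map in coordinates and in the frame. -/
theorem sum_apply_stdVec
    (T : EuclideanSpace ℝ (Fin n) →ₗ[ℝ] EuclideanSpace ℝ (Fin n)) :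
    ∑ i, T (stdVec i) i = ∑ p, metricForm G y (T (e p y)) (e p y) := by
  have h1 : ∀ p, metricForm G y (T (e p y)) (e p y)
      = ∑ i, e p y i * metricForm G y (T (stdVec i)) (e p y) := fun p =>
    IsLinearMap.apply_eq_sum (f := fun a => metricForm G y (T a) (e p y))
      ⟨fun _ _ => by simp, fun _ _ => by simp⟩ (e p y)
  have h2 : ∀ i, T (stdVec i) i = ∑ p, e p y i * metricForm G y (T (stdVec i)) (e p y) :=
    fun i => by
      conv_lhs => rw [h.isOrthonormalFrame.span y hy (T (stdVec i))]
      simp [mul_comm]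
  rw [Finset.sum_congr rfl fun p _ => h1 p, Finset.sum_congr rfl fun p _ => h2 p,
    Finset.sum_comm]

/-- Since G⁻¹ = Σ e_p e_pᵀ, contraction with the inverse metric is the trace over the frame. -/
theorem sum_inv_mul (β : EuclideanSpace ℝ (Fin n) → EuclideanSpace ℝ (Fin n) → ℝ)
    (h₁ : ∀ b, IsLinearMap ℝ fun a => β a b) (h₂ : ∀ a, IsLinearMap ℝ (β a)) :
    ∑ j, ∑ k, (G y)⁻¹ j k * β (stdVec j) (stdVec k) = ∑ p, β (e p y) (e p y) := by
  have h3 : ∀ p, β (e p y) (e p y)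
      = ∑ j, ∑ k, e p y j * e p y k * β (stdVec j) (stdVec k) := fun p => by
    rw [IsLinearMap.apply_eq_sum (h₁ _)]
    refine Finset.sum_congr rfl fun j _ => ?_
    rw [IsLinearMap.apply_eq_sum (h₂ _), Finset.mul_sum]
    exact Finset.sum_congr rfl fun k _ => by ring
  simp only [h3, h.inv_apply hy, Finset.sum_mul]
  rw [Finset.sum_comm]
  rw [Finset.sum_congr rfl fun k _ => Finset.sum_comm, Finset.sum_comm]
  refine Finset.sum_congr rfl fun p _ => ?_
  rw [Finset.sum_comm]

theorem ric_stdVec (j k : Fin n) :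
    ric (metricForm G) (christoffelMap G) e y (stdVec j) (stdVec k) = ricciCoord G y j k := by
  have := h.sum_apply_stdVec hy (IsLinearMap.mk' (fun a => curv (christoffelMap G) y a (stdVec j)
    (stdVec k)) ⟨fun _ _ => curv_add₁ .., fun _ _ => curv_smul₁ ..⟩)
  simp only [IsLinearMap.mk'_apply, h.curv_stdVec hy] at this
  rw [ricciCoord, this]
  rfl

theorem scal_eq : scal (metricForm G) (christoffelMap G) e y = scalarCoord G y := by
  have := h.sum_inv_mul hy (ric (metricForm G) (christoffelMap G) e y)
    (fun _ => ⟨fun _ _ => ric_add₁ .., fun _ _ => ric_smul₁ ..⟩)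
    (fun _ => ⟨fun _ _ => ric_add₂ .., fun _ _ => ric_smul₂ ..⟩)
  simp only [h.ric_stdVec hy] at this
  rw [scalarCoord, this]
  rfl

theorem weylForm_stdVec (i j k l : Fin n) : weylForm (metricForm G) (christoffelMap G) e y
    (stdVec i) (stdVec j) (stdVec k) (stdVec l) = weyl G y i j k l := by
  simp only [weylForm, weyl, h.curv4_stdVec hy, h.ric_stdVec hy, h.scal_eq hy, metricForm_stdVec,
    Fintype.card_fin]

theorem contDiffAt_riemannUp (i j k l : Fin n) :
    ContDiffAt ℝ ∞ (fun z => riemannUp G z i j k l) y :=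
  ((contDiffAt_pderiv (h.contDiffAt_christoffel hy l j k) i).sub
    (contDiffAt_pderiv (h.contDiffAt_christoffel hy l i k) j)).add
    (ContDiffAt.sum fun m _ => ((h.contDiffAt_christoffel hy l i m).mul
      (h.contDiffAt_christoffel hy m j k)).sub ((h.contDiffAt_christoffel hy l j m).mul
      (h.contDiffAt_christoffel hy m i k)))

theorem contDiffAt_ricciCoord (j k : Fin n) : ContDiffAt ℝ ∞ (fun z => ricciCoord G z j k) y :=
  ContDiffAt.sum fun i _ => h.contDiffAt_riemannUp hy i j k i

theorem contDiffAt_scalarCoord : ContDiffAt ℝ ∞ (scalarCoord G) y :=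
  ContDiffAt.sum fun j _ => ContDiffAt.sum fun k _ => (h.contDiffAt_inv hy j k).mul
    (h.contDiffAt_ricciCoord hy j k)

theorem contDiffAt_weyl (i j k l : Fin n) : ContDiffAt ℝ ∞ (fun z => weyl G z i j k l) y := by
  have hr := h.contDiffAt_ricciCoord hy
  have hg := h.contDiffAt_metric hy
  have h1 : ContDiffAt ℝ ∞ (fun z => riemann G z i j k l) y :=
    ContDiffAt.sum fun m _ => (h.contDiffAt_riemannUp hy i j k m).mul (hg m l)
  exact (h1.sub (contDiffAt_const.mul (((((hr j k).mul (hg i l)).add ((hr i l).mul (hg j k))).sub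
    ((hr i k).mul (hg j l))).sub ((hr j l).mul (hg i k))))).add
    (((h.contDiffAt_scalarCoord hy).div_const _).mul
      (((hg j k).mul (hg i l)).sub ((hg i k).mul (hg j l))))

/-- A constant field has covariant derivative A(v, a); inserted into the Leibniz rule, these terms
are the Christoffel corrections of `covWeyl`. -/
theorem weylCov_stdVec (m i j k l : Fin n) : weylCov (metricForm G) (christoffelMap G) e y
    (stdVec m) (stdVec i) (stdVec j) (stdVec k) (stdVec l) = covWeyl G y m i j k l := by
  have hc : ∀ a : EuclideanSpace ℝ (Fin n), HasCovDerivAt (christoffelMap G)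
      (fun t : ℝ => y + t • stdVec m) (stdVec m) (fun _ => a)
      (christoffelMap G y (stdVec m) a) 0 := fun a => by
    simpa [HasCovDerivAt] using hasDerivAt_const (0 : ℝ) a
  have h1 := weylForm_hasDerivAt h.isLeviCivita h.isOrthonormalFrame
    (γ := fun t : ℝ => y + t • stdVec m) (t := 0) (by simpa using hy)
    (hasDerivAt_line y (stdVec m) 0) (hc (stdVec i)) (hc (stdVec j)) (hc (stdVec k))
    (hc (stdVec l))
  have h2 := pderiv_hasDerivAt ((h.contDiffAt_weyl hy i j k l).differentiableAt (by norm_num)) m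
  have h3 := h2.unique (h1.congr_of_eventuallyEq (by
    filter_upwards [h.isLeviCivita.eventually_line_mem hy (stdVec m)] with t ht
      using (h.weylForm_stdVec ht i j k l).symm))
  simp only [zero_smul, add_zero] at h3
  rw [IsLinearMap.apply_eq_sum (weylForm_linear₁ _ _ _ y _ _ _) (christoffelMap G y _ _),
    IsLinearMap.apply_eq_sum (weylForm_linear₂ _ _ _ y _ _ _) (christoffelMap G y _ _),
    IsLinearMap.apply_eq_sum (weylForm_linear₃ _ _ _ y _ _ _) (christoffelMap G y _ _),
    IsLinearMap.apply_eq_sum (weylForm_linear₄ _ _ _ y _ _ _) (christoffelMap G y _ _)] at h3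
  simp only [christoffelMap_stdVec, h.weylForm_stdVec hy] at h3
  rw [covWeyl, h3]
  simp only [Finset.sum_add_distrib]
  ring

theorem sum_weylCov (hW : ∀ j k l, divWeyl G y j k l = 0) (b c d : EuclideanSpace ℝ (Fin n)) :
    ∑ p, weylCov (metricForm G) (christoffelMap G) e y (e p y) (e p y) b c d = 0 := by
  have hl : ∀ f : Fin n → EuclideanSpace ℝ (Fin n) → ℝ, (∀ p, IsLinearMap ℝ (f p)) →
      IsLinearMap ℝ fun a => ∑ p, f p a := fun f hf =>
    ⟨fun a b => by simp only [(hf _).map_add, Finset.sum_add_distrib],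
      fun r a => by simp only [(hf _).map_smul, Finset.smul_sum]⟩
  have h0 : IsLinearMap ℝ fun _ : EuclideanSpace ℝ (Fin n) => (0 : ℝ) :=
    ⟨fun _ _ => by simp, fun _ _ => by simp⟩
  refine eq_of_forall_stdVec (hl _ fun p => weylCov_linear₂ _ _ _ y _ _ _ _) h0 (fun j => ?_) b
  refine eq_of_forall_stdVec (hl _ fun p => weylCov_linear₃ _ _ _ y _ _ _ _) h0 (fun k => ?_) c
  refine eq_of_forall_stdVec (hl _ fun p => weylCov_linear₄ _ _ _ y _ _ _ _) h0 (fun l => ?_) d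
  rw [← hW j k l, divWeyl]
  rw [← h.sum_inv_mul hy (fun a b => weylCov (metricForm G) (christoffelMap G) e y a b
    (stdVec j) (stdVec k) (stdVec l)) (fun _ => weylCov_linear _ _ _ _ _ _ _ _)
    (fun _ => weylCov_linear₁ _ _ _ _ _ _ _ _)]
  simp only [h.weylCov_stdVec hy]

omit h hy in
theorem hess_stdVec {u : EuclideanSpace ℝ (Fin n) → ℝ} (hu : ContDiffAt ℝ ∞ u y) (i j : Fin n) :
    hess (christoffelMap G) u y (stdVec i) (stdVec j) = hessCoord G u y i j := by
  have hd : DifferentiableAt ℝ (fderiv ℝ u) y :=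
    (hu.fderiv_right (m := 1) (by norm_cast)).differentiableAt (by norm_num)
  have h1 : pderiv i (pderiv j u) y = fderiv ℝ (fderiv ℝ u) y (stdVec i) (stdVec j) := by
    have : HasFDerivAt (pderiv j u) ((fderiv ℝ (fderiv ℝ u) y).flip (stdVec j)) y :=
      (hd.hasFDerivAt.clm_apply (hasFDerivAt_const (stdVec j) y)).congr_fderiv (by ext; simp)
    rw [pderiv, this.fderiv]
    rfl
  rw [hess, hessCoord, h1, IsLinearMap.apply_eq_sum (f := fderiv ℝ u y)
    ⟨fun _ _ => by simp, fun _ _ => by simp⟩ (christoffelMap G y _ _)]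
  simp only [christoffelMap_stdVec]
  rfl

theorem ric_apply (a b : EuclideanSpace ℝ (Fin n)) : ric (metricForm G) (christoffelMap G) e y a b
    = ∑ i, ∑ j, ricciCoord G y i j * a i * b j := by
  rw [IsLinearMap.apply_eq_sum (f := fun a => ric (metricForm G) (christoffelMap G) e y a b)
    ⟨fun _ _ => ric_add₁ .., fun _ _ => ric_smul₁ ..⟩]
  refine Finset.sum_congr rfl fun i _ => ?_
  rw [IsLinearMap.apply_eq_sum (f := ric (metricForm G) (christoffelMap G) e y (stdVec i))
    ⟨fun _ _ => ric_add₂ .., fun _ _ => ric_smul₂ ..⟩, Finset.mul_sum]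
  refine Finset.sum_congr rfl fun j _ => ?_
  rw [h.ric_stdVec hy]
  ring

theorem hess_eq {u : EuclideanSpace ℝ (Fin n) → ℝ} (hu : ContDiffAt ℝ ∞ u y) {lam : ℝ}
    (hs : ∀ i j, hessCoord G u y i j = -ricciCoord G y i j + lam * G y i j)
    (a b : EuclideanSpace ℝ (Fin n)) : hess (christoffelMap G) u y a b
    = -ric (metricForm G) (christoffelMap G) e y a b + lam * metricForm G y a b := by
  refine eq_of_forall_stdVec (f := fun a => hess (christoffelMap G) u y a b) (f' := fun a =>
    -ric (metricForm G) (christoffelMap G) e y a b + lam * metricForm G y a b)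
    ⟨fun _ _ => by simp [hess]; ring, fun _ _ => by simp [hess]; ring⟩
    ⟨fun _ _ => by simp [ric_add₁]; ring, fun _ _ => by simp [ric_smul₁]; ring⟩ (fun i => ?_) a
  refine eq_of_forall_stdVec (f := hess (christoffelMap G) u y (stdVec i)) (f' := fun b =>
    -ric (metricForm G) (christoffelMap G) e y (stdVec i) b + lam * metricForm G y (stdVec i) b)
    ⟨fun _ _ => by simp [hess]; ring, fun _ _ => by simp [hess]; ring⟩
    ⟨fun _ _ => by simp [ric_add₂]; ring, fun _ _ => by simp [ric_smul₂]; ring⟩ (fun j => ?_) b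
  simp only [hess_stdVec hu, h.ric_stdVec hy, metricForm_stdVec, hs]

end IsCoordFrame

/-! ### Passage from the manifold to a chart. -/

section Charts

open Filter Topology

variable {n : ℕ} {M : Type*} [TopologicalSpace M] [ChartedSpace (EuclideanSpace ℝ (Fin n)) M]

theorem vecCoord_mfderiv_symm {φ : OpenPartialHomeomorph M (EuclideanSpace ℝ (Fin n))}
    (hφ : φ.MDifferentiable (𝓡 n) (𝓡 n)) {y : EuclideanSpace ℝ (Fin n)} (hy : y ∈ φ.target)
    (b : EuclideanSpace ℝ (Fin n)) :
    vecCoord φ (φ.symm y) (mfderiv (𝓡 n) (𝓡 n) φ.symm y b) = b :=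
  congrArg (fun L : EuclideanSpace ℝ (Fin n) →L[ℝ] EuclideanSpace ℝ (Fin n) => L b)
    (hφ.comp_symm_deriv hy)

theorem mfderiv_symm_vecCoord {φ : OpenPartialHomeomorph M (EuclideanSpace ℝ (Fin n))}
    (hφ : φ.MDifferentiable (𝓡 n) (𝓡 n)) {y : EuclideanSpace ℝ (Fin n)} (hy : y ∈ φ.target)
    (v : TangentSpace (𝓡 n) (φ.symm y)) :
    mfderiv (𝓡 n) (𝓡 n) φ.symm y (vecCoord φ (φ.symm y) v) = v :=
  hφ.mfderiv_injective (φ.map_target hy) (vecCoord_mfderiv_symm hφ hy _)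

theorem mfderiv_symm_eq_sum {φ : OpenPartialHomeomorph M (EuclideanSpace ℝ (Fin n))}
    (y b : EuclideanSpace ℝ (Fin n)) :
    mfderiv (𝓡 n) (𝓡 n) φ.symm y b = ∑ i, b i • coordField φ y i := by
  let L : EuclideanSpace ℝ (Fin n) →ₗ[ℝ] TangentSpace (𝓡 n) (φ.symm y) :=
    (mfderiv (𝓡 n) (𝓡 n) φ.symm y).toLinearMap
  have h1 : L b = ∑ i, b i • L (stdVec i) := by
    conv_lhs => rw [eq_sum_stdVec b]
    rw [map_sum]
    exact Finset.sum_congr rfl fun i _ => map_smul _ _ _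
  exact h1

theorem vecCoord_smul (φ : OpenPartialHomeomorph M (EuclideanSpace ℝ (Fin n))) (x : M) (r : ℝ)
    (v : TangentSpace (𝓡 n) x) : vecCoord φ x (r • v) = r • vecCoord φ x v :=
  map_smul (mfderiv (𝓡 n) (𝓡 n) φ x) r v

theorem hasDerivAt_chart_comp {φ : OpenPartialHomeomorph M (EuclideanSpace ℝ (Fin n))}
    (hφ : φ.MDifferentiable (𝓡 n) (𝓡 n)) {γ : ℝ → M} {t : ℝ} {v : TangentSpace (𝓡 n) (γ t)}
    (ht : γ t ∈ φ.source)
    (hγ : HasMFDerivAt 𝓘(ℝ, ℝ) (𝓡 n) γ t ((1 : ℝ →L[ℝ] ℝ).smulRight v)) :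
    HasDerivAt (fun s => φ (γ s)) (vecCoord φ (γ t) v) t := by
  let D : ℝ →L[ℝ] EuclideanSpace ℝ (Fin n) :=
    (mfderiv (𝓡 n) (𝓡 n) φ (γ t)).comp ((1 : ℝ →L[ℝ] ℝ).smulRight v)
  have h1 : HasMFDerivAt 𝓘(ℝ, ℝ) (𝓡 n) (fun s => φ (γ s)) t D :=
    (hφ.mdifferentiableAt ht).hasMFDerivAt.comp t hγ
  have h2 : HasFDerivAt (fun s => φ (γ s)) D t := hasMFDerivAt_iff_hasFDerivAt.1 h1
  have h3 : D 1 = vecCoord φ (γ t) v :=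
    congrArg (vecCoord φ (γ t)) (one_smul ℝ v)
  exact h2.hasDerivAt.congr_deriv h3

section

variable [RiemannianBundle (fun x : M => TangentSpace (𝓡 n) x)]

theorem inner_eq_metricForm {φ : OpenPartialHomeomorph M (EuclideanSpace ℝ (Fin n))}
    (hφ : φ.MDifferentiable (𝓡 n) (𝓡 n)) {y : EuclideanSpace ℝ (Fin n)} (hy : y ∈ φ.target)
    (v w : TangentSpace (𝓡 n) (φ.symm y)) :
    inner ℝ v w = metricForm (metricCoord φ) y (vecCoord φ _ v) (vecCoord φ _ w) := by
  conv_lhs => rw [← mfderiv_symm_vecCoord hφ hy v, ← mfderiv_symm_vecCoord hφ hy w,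
    mfderiv_symm_eq_sum, mfderiv_symm_eq_sum]
  rw [sum_inner, metricForm_apply]
  refine Finset.sum_congr rfl fun i _ => ?_
  rw [inner_sum]
  refine Finset.sum_congr rfl fun j _ => ?_
  rw [real_inner_smul_left, real_inner_smul_right, metricCoord, Matrix.of_apply]
  ring

theorem inner_grad (f : M → ℝ) (x : M) (v : TangentSpace (𝓡 n) x) :
    inner ℝ (grad n f x) v = mfderiv (𝓡 n) 𝓘(ℝ, ℝ) f x v := by
  have : FiniteDimensional ℝ (TangentSpace (𝓡 n) x) :=
    inferInstanceAs (FiniteDimensional ℝ (EuclideanSpace ℝ (Fin n)))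
  have : CompleteSpace (TangentSpace (𝓡 n) x) := FiniteDimensional.complete ℝ _
  exact InnerProductSpace.toDual_symm_apply

theorem grad_eq_norm_smul_unitGrad {f : M → ℝ} {x : M} (h : grad n f x ≠ 0) :
    grad n f x = ‖grad n f x‖ • unitGrad n f x := by
  rw [unitGrad, smul_smul, mul_inv_cancel₀ (norm_ne_zero_iff.2 h), one_smul]

theorem fderiv_comp_symm {f : M → ℝ} (hf : ContMDiff (𝓡 n) 𝓘(ℝ, ℝ) ∞ f)
    {φ : OpenPartialHomeomorph M (EuclideanSpace ℝ (Fin n))}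
    (hφ : φ.MDifferentiable (𝓡 n) (𝓡 n)) {y : EuclideanSpace ℝ (Fin n)} (hy : y ∈ φ.target)
    (b : EuclideanSpace ℝ (Fin n)) : fderiv ℝ (fun z => f (φ.symm z)) y b
    = metricForm (metricCoord φ) y (vecCoord φ _ (grad n f (φ.symm y))) b := by
  let D : EuclideanSpace ℝ (Fin n) →L[ℝ] ℝ :=
    (mfderiv (𝓡 n) 𝓘(ℝ, ℝ) f (φ.symm y)).comp (mfderiv (𝓡 n) (𝓡 n) φ.symm y)
  have h1 : HasMFDerivAt (𝓡 n) 𝓘(ℝ, ℝ) (fun z => f (φ.symm z)) y D :=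
    ((hf.mdifferentiable (by norm_num)) (φ.symm y)).hasMFDerivAt.comp y
      (hφ.mdifferentiableAt_symm hy).hasMFDerivAt
  have h3 : HasFDerivAt (fun z => f (φ.symm z)) D y := hasMFDerivAt_iff_hasFDerivAt.1 h1
  rw [h3.fderiv]
  have h2 := inner_grad f (φ.symm y) (mfderiv (𝓡 n) (𝓡 n) φ.symm y b)
  rw [inner_eq_metricForm hφ hy, vecCoord_mfderiv_symm hφ hy] at h2
  exact h2.symm

end

variable [IsManifold (𝓡 n) ∞ M]

theorem mdifferentiable_chartAt (x₀ : M) :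
    (chartAt (EuclideanSpace ℝ (Fin n)) x₀).MDifferentiable (𝓡 n) (𝓡 n) :=
  mdifferentiable_chart x₀

/-- Smoothness of a section is tested in the tangent-bundle trivialisation at `x₀`, which over the
chart domain is the derivative of the chart. -/
theorem contDiffAt_vecCoord {x₀ : M} {U : Set M} (hU : IsOpen U)
    {Y : ∀ x : M, TangentSpace (𝓡 n) x}
    (hY : ContMDiffOn (𝓡 n) (𝓡 n).tangent ∞ (fun x => (⟨x, Y x⟩ : TangentBundle (𝓡 n) M)) U)
    {y : EuclideanSpace ℝ (Fin n)} (hy : y ∈ (chartAt (EuclideanSpace ℝ (Fin n)) x₀).target)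
    (hyU : (chartAt (EuclideanSpace ℝ (Fin n)) x₀).symm y ∈ U) :
    ContDiffAt ℝ ∞ (fun z => vecCoord (chartAt (EuclideanSpace ℝ (Fin n)) x₀)
      ((chartAt (EuclideanSpace ℝ (Fin n)) x₀).symm z)
      (Y ((chartAt (EuclideanSpace ℝ (Fin n)) x₀).symm z))) y := by
  set φ := chartAt (EuclideanSpace ℝ (Fin n)) x₀ with hφ
  have hs : φ.symm y ∈ φ.source := φ.map_target hy
  have h1 : ContMDiffAt (𝓡 n) (𝓡 n).tangent ∞ (fun x => (⟨x, Y x⟩ : TangentBundle (𝓡 n) M))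
    (φ.symm y) := (hY _ hyU).contMDiffAt (hU.mem_nhds hyU)
  have h2 := ((trivializationAt (EuclideanSpace ℝ (Fin n)) (TangentSpace (𝓡 n))
    x₀).contMDiffAt_section_iff (IB := 𝓡 n) (n := ∞) (s := Y) (x₀ := φ.symm y)
    (by simpa [TangentBundle.trivializationAt_baseSet] using hs)).1 h1
  have h3 : ContMDiffAt (𝓡 n) (𝓡 n) ∞ φ.symm y :=
    (contMDiffOn_symm_of_mem_maximalAtlas (IsManifold.chart_mem_maximalAtlas x₀) y
      hy).contMDiffAt (φ.open_target.mem_nhds hy)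
  have h4 := (ContMDiffAt.comp y h2 h3).contDiffAt
  refine h4.congr_of_eventuallyEq ?_
  filter_upwards [φ.open_target.mem_nhds hy] with z hz
  have hzs : φ.symm z ∈ φ.source := φ.map_target hz
  have h5 := congrArg (fun L : EuclideanSpace ℝ (Fin n) →L[ℝ] EuclideanSpace ℝ (Fin n) =>
    L (Y (φ.symm z))) (TangentBundle.continuousLinearMapAt_trivializationAt (I := 𝓡 n) hzs)
  have h6 : (extChartAt (𝓡 n) x₀ : M → EuclideanSpace ℝ (Fin n)) = φ := by
    ext; simp [hφ]
  rw [h6] at h5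
  refine h5.symm.trans ?_
  simp only [Function.comp]
  exact congrFun ((trivializationAt (EuclideanSpace ℝ (Fin n)) (TangentSpace (𝓡 n))
    x₀).coe_linearMapAt_of_mem (R := ℝ)
      (by simpa [TangentBundle.trivializationAt_baseSet] using hzs)) _

variable [RiemannianBundle (fun x : M => TangentSpace (𝓡 n) x)]

/-- An adapted frame field, read in a chart. -/
def frameCoord (φ : OpenPartialHomeomorph M (EuclideanSpace ℝ (Fin n)))
    (F : Fin n → ∀ x : M, TangentSpace (𝓡 n) x) (i : Fin n) (y : EuclideanSpace ℝ (Fin n)) :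
    EuclideanSpace ℝ (Fin n) :=
  vecCoord φ (φ.symm y) (F i (φ.symm y))

variable [NeZero n] {f : M → ℝ} {U : Set M} {F : Fin n → ∀ x : M, TangentSpace (𝓡 n) x}
  {ev : Fin n → M → ℝ}

theorem IsAdaptedFrame.isCoordFrame (hF : IsAdaptedFrame f U F ev) (x₀ : M) :
    IsCoordFrame (metricCoord (chartAt (EuclideanSpace ℝ (Fin n)) x₀))
      (frameCoord (chartAt (EuclideanSpace ℝ (Fin n)) x₀) F)
      ((chartAt (EuclideanSpace ℝ (Fin n)) x₀).target
        ∩ (chartAt (EuclideanSpace ℝ (Fin n)) x₀).symm ⁻¹' U) where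
  isOpen := (chartAt _ x₀).isOpen_inter_preimage_symm hF.isOpen
  symm _ _ _ _ := by
    simp only [metricCoord, Matrix.of_apply]
    exact real_inner_comm _ _
  smooth i _ hy := contDiffAt_vecCoord hF.isOpen (hF.smooth i) hy.1 hy.2
  orthonormal y hy i j := by
    have := inner_eq_metricForm (mdifferentiable_chartAt x₀) hy.1 (F i _) (F j _)
    rw [hF.orthonormal _ hy.2, metricForm_apply] at this
    exact this.symm

theorem IsAdaptedFrame.isSolitonFrame (hn : 4 ≤ n) {lam : ℝ}
    (hf : IsGradientRicciSoliton (n := n) f lam) (hW : HasHarmonicWeyl n M)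
    (hF : IsAdaptedFrame f U F ev) (x₀ : M) :
    IsSolitonFrame (metricForm (metricCoord (chartAt (EuclideanSpace ℝ (Fin n)) x₀)))
      (christoffelMap (metricCoord (chartAt (EuclideanSpace ℝ (Fin n)) x₀)))
      (frameCoord (chartAt (EuclideanSpace ℝ (Fin n)) x₀) F)
      ((chartAt (EuclideanSpace ℝ (Fin n)) x₀).target
        ∩ (chartAt (EuclideanSpace ℝ (Fin n)) x₀).symm ⁻¹' U) 0
      (fun y => f ((chartAt (EuclideanSpace ℝ (Fin n)) x₀).symm y)) lam
      (fun y => ‖grad n f ((chartAt (EuclideanSpace ℝ (Fin n)) x₀).symm y)‖)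
      (fun i y => ev i ((chartAt (EuclideanSpace ℝ (Fin n)) x₀).symm y)) := by
  have hc := hF.isCoordFrame x₀
  set φ := chartAt (EuclideanSpace ℝ (Fin n)) x₀
  have hφ : φ.MDifferentiable (𝓡 n) (𝓡 n) := mdifferentiable_chartAt x₀
  have hmem : φ ∈ IsManifold.maximalAtlas (𝓡 n) ∞ M := IsManifold.chart_mem_maximalAtlas x₀
  have hu : ∀ y ∈ φ.target ∩ φ.symm ⁻¹' U, ContDiffAt ℝ ∞ (fun y => f (φ.symm y)) y :=
    fun y hy => ((hf.smooth _).comp y ((contMDiffOn_symm_of_mem_maximalAtlas hmem y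
      hy.1).contMDiffAt (φ.open_target.mem_nhds hy.1))).contDiffAt
  exact
  { lc := hc.isLeviCivita
    frame := hc.isOrthonormalFrame
    smooth := hu
    soliton := fun y hy a b => hc.hess_eq hy (hu y hy) (hf.equation φ hmem y hy.1) a b
    eigen := fun i y hy b => by
      have h1 := hF.eigen i _ hy.2 φ hmem (φ.map_target hy.1)
        (mfderiv (𝓡 n) (𝓡 n) φ.symm y b)
      rw [inner_eq_metricForm hφ hy.1, ricci, vecCoord_mfderiv_symm hφ hy.1,
        φ.right_inv hy.1] at h1
      rw [hc.ric_apply hy]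
      exact h1
    grad := fun y hy b => by
      have h1 : vecCoord φ (φ.symm y) (grad n f (φ.symm y))
          = ‖grad n f (φ.symm y)‖ • frameCoord φ F 0 y := by
        rw [frameCoord, hF.first _ hy.2, ← vecCoord_smul,
          ← grad_eq_norm_smul_unitGrad (hF.grad_ne_zero _ hy.2)]
      rw [fderiv_comp_symm hf.smooth hφ hy.1, h1, map_smul, smul_apply, smul_eq_mul]
    grad_ne_zero := fun y hy => norm_ne_zero_iff.2 (hF.grad_ne_zero _ hy.2)
    card := by simpa using hn
    div_weyl := fun y hy b c d => hc.sum_weylCov hy (hW φ hmem y hy.1) b c d }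

/-- The flow line that sweeps out x, restricted to times at which it also stays in the chart at x;
it remains in U because U is the union of these flow lines. -/
theorem IsRefinedAdaptedFrame.exists_integralCurve (hF : IsRefinedAdaptedFrame f U F ev) {x : M}
    (hx : x ∈ U) : ∃ (γ : ℝ → M) (a b t₀ : ℝ), t₀ ∈ Set.Ioo a b ∧ γ t₀ = x ∧
      ∀ t ∈ Set.Ioo a b, γ t ∈ U ∧ γ t ∈ (chartAt (EuclideanSpace ℝ (Fin n)) x).source ∧
        HasMFDerivAt 𝓘(ℝ, ℝ) (𝓡 n) γ t ((1 : ℝ →L[ℝ] ℝ).smulRight (F 0 (γ t))) := by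
  obtain ⟨c, ε, θ, D, -, hθ, hD, hU, -⟩ := hF.refined
  obtain ⟨⟨p, t₀⟩, ⟨hp, ht₀⟩, hpx⟩ : x ∈ (fun q : M × ℝ => θ q.1 q.2) '' _ := hU.symm ▸ hx
  simp only at hp ht₀ hpx
  have hDt : IsOpen {t | (p, t) ∈ D} := hθ.isOpen.preimage (by fun_prop)
  have hmem : ∀ t ∈ Set.Ioo (-ε) ε, (p, t) ∈ D := fun t ht => hD ⟨hp, ht⟩
  have hder : ∀ t ∈ Set.Ioo (-ε) ε, HasMFDerivAt 𝓘(ℝ, ℝ) (𝓡 n) (θ p) t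
      ((1 : ℝ →L[ℝ] ℝ).smulRight (unitGrad n f (θ p t))) := fun t ht =>
    (hθ.integralCurve p t (hmem t ht)).hasMFDerivAt (hDt.mem_nhds (hmem t ht))
  have hsrc : ∀ᶠ t in 𝓝 t₀, t ∈ Set.Ioo (-ε) ε
      ∧ θ p t ∈ (chartAt (EuclideanSpace ℝ (Fin n)) x).source :=
    Filter.Eventually.and (isOpen_Ioo.mem_nhds ht₀) ((hder t₀ ht₀).continuousAt.eventually_mem
      ((chartAt _ x).open_source.mem_nhds (by rw [hpx]; exact mem_chart_source _ x)))
  obtain ⟨a, b, hab, hsub⟩ := mem_nhds_iff_exists_Ioo_subset.1 hsrc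
  refine ⟨θ p, a, b, t₀, hab, hpx, fun t ht => ?_⟩
  have hUt : θ p t ∈ U := by
    rw [← hU]
    exact ⟨(p, t), ⟨hp, (hsub ht).1⟩, rfl⟩
  refine ⟨hUt, (hsub ht).2, ?_⟩
  rw [hF.first _ hUt]
  exact hder t (hsub ht).1

end Charts

end RicciSoliton

end

theorem proposition7p1 {n : ℕ} [NeZero n] (hn : 4 ≤ n)
    {M : Type*} [TopologicalSpace M] [T2Space M] [ChartedSpace (EuclideanSpace ℝ (Fin n)) M]
    [IsManifold (𝓡 n) ∞ M]
    [RiemannianBundle (fun x : M => TangentSpace (𝓡 n) x)]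
    [IsContMDiffRiemannianBundle (𝓡 n) ∞ (EuclideanSpace ℝ (Fin n))
      (fun x : M => TangentSpace (𝓡 n) x)]
    (f : M → ℝ) (lam : ℝ)
    (hf : RicciSoliton.IsGradientRicciSoliton (n := n) f lam)
    (hW : RicciSoliton.HasHarmonicWeyl n M)
    (U : Set M) (F : Fin n → ∀ x : M, TangentSpace (𝓡 n) x) (ev : Fin n → M → ℝ)
    (hF : RicciSoliton.IsRefinedAdaptedFrame f U F ev) :
    ∀ x ∈ U, ((fun i : Fin n => ev i x) '' {i | i ≠ 0}).ncard < 3 := by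
  intro x hx
  by_contra! hcon
  obtain ⟨_, _, _, ⟨i, hi, rfl⟩, ⟨j, hj, rfl⟩, ⟨k, hk, rfl⟩, hij, hik, hjk⟩ :=
    (Set.two_lt_ncard_iff).1 hcon
  -- Everything is read in the chart at x = γ(t₀), where the flow line becomes an integral curve of
  -- the coordinate frame vector e_0.
  obtain ⟨γ, a, b, t₀, ht₀, rfl, hγ⟩ := hF.exists_integralCurve hx
  have S := hF.toIsAdaptedFrame.isSolitonFrame hn hf hW (γ t₀)
  have hφ := RicciSoliton.mdifferentiable_chartAt (n := n) (γ t₀)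
  set φ := chartAt (EuclideanSpace ℝ (Fin n)) (γ t₀)
  have hinv : ∀ t ∈ Set.Ioo a b, φ.symm (φ (γ t)) = γ t := fun t ht => φ.left_inv (hγ t ht).2.1
  refine S.not_three_distinct ht₀ (γ := fun t => φ (γ t)) (fun t ht => ?_) (fun t ht => ?_) hi hj
    hk ?_ ?_ ?_
  · refine ⟨φ.map_source (hγ t ht).2.1, ?_⟩
    rw [Set.mem_preimage, hinv t ht]
    exact (hγ t ht).1
  · rw [RicciSoliton.frameCoord, hinv t ht]
    exact RicciSoliton.hasDerivAt_chart_comp hφ (hγ t ht).2.1 (hγ t ht).2.2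
  all_goals
    rw [hinv t₀ ht₀]
    assumption
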